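/- **Setting.** A contact form on a 3-manifold $M$ is a smooth 1-form $\lambda$ with $\lambda\wedge d\lambda$ nowhere zero ($M$ is oriented by $\lambda\wedge d\lambda$, and this orientation depends only on $\ker\lambda$); a contact structure is a plane field $\xi=\ker\lambda$. The Reeb field $X_\lambda$ is given by $d\lambda(X_\lambda,\cdot)=0$, $\lambda(X_\lambda)=1$, with flow $\phi_t$. A (Reeb) orbit of period $T>0$ is a solution $\gamma:\mathbb R/T\mathbb Z\to M$ of $\dot\gamma=X_\lambda(\gamma)$. It is nondegenerate if $1$ is not an eigenvalue of $d\phi_T|_\xi$, and Morse–Bott if it lies in a closed connected submanifold $N\subset M$ foliated by $T$-periodic orbits such that $\ker(d\phi_T(p)-1)=T_pN$ for all $p\in N$; then $N$ is called a Morse–Bott submanifold. (For a simply covered nondegenerate orbit, $N$ is the orbit itself.) An admissible almost complex structure $J$ on $\mathbb R\times M$ is $\mathbb R$-invariant, satisfies $J\partial_a=X_\lambda$, and restricts to $\xi$ as a complex structure compatible with $d\lambda|_\xi$. A $J$-holomorphic map $u=(u_{\mathbb R},u_M):S^2\setminus\{z_1,\dots,z_N\}\to\mathbb R\times M$ has finite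 energy if it is proper and $\sup_\psi\int u^*d(\psi\lambda)<\infty$, the supremum being over smooth $\psi:\mathbb R\to(0,1)$ with $\psi'>0$. **Giroux torsion.** $(M,\xi)$ has Giroux torsion if there is a smooth embedding of $S^1\times S^1\times[0,1]$ into $M$ ($S^1=\mathbb R/\mathbb Z$, coordinates $(x,y,\theta)$) under which $\xi$ becomes $\ker\left[\cos(2\pi\theta)\,dx+\sin(2\pi\theta)\,dy\right]$. **Property $(\star)$.** A closed contact 3-manifold $(M,\xi)$ satisfies property $(\star)$ if there are a contact form $\lambda$ with $\ker\lambda=\xi$, an admissible $J$ on $\mathbb R\times M$, and a finite energy $J$-holomorphic punctured sphere $u=(u_{\mathbb R},u_M):\dot\Sigma=S^2\setminus\{z_1,\dots,z_N\}\to\mathbb R\times M$ such that: 1. $u_M$ is an embedding, and the closure of $u_M(\dot\Sigma)$ is an embedded surface with interior $u_M(\dot\Sigma)$ whose oriented boundary is a disjoint union of simply covered Reeb orbits $\gamma_1,\dots,\gamma_N$, where $u$ is asymptotic to $\gamma_i$ at $z_i$, with $u_{\mathbb R}\to+\infty$ (the asymptotic orbits of $u$). 2. Each asymptotic orbit is nondegenerate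 or Morse–Bott. 3. If $T_1,\dots,T_N$ are the periods of $\gamma_1,\dots,\gamma_N$, then every Reeb orbit not in the same Morse–Bott submanifold with one of these has period strictly greater than $T_1+\dots+T_N$. (An orbit of period $T'$ is in $N$ if it is contained in $N$ and $N$ is foliated by $T'$-periodic orbits; in particular multiple covers of $\gamma_i$ are in the Morse–Bott submanifold of $\gamma_i$.) 4. No asymptotic orbit is nondegenerate with Conley–Zehnder index zero relative to the trivialization of $\xi$ along it given by the direction in $\xi$ that is tangent to the closure of $u_M(\dot\Sigma)$ and points into it. 5. If an asymptotic orbit belongs to a 2-dimensional Morse–Bott submanifold $N$ disjoint from $u_M(\dot\Sigma)$, then $N$ is a torus and contains no other asymptotic orbit of $u$. **Proposition 3.1.** Every closed contact 3-manifold $(M,\xi)$ that has Giroux torsion satisfies property $(\star)$. -/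

import Mathlib

open Set Filter Topology MeasureTheory
open scoped Manifold ContDiff ENNReal

noncomputable section

namespace ContactThree

/-- The model space of smooth 3-manifolds. -/
abbrev E3 : Type := EuclideanSpace ℝ (Fin 3)

section Forms

variable {M : Type*} [TopologicalSpace M] [ChartedSpace E3 M]

/-- The 1-form `lam` pulled back to the Euclidean space by the inverse of the chart around `p`. -/
def formInChart (lam : ∀ p : M, TangentSpace (𝓡 3) p →L[ℝ] ℝ) (p : M) (y : E3) : E3 →L[ℝ] ℝ :=
  (lam ((extChartAt (𝓡 3) p).symm y)).comp
    (mfderiv 𝓘(ℝ, E3) (𝓡 3) (extChartAt (𝓡 3) p).symm y)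

/-- A 1-form is smooth if its coefficients are smooth in every chart. -/
def IsSmoothForm (lam : ∀ p : M, TangentSpace (𝓡 3) p →L[ℝ] ℝ) : Prop :=
  ∀ p : M, ContDiffOn ℝ ∞ (formInChart lam p) (extChartAt (𝓡 3) p).target

/-- The exterior derivative `dlam` at `p`, computed in the chart around `p`:
`dlam(v, w) = ∂_v (lam w) - ∂_w (lam v)` for constant `v`, `w` in the chart. -/
def extD (lam : ∀ p : M, TangentSpace (𝓡 3) p →L[ℝ] ℝ) (p : M)
    (v w : TangentSpace (𝓡 3) p) : ℝ :=
  let v' : E3 := mfderiv (𝓡 3) 𝓘(ℝ, E3) (extChartAt (𝓡 3) p) p v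
  let w' : E3 := mfderiv (𝓡 3) 𝓘(ℝ, E3) (extChartAt (𝓡 3) p) p w
  fderiv ℝ (formInChart lam p) (extChartAt (𝓡 3) p p) v' w' -
    fderiv ℝ (formInChart lam p) (extChartAt (𝓡 3) p p) w' v'

/-- A contact form: a smooth 1-form `lam` such that the 3-form `lam ∧ dlam` vanishes nowhere.
(The orientation of the manifold is the one given by `lam ∧ dlam`, which depends only on
the kernel of `lam`.) -/
structure IsContactForm (lam : ∀ p : M, TangentSpace (𝓡 3) p →L[ℝ] ℝ) : Prop where
  smooth : IsSmoothForm lam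
  contact : ∀ (p : M) (v : Fin 3 → TangentSpace (𝓡 3) p), LinearIndependent ℝ v →
    lam p (v 0) * extD lam p (v 1) (v 2) + lam p (v 1) * extD lam p (v 2) (v 0) +
      lam p (v 2) * extD lam p (v 0) (v 1) ≠ 0

/-- `lam` is a contact form for the plane field `ξ`. -/
def IsContactFormFor (ξ : ∀ p : M, Submodule ℝ (TangentSpace (𝓡 3) p))
    (lam : ∀ p : M, TangentSpace (𝓡 3) p →L[ℝ] ℝ) : Prop :=
  IsContactForm lam ∧ ∀ (p : M) (v : TangentSpace (𝓡 3) p), v ∈ ξ p ↔ lam p v = 0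

/-- A (coorientable) contact structure: the kernel of a contact form. -/
def IsContactStructure (ξ : ∀ p : M, Submodule ℝ (TangentSpace (𝓡 3) p)) : Prop :=
  ∃ lam : ∀ p : M, TangentSpace (𝓡 3) p →L[ℝ] ℝ, IsContactFormFor ξ lam

/-- The Reeb vector field of `lam`: `dlam(X, ·) = 0` and `lam(X) = 1`. -/
def IsReebField (lam : ∀ p : M, TangentSpace (𝓡 3) p →L[ℝ] ℝ)
    (X : ∀ p : M, TangentSpace (𝓡 3) p) : Prop :=
  ∀ p : M, (∀ v : TangentSpace (𝓡 3) p, extD lam p (X p) v = 0) ∧ lam p (X p) = 1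

/-- `φ` is the (global) flow of the vector field `X`. -/
def IsFlowOf (X : ∀ p : M, TangentSpace (𝓡 3) p) (φ : ℝ → M → M) : Prop :=
  ∀ p : M, φ 0 p = p ∧ IsMIntegralCurve (fun t => φ t p) X

end Forms

section Torsion

/-- The slab `ℝ × ℝ × [0,1]`, the universal cover of the thickened torus `S¹ × S¹ × [0,1]`,
where `S¹ = ℝ / ℤ`. -/
def slab : Set (ℝ × ℝ × ℝ) := {q | q.2.2 ∈ Icc (0 : ℝ) 1}

variable {M : Type*} [TopologicalSpace M] [ChartedSpace E3 M]

/-- Giroux torsion: there is a smooth embedding of the thickened torus `S¹ × S¹ × [0,1]`,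
written as a map `F` in the coordinates `(x, y, θ)` of the universal cover, under which `ξ`
becomes the kernel of `cos(2πθ) dx + sin(2πθ) dy`. (The thickened torus being compact, an
embedding of it is the same as an injective immersion.) -/
def HasGirouxTorsion (ξ : ∀ p : M, Submodule ℝ (TangentSpace (𝓡 3) p)) : Prop :=
  ∃ F : ℝ × ℝ × ℝ → M,
    ContMDiffOn 𝓘(ℝ, ℝ × ℝ × ℝ) (𝓡 3) ∞ F slab ∧
    (∀ q ∈ slab, ∀ q' ∈ slab, F q = F q' ↔
      ∃ m n : ℤ, q'.1 = q.1 + m ∧ q'.2.1 = q.2.1 + n ∧ q'.2.2 = q.2.2) ∧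
    (∀ q ∈ slab, Function.Injective (mfderivWithin 𝓘(ℝ, ℝ × ℝ × ℝ) (𝓡 3) F slab q)) ∧
    (∀ q ∈ slab, ∀ v : ℝ × ℝ × ℝ,
      mfderivWithin 𝓘(ℝ, ℝ × ℝ × ℝ) (𝓡 3) F slab q v ∈ ξ (F q) ↔
        Real.cos (2 * Real.pi * q.2.2) * v.1 + Real.sin (2 * Real.pi * q.2.2) * v.2.1 = 0)

end Torsion

section AlmostComplex

variable {M : Type*} [TopologicalSpace M] [ChartedSpace E3 M]

/-- An endomorphism field of `TM`, written in the chart around `p`. -/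
def endoInChart (j : ∀ p : M, TangentSpace (𝓡 3) p →L[ℝ] TangentSpace (𝓡 3) p) (p : M) (y : E3) :
    E3 →L[ℝ] E3 :=
  (mfderiv (𝓡 3) 𝓘(ℝ, E3) (extChartAt (𝓡 3) p) ((extChartAt (𝓡 3) p).symm y)).comp
    ((j ((extChartAt (𝓡 3) p).symm y)).comp
      (mfderiv 𝓘(ℝ, E3) (𝓡 3) (extChartAt (𝓡 3) p).symm y))

/-- `j` is a smooth complex structure on the plane field `ker lam`, compatible with the
symplectic form `dlam` on it; it is extended to `TM` by `j X = 0` on the Reeb field `X`. -/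
structure IsCompatible (lam : ∀ p : M, TangentSpace (𝓡 3) p →L[ℝ] ℝ)
    (X : ∀ p : M, TangentSpace (𝓡 3) p)
    (j : ∀ p : M, TangentSpace (𝓡 3) p →L[ℝ] TangentSpace (𝓡 3) p) : Prop where
  smooth : ∀ p : M, ContDiffOn ℝ ∞ (endoInChart j p) (extChartAt (𝓡 3) p).target
  map_reeb : ∀ p : M, j p (X p) = 0
  map_ker : ∀ (p : M) (v : TangentSpace (𝓡 3) p), lam p v = 0 → lam p (j p v) = 0
  sq : ∀ (p : M) (v : TangentSpace (𝓡 3) p), lam p v = 0 → j p (j p v) = -v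
  invariant : ∀ (p : M) (v w : TangentSpace (𝓡 3) p), lam p v = 0 → lam p w = 0 →
    extD lam p (j p v) (j p w) = extD lam p v w
  pos : ∀ (p : M) (v : TangentSpace (𝓡 3) p), lam p v = 0 → v ≠ 0 → 0 < extD lam p v (j p v)

/-- The almost complex structure `J` on the symplectization `ℝ × M` determined by `j`, at any
point `(a, p)`: the unique `ℝ`-invariant one with `J ∂_a = X`, hence `J X = -∂_a`, and with
`J = j` on `ker lam`. Every admissible almost complex structure is of this form. -/
def sympJ (lam : ∀ p : M, TangentSpace (𝓡 3) p →L[ℝ] ℝ) (X : ∀ p : M, TangentSpace (𝓡 3) p)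
    (j : ∀ p : M, TangentSpace (𝓡 3) p →L[ℝ] TangentSpace (𝓡 3) p) (p : M)
    (V : ℝ × TangentSpace (𝓡 3) p) : ℝ × TangentSpace (𝓡 3) p :=
  (-lam p V.2, V.1 • X p + j p V.2)

/-- The 2-form `d(ψ lam) = ψ' da ∧ lam + ψ dlam` on `ℝ × M` at the point `(a, p)`. -/
def sympForm (lam : ∀ p : M, TangentSpace (𝓡 3) p →L[ℝ] ℝ) (ψ : ℝ → ℝ) (a : ℝ) (p : M)
    (V W : ℝ × TangentSpace (𝓡 3) p) : ℝ :=
  deriv ψ a * (V.1 * lam p W.2 - W.1 * lam p V.2) + ψ a * extD lam p V.2 W.2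

end AlmostComplex

section Sphere

open Classical in
/-- The two standard holomorphic coordinates of the Riemann sphere `ℂ ∪ {∞}`: the coordinate
`ζ ↦ ζ` around `0` (for `false`) and `ζ ↦ 1/ζ` around `∞` (for `true`). -/
def sphereCoord (b : Bool) (ζ : ℂ) : OnePoint ℂ :=
  if b then (if ζ = 0 then OnePoint.infty else ((ζ⁻¹ : ℂ) : OnePoint ℂ)) else (ζ : OnePoint ℂ)

/-- Holomorphic cylindrical coordinates `s + it`, `s → +∞`, `t ∈ ℝ / ℤ`, on a punctured
neighbourhood of the point `z` of the Riemann sphere. -/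
def cylEnd (z : OnePoint ℂ) (s t : ℝ) : OnePoint ℂ :=
  OnePoint.elim z ((Complex.exp (2 * Real.pi * (s + t * Complex.I)) : ℂ) : OnePoint ℂ)
    (fun c : ℂ => ((c + Complex.exp (-(2 * Real.pi * (s + t * Complex.I))) : ℂ) : OnePoint ℂ))

end Sphere

section Curves

variable {M : Type*} [TopologicalSpace M] [ChartedSpace E3 M]

/-- The differential of `u = (uR, uM)` at the point of the sphere with coordinate `ζ`. -/
def curveD (uR : OnePoint ℂ → ℝ) (uM : OnePoint ℂ → M) (b : Bool) (ζ v : ℂ) :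
    ℝ × TangentSpace (𝓡 3) (uM (sphereCoord b ζ)) :=
  (fderiv ℝ (fun ζ => uR (sphereCoord b ζ)) ζ v,
    mfderiv 𝓘(ℝ, ℂ) (𝓡 3) (fun ζ => uM (sphereCoord b ζ)) ζ v)

/-- `u = (uR, uM)` is a smooth `J`-holomorphic map `S² ∖ Γ → ℝ × M`: in the standard
coordinates, `du(i v) = J du(v)`. (The values of `uR`, `uM` on `Γ` play no role.) -/
def IsJHolomorphic (lam : ∀ p : M, TangentSpace (𝓡 3) p →L[ℝ] ℝ)
    (X : ∀ p : M, TangentSpace (𝓡 3) p)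
    (j : ∀ p : M, TangentSpace (𝓡 3) p →L[ℝ] TangentSpace (𝓡 3) p)
    (Γ : Set (OnePoint ℂ)) (uR : OnePoint ℂ → ℝ) (uM : OnePoint ℂ → M) : Prop :=
  ∀ (b : Bool) (ζ : ℂ), sphereCoord b ζ ∉ Γ →
    ContDiffAt ℝ ∞ (fun ζ => uR (sphereCoord b ζ)) ζ ∧
    ContMDiffAt 𝓘(ℝ, ℂ) (𝓡 3) ∞ (fun ζ => uM (sphereCoord b ζ)) ζ ∧
    ∀ v : ℂ, curveD uR uM b ζ (Complex.I * v) =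
      sympJ lam X j (uM (sphereCoord b ζ)) (curveD uR uM b ζ v)

/-- The energy: the supremum of `∫ u^* d(ψ lam)` over all smooth `ψ : ℝ → (0,1)` with `ψ' > 0`.
The integrand is nonnegative for `J`-holomorphic curves; the point `∞` has measure zero. -/
def energy (lam : ∀ p : M, TangentSpace (𝓡 3) p →L[ℝ] ℝ)
    (Γ : Set (OnePoint ℂ)) (uR : OnePoint ℂ → ℝ) (uM : OnePoint ℂ → M) : ℝ≥0∞ :=
  ⨆ (ψ : ℝ → ℝ) (_ : ContDiff ℝ ∞ ψ ∧ ∀ a, 0 < ψ a ∧ ψ a < 1 ∧ 0 < deriv ψ a),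
    ∫⁻ ζ in {ζ : ℂ | (ζ : OnePoint ℂ) ∉ Γ},
      ENNReal.ofReal (sympForm lam ψ (uR (sphereCoord false ζ)) (uM (sphereCoord false ζ))
        (curveD uR uM false ζ 1) (curveD uR uM false ζ Complex.I))

/-- A finite energy `J`-holomorphic punctured sphere: proper and of finite energy. -/
structure IsFiniteEnergyCurve (lam : ∀ p : M, TangentSpace (𝓡 3) p →L[ℝ] ℝ)
    (X : ∀ p : M, TangentSpace (𝓡 3) p)
    (j : ∀ p : M, TangentSpace (𝓡 3) p →L[ℝ] TangentSpace (𝓡 3) p)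
    (Γ : Set (OnePoint ℂ)) (uR : OnePoint ℂ → ℝ) (uM : OnePoint ℂ → M) : Prop where
  holomorphic : IsJHolomorphic lam X j Γ uR uM
  proper : IsProperMap (fun z : ↥Γᶜ => (uR z, uM z))
  energy_lt_top : energy lam Γ uR uM < ⊤

/-- `uM : S² ∖ Γ → M` is an embedding: an immersion and a homeomorphism onto its image. -/
def IsEmbeddedOn (Γ : Set (OnePoint ℂ)) (uM : OnePoint ℂ → M) : Prop :=
  IsEmbedding (fun z : ↥Γᶜ => uM z) ∧
  ∀ (b : Bool) (ζ : ℂ), sphereCoord b ζ ∉ Γ →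
    Function.Injective (mfderiv 𝓘(ℝ, ℂ) (𝓡 3) (fun ζ => uM (sphereCoord b ζ)) ζ)

/-- The curve `u` is asymptotic, at a positive puncture `z`, to the orbit `t ↦ φ t p` of
period `T`: in cylindrical coordinates `uR → +∞` and `uM(s,t) → φ (T t) p`, uniformly in `t`,
as `s → +∞`. -/
def IsAsymptotic (φ : ℝ → M → M) (uR : OnePoint ℂ → ℝ) (uM : OnePoint ℂ → M)
    (z : OnePoint ℂ) (p : M) (T : ℝ) : Prop :=
  ∀ t₀ : ℝ,
    Tendsto (fun q : ℝ × ℝ => uR (cylEnd z q.1 q.2)) (atTop ×ˢ 𝓝 t₀) atTop ∧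
    Tendsto (fun q : ℝ × ℝ => uM (cylEnd z q.1 q.2)) (atTop ×ˢ 𝓝 t₀) (𝓝 (φ (T * t₀) p))

/-- The differential at `p` of a chart `e`, applied to `v`, as a vector of coordinates. -/
def chartD (e : OpenPartialHomeomorph M E3) (p : M) (v : TangentSpace (𝓡 3) p) : E3 :=
  mfderiv (𝓡 3) 𝓘(ℝ, E3) e p v

/-- `e` is a chart of `M` in which the set `S` is the half-plane `{x₀ ≤ 0, x₂ = 0}` and `B ⊆ S`
is its boundary line `{x₀ = 0, x₂ = 0}`: thus `S` is, in the domain of `e`, an embedded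
surface with boundary `B`. -/
def IsBoundaryChart (S B : Set M) (e : OpenPartialHomeomorph M E3) : Prop :=
  e ∈ IsManifold.maximalAtlas (𝓡 3) ∞ M ∧
  ∀ q ∈ e.source, (q ∈ S ↔ e q 0 ≤ 0 ∧ e q 2 = 0) ∧ (q ∈ B ↔ e q 0 = 0 ∧ e q 2 = 0)

/-- In the chart `e`, the coordinates `(x₀, x₁)` are positively oriented on the surface
`uM(S² ∖ Γ)`, oriented by the complex orientation of the sphere. -/
def IsOrientedChart (Γ : Set (OnePoint ℂ)) (uM : OnePoint ℂ → M)
    (e : OpenPartialHomeomorph M E3) : Prop :=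
  ∀ (b : Bool) (ζ : ℂ), sphereCoord b ζ ∉ Γ → uM (sphereCoord b ζ) ∈ e.source →
    let D : ℂ →L[ℝ] E3 := fderiv ℝ (fun ζ => e (uM (sphereCoord b ζ))) ζ
    0 < D 1 0 * D Complex.I 1 - D 1 1 * D Complex.I 0

/-- The closure of `uM(S² ∖ Γ)` is an embedded surface with boundary `B`, with interior
`uM(S² ∖ Γ)`, and along `B` the vector field `X` points in the direction of the boundary
orientation (outward normal first). -/
def ClosureHasOrientedBoundary (X : ∀ p : M, TangentSpace (𝓡 3) p) (Γ : Set (OnePoint ℂ))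
    (uM : OnePoint ℂ → M) (B : Set M) : Prop :=
  closure (uM '' Γᶜ) = uM '' Γᶜ ∪ B ∧ Disjoint (uM '' Γᶜ) B ∧
  ∀ p ∈ B, ∃ e : OpenPartialHomeomorph M E3, p ∈ e.source ∧
    IsBoundaryChart (closure (uM '' Γᶜ)) B e ∧ IsOrientedChart Γ uM e ∧
    0 < chartD e p (X p) 1

/-- `v` is tangent at the boundary point `p` to the surface `S` with boundary `B`, and points
strictly into `S`. -/
def IsInward (S B : Set M) (p : M) (v : TangentSpace (𝓡 3) p) : Prop :=
  ∃ e : OpenPartialHomeomorph M E3, p ∈ e.source ∧ IsBoundaryChart S B e ∧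
    chartD e p v 0 < 0 ∧ chartD e p v 2 = 0

end Curves

section Orbits

variable {M : Type*} [TopologicalSpace M] [ChartedSpace E3 M] [IsManifold (𝓡 3) ∞ M]

/-- `t ↦ φ t p` is a periodic orbit of the flow `φ`, of (not necessarily minimal) period `T`. -/
def IsPeriodicOrbit (φ : ℝ → M → M) (p : M) (T : ℝ) : Prop :=
  0 < T ∧ φ T p = p

/-- The periodic orbit of period `T` through `p` is simply covered: `T` is its minimal period. -/
def IsSimplyCovered (φ : ℝ → M → M) (p : M) (T : ℝ) : Prop :=
  ∀ t : ℝ, 0 < t → t < T → φ t p ≠ p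

/-- The linearized flow at time `t` at the point `p`. -/
def linFlow (φ : ℝ → M → M) (t : ℝ) (p : M) (v : TangentSpace (𝓡 3) p) :
    TangentSpace (𝓡 3) (φ t p) :=
  mfderiv (𝓡 3) (𝓡 3) (φ t) p v

/-- For `φ T p = p`: the vector `v` at `p` is fixed by the linearized flow at time `T`. -/
def IsFixedVector (φ : ℝ → M → M) (T : ℝ) (p : M) (v : TangentSpace (𝓡 3) p) : Prop :=
  (linFlow φ T p v : E3) = (v : E3)

/-- The orbit of period `T` through `p` is nondegenerate: `1` is not an eigenvalue of the
linearized flow at time `T` on the contact plane at `p`. -/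
def IsNondegenerate (lam : ∀ p : M, TangentSpace (𝓡 3) p →L[ℝ] ℝ) (φ : ℝ → M → M)
    (p : M) (T : ℝ) : Prop :=
  ∀ v : TangentSpace (𝓡 3) p, lam p v = 0 → IsFixedVector φ T p v → v = 0

/-- `N` is a Morse-Bott submanifold of dimension `k` for the period `T`: a closed (that is,
compact without boundary) connected embedded submanifold, foliated by orbits of period `T`,
such that at each `p ∈ N` the `1`-eigenspace of the linearized flow at time `T` is exactly
`T_p N`. The submanifold and its tangent space are described by charts in which `N` is the
coordinate subspace of the first `k` coordinates. For `k = 1` this means that `N` is a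
nondegenerate orbit. -/
structure IsMorseBott (φ : ℝ → M → M) (T : ℝ) (k : ℕ) (N : Set M) : Prop where
  dim_le : k ≤ 3
  compact : IsCompact N
  connected : IsConnected N
  foliated : ∀ p ∈ N, IsPeriodicOrbit φ p T ∧ ∀ t : ℝ, φ t p ∈ N
  eigenspace : ∀ p ∈ N, ∃ e ∈ IsManifold.maximalAtlas (𝓡 3) ∞ M, p ∈ e.source ∧
    (∀ q ∈ e.source, q ∈ N ↔ ∀ i : Fin 3, k ≤ (i : ℕ) → e q i = 0) ∧
    ∀ v : TangentSpace (𝓡 3) p, IsFixedVector φ T p v ↔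
      ∀ i : Fin 3, k ≤ (i : ℕ) → chartD e p v i = 0

/-- `δ` is the rotation number, over the time interval `[0, T]`, of the vector `v` in the contact
plane at `p` under the linearized flow, measured in the complex frame `η` of the contact planes
along the orbit of `p`: the total change of the argument, divided by `2π`. -/
def HasRotation (j : ∀ p : M, TangentSpace (𝓡 3) p →L[ℝ] TangentSpace (𝓡 3) p)
    (φ : ℝ → M → M) (p : M) (T : ℝ) (η : ∀ t : ℝ, TangentSpace (𝓡 3) (φ t p))
    (v : TangentSpace (𝓡 3) p) (δ : ℝ) : Prop :=
  ∃ r ϑ : ℝ → ℝ, ContinuousOn ϑ (Icc 0 T) ∧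
    (∀ t ∈ Icc (0 : ℝ) T, 0 < r t ∧
      linFlow φ t p v =
        r t • (Real.cos (ϑ t) • η t + Real.sin (ϑ t) • j (φ t p) (η t))) ∧
    ϑ T - ϑ 0 = 2 * Real.pi * δ

/-- `μ` is the Conley-Zehnder index of the nondegenerate orbit of period `T` through `p`, in the
trivialization `η`. The rotation numbers of all nonzero vectors of the contact plane fill an
interval of length less than `1/2`; the index is `2k` if the interval contains the integer `k`,
and `2k + 1` if it lies strictly between the integers `k` and `k + 1`. -/
def HasConleyZehnderIndex (lam : ∀ p : M, TangentSpace (𝓡 3) p →L[ℝ] ℝ)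
    (j : ∀ p : M, TangentSpace (𝓡 3) p →L[ℝ] TangentSpace (𝓡 3) p)
    (φ : ℝ → M → M) (p : M) (T : ℝ) (η : ∀ t : ℝ, TangentSpace (𝓡 3) (φ t p))
    (μ : ℤ) : Prop :=
  ∃ k : ℤ,
    (μ = 2 * k ∧ ∃ v : TangentSpace (𝓡 3) p, lam p v = 0 ∧ v ≠ 0 ∧
      HasRotation j φ p T η v k) ∨
    (μ = 2 * k + 1 ∧ ∀ v : TangentSpace (𝓡 3) p, lam p v = 0 → v ≠ 0 →
      ∃ δ : ℝ, (k : ℝ) < δ ∧ δ < k + 1 ∧ HasRotation j φ p T η v δ)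

/-- `η` is the natural trivialization, along the boundary orbit of period `T` through `p`, that
is determined by the surface `S` with boundary `B`: a continuous periodic section of the contact
planes, tangent to `S` and pointing into `S`. It is unique up to a positive factor. -/
structure IsNaturalFrame (lam : ∀ p : M, TangentSpace (𝓡 3) p →L[ℝ] ℝ) (φ : ℝ → M → M)
    (S B : Set M) (p : M) (T : ℝ) (η : ∀ t : ℝ, TangentSpace (𝓡 3) (φ t p)) : Prop where
  continuous : Continuous (fun t => (⟨φ t p, η t⟩ : TangentBundle (𝓡 3) M))
  periodic : ∀ t : ℝ, (η (t + T) : E3) = (η t : E3)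
  mem_ker : ∀ t : ℝ, lam (φ t p) (η t) = 0
  inward : ∀ t : ℝ, IsInward S B (φ t p) (η t)

/-- The orbit of `φ` through `p`, as a set. -/
def orbitSet (φ : ℝ → M → M) (p : M) : Set M := range (fun t => φ t p)

/-- Property `(⋆)` of the contact structure `ξ`. The data are: a contact form `lam` for `ξ`, with
Reeb field `X` and Reeb flow `φ`; an admissible almost complex structure, given by `j`; a finite
energy punctured sphere `u = (uR, uM)` with punctures `z i`; its asymptotic orbits, through the
points `p i`, with periods `T i`; and the Morse-Bott submanifolds `N i`, of dimension `k i`, that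
contain these orbits. (`N i` is determined by the orbit: it is a connected component of the
fixed point set of `φ (T i)`. Nondegenerate orbits are the case `k i = 1`.) -/
def PropertyStar (ξ : ∀ p : M, Submodule ℝ (TangentSpace (𝓡 3) p)) : Prop :=
  ∃ (lam : ∀ p : M, TangentSpace (𝓡 3) p →L[ℝ] ℝ) (X : ∀ p : M, TangentSpace (𝓡 3) p)
    (φ : ℝ → M → M) (j : ∀ p : M, TangentSpace (𝓡 3) p →L[ℝ] TangentSpace (𝓡 3) p)
    (n : ℕ) (z : Fin n → OnePoint ℂ) (uR : OnePoint ℂ → ℝ) (uM : OnePoint ℂ → M)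
    (p : Fin n → M) (T : Fin n → ℝ) (N : Fin n → Set M) (k : Fin n → ℕ),
    IsContactFormFor ξ lam ∧ IsReebField lam X ∧ IsFlowOf X φ ∧ IsCompatible lam X j ∧
    Function.Injective z ∧ IsFiniteEnergyCurve lam X j (range z) uR uM ∧
    -- the asymptotic orbits of `u`
    (∀ i, IsPeriodicOrbit φ (p i) (T i) ∧ IsSimplyCovered φ (p i) (T i) ∧
      IsAsymptotic φ uR uM (z i) (p i) (T i)) ∧
    -- `uM` is an embedding, and its closure is an embedded surface whose oriented boundary is
    -- the disjoint union of the asymptotic orbits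
    IsEmbeddedOn (range z) uM ∧
    (∀ i i', i ≠ i' → Disjoint (orbitSet φ (p i)) (orbitSet φ (p i'))) ∧
    ClosureHasOrientedBoundary X (range z) uM (⋃ i, orbitSet φ (p i)) ∧
    -- each asymptotic orbit is nondegenerate or Morse-Bott
    (∀ i, IsMorseBott φ (T i) (k i) (N i) ∧ p i ∈ N i) ∧
    -- every orbit that is not in the same Morse-Bott submanifold with an asymptotic orbit (an
    -- orbit of period `T'` is in `N i` if it lies in `N i` and `N i` is foliated by orbits of
    -- period `T'`; covers of the asymptotic orbits are of this kind) has large period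
    (∀ (q : M) (T' : ℝ), IsPeriodicOrbit φ q T' →
      (∀ i, ¬ (q ∈ N i ∧ ∀ q' ∈ N i, φ T' q' = q')) → ∑ i, T i < T') ∧
    -- no asymptotic orbit is nondegenerate with Conley-Zehnder index zero
    (∀ i, IsNondegenerate lam φ (p i) (T i) →
      ∀ η : ∀ t : ℝ, TangentSpace (𝓡 3) (φ t (p i)),
        IsNaturalFrame lam φ (closure (uM '' (range z)ᶜ)) (⋃ i, orbitSet φ (p i))
          (p i) (T i) η →
        ¬ HasConleyZehnderIndex lam j φ (p i) (T i) η 0) ∧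
    -- a two-dimensional Morse-Bott submanifold disjoint from `uM` is a torus and contains only
    -- one asymptotic orbit
    (∀ i, k i = 2 → Disjoint (N i) (uM '' (range z)ᶜ) →
      Nonempty (↥(N i) ≃ₜ Circle × Circle) ∧ ∀ i', i' ≠ i → Disjoint (orbitSet φ (p i')) (N i))

end Orbits

end ContactThree

end

/-!
Giroux torsion yields a finite energy cylinder whose two asymptotic orbits are the shortest
Reeb orbits.

On the thickened torus a contact form for `ξ` is `f(θ) dx + g(θ) dy`, where the curve `(f, g)` may
be any curve that winds around the origin with the same angle `2πθ`. Its Reeb field is tangent to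
the tori of constant `θ` and has the direction `(g', -f')`, so that it is vertical exactly where
`g' = 0`. For `(f, g)` an ellipse `f² + g² / ε² = 1`, this happens at `θ = 1/4` and `θ = 3/4`; these
two tori are Morse-Bott, they are foliated by orbits of period `ε`, and the orbits at `θ = 1/4` and
at `θ = 3/4` run in opposite directions. Every other closed orbit in the thickened torus has to wind
around the `x`-direction, and therefore has period at least `2/3`.

The ellipse has to be joined to the given contact structure at the two ends of the thickened torus,
without creating short orbits. For this one starts with a contact form which restricts to the
standard form on the boundary tori (`IsTorsionMap.exists_normalized_contactForm`). It is
interpolated, in collars of width `δ`, with the standard form (`interp`), and this form is deformed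
to the ellipse a little further inside (`prof`). Away from the deformed part the resulting Reeb
fields are bounded and locally transverse to a hyperplane, uniformly in `δ`
(`exists_torsVec_interp_bound`), so that a compactness argument bounds the periods of the orbits there
from below by some `c` that is independent of `ε` and `δ`
(`IsTorsionMap.exists_uniform_period_bound`). Choosing `ε` with `2 ε < c` and then `δ` small, all
closed orbits except those in the two critical tori have period greater than `2 ε`
(`IsTorsionMap.exists_adapted`).

A compatible almost complex structure `j` with `j ∂_θ = (ρ³ / ε) (- sin ∂_x + cos ∂_y)` in the middle
of the thickened torus (`IsAdapted.exists_compatible`) makes the annulus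
`x = 0`, `1/4 < θ < 3/4` the projection of a holomorphic cylinder, which is given explicitly, in the
coordinate `σ + iτ = log ζ`, by

  `θ = 1/2 - arctan (ε sinh σ) / 2π`, `y = τ / 2π`, `a = ε log (cosh σ) / 2π`

(`strip`, `hgt`, `stripD_I_mul`). At the punctures `∞` and `0` it is asymptotic to one orbit in each
of the critical tori, with `a → +∞`, and its energy is at most `2 ε` (`IsAdapted.energy_lt_top`). The
asymptotic orbits are degenerate, as `∂_x` is fixed by the linearized flow, so the condition on
Conley-Zehnder indices is vacuous; and they lie in two disjoint tori.
-/

noncomputable section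

namespace ContactThree

/-! ### Differentials and exterior derivatives in charts -/

section Calculus

variable {M : Type*} [TopologicalSpace M] [ChartedSpace E3 M]
variable {E' : Type*} [NormedAddCommGroup E'] [NormedSpace ℝ E']

/-- The differential at `r` of the chart around `p`, as an endomorphism of the model space. -/
def chD (p r : M) : E3 →L[ℝ] E3 := mfderiv (𝓡 3) 𝓘(ℝ, E3) (extChartAt (𝓡 3) p) r

/-- The differential at `q` of a map `G` from a normed space to `M`; the tangent spaces of `M` are
identified with the model space. -/
def rawD (G : E' → M) (q : E') : E' →L[ℝ] E3 := mfderiv 𝓘(ℝ, E') (𝓡 3) G q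

/-- The value at `p` of a 1-form, as a functional on the model space. -/
def rawF (lam : ∀ p : M, TangentSpace (𝓡 3) p →L[ℝ] ℝ) (p : M) : E3 →L[ℝ] ℝ := lam p

/-- The exterior derivative at `p` of a 1-form, as a function on the model space. -/
def rawE (lam : ∀ p : M, TangentSpace (𝓡 3) p →L[ℝ] ℝ) (p : M) (v w : E3) : ℝ := extD lam p v w

/-- The pullback of the 1-form `lam` by the map `G`. -/
def pullForm (lam : ∀ p : M, TangentSpace (𝓡 3) p →L[ℝ] ℝ) (G : E' → M) (q : E') : E' →L[ℝ] ℝ :=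
  (rawF lam (G q)).comp (rawD G q)

/-- The exterior derivative of a 1-form on a normed space. -/
def dOne (A : E' → E' →L[ℝ] ℝ) (q v w : E') : ℝ := fderiv ℝ A q v w - fderiv ℝ A q w v

theorem rawE_eq_dOne (lam : ∀ p : M, TangentSpace (𝓡 3) p →L[ℝ] ℝ) (p : M) (v w : E3) :
    rawE lam p v w =
      dOne (formInChart lam p) (extChartAt (𝓡 3) p p) (chD p p v) (chD p p w) := rfl

variable [IsManifold (𝓡 3) ∞ M]

omit [IsManifold (𝓡 3) ∞ M] in
theorem isOpen_chart_target (p : M) : IsOpen (extChartAt (𝓡 3) p).target :=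
  isOpen_extChartAt_target p

theorem chD_comp_rawD_symm (p : M) {y : E3} (hy : y ∈ (extChartAt (𝓡 3) p).target) (v : E3) :
    chD p ((extChartAt (𝓡 3) p).symm y) (rawD (extChartAt (𝓡 3) p).symm y v) = v := by
  have : IsManifold (𝓡 3) 1 M := .of_le (n := ∞) (by simp)
  have h := mfderiv_extChartAt_comp_mfderivWithin_extChartAt_symm (I := 𝓡 3) (x := p) hy
  have h2 := congrArg (fun L : E3 →L[ℝ] E3 => L v) h
  have hr : range (𝓡 3) = univ := ModelWithCorners.Boundaryless.range_eq_univ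
  rw [hr, mfderivWithin_univ] at h2
  exact h2

theorem rawD_symm_comp_chD (p : M) {r : M} (hr : r ∈ (extChartAt (𝓡 3) p).source) (v : E3) :
    rawD (extChartAt (𝓡 3) p).symm (extChartAt (𝓡 3) p r) (chD p r v) = v := by
  have : IsManifold (𝓡 3) 1 M := .of_le (n := ∞) (by simp)
  have h := mfderivWithin_extChartAt_symm_comp_mfderiv_extChartAt' (I := 𝓡 3) (x := p)
    (y := r) hr
  have h2 := congrArg (fun L : E3 →L[ℝ] E3 => L v) h
  have hr : range (𝓡 3) = univ := ModelWithCorners.Boundaryless.range_eq_univ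
  rw [hr, mfderivWithin_univ] at h2
  exact h2

theorem chD_comp_rawD {G : E' → M} {q : E'} {p : M}
    (hG : MDifferentiableAt 𝓘(ℝ, E') (𝓡 3) G q) (hq : G q ∈ (extChartAt (𝓡 3) p).source) (v : E') :
    chD p (G q) (rawD G q v) = fderiv ℝ (extChartAt (𝓡 3) p ∘ G) q v := by
  have : IsManifold (𝓡 3) 1 M := .of_le (n := ∞) (by simp)
  have h1 : MDifferentiableAt (𝓡 3) 𝓘(ℝ, E3) (extChartAt (𝓡 3) p) (G q) :=
    mdifferentiableAt_extChartAt (by simpa using hq)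
  have := mfderiv_comp q h1 hG
  rw [mfderiv_eq_fderiv] at this
  exact (congrArg (fun L : E' →L[ℝ] E3 => L v) this).symm

theorem rawD_eq {G : E' → M} {q : E'} {p : M}
    (hG : MDifferentiableAt 𝓘(ℝ, E') (𝓡 3) G q) (hq : G q ∈ (extChartAt (𝓡 3) p).source) (v : E') :
    rawD G q v = rawD (extChartAt (𝓡 3) p).symm (extChartAt (𝓡 3) p (G q))
      (fderiv ℝ (extChartAt (𝓡 3) p ∘ G) q v) := by
  rw [← chD_comp_rawD hG hq, rawD_symm_comp_chD p hq]

theorem contDiffAt_chart_comp {G : E' → M} {q : E'} {p : M} 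
    (hG : ContMDiffAt 𝓘(ℝ, E') (𝓡 3) ∞ G q) (hq : G q ∈ (extChartAt (𝓡 3) p).source) :
    ContDiffAt ℝ ∞ (extChartAt (𝓡 3) p ∘ G) q := by
  have h1 : ContMDiffAt (𝓡 3) 𝓘(ℝ, E3) ∞ (extChartAt (𝓡 3) p) (G q) :=
    contMDiffAt_extChartAt' (by simpa using hq)
  exact (h1.comp q hG).contDiffAt

theorem contMDiffAt_chart_symm (p : M) {y : E3} (hy : y ∈ (extChartAt (𝓡 3) p).target) :
    ContMDiffAt 𝓘(ℝ, E3) (𝓡 3) ∞ (extChartAt (𝓡 3) p).symm y :=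
  (contMDiffOn_extChartAt_symm p).contMDiffAt ((isOpen_chart_target p).mem_nhds hy)

theorem eventually_mdifferentiableAt {G : E' → M} {q : E'}
    (hG : ContMDiffAt 𝓘(ℝ, E') (𝓡 3) ∞ G q) :
    ∀ᶠ q' in 𝓝 q, MDifferentiableAt 𝓘(ℝ, E') (𝓡 3) G q' := by
  have : IsManifold (𝓡 3) 1 M := .of_le (n := ∞) (by simp)
  have h1 : ContMDiffAt 𝓘(ℝ, E') (𝓡 3) 1 G q := hG.of_le (by simp)
  have := (contMDiffAt_iff_contMDiffAt_nhds (by simp)).1 h1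
  exact this.mono fun q' h => h.mdifferentiableAt (by simp)

variable {lam : ∀ p : M, TangentSpace (𝓡 3) p →L[ℝ] ℝ}

theorem pullForm_eventuallyEq {G : E' → M} {q : E'} {p : M}
    (hG : ContMDiffAt 𝓘(ℝ, E') (𝓡 3) ∞ G q) (hq : G q ∈ (extChartAt (𝓡 3) p).source) :
    pullForm lam G =ᶠ[𝓝 q] fun q' => (formInChart lam p ((extChartAt (𝓡 3) p ∘ G) q')).comp
      (fderiv ℝ (extChartAt (𝓡 3) p ∘ G) q') := by
  have hs : ∀ᶠ q' in 𝓝 q, G q' ∈ (extChartAt (𝓡 3) p).source :=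
    hG.continuousAt.eventually ((isOpen_extChartAt_source p).mem_nhds hq)
  filter_upwards [eventually_mdifferentiableAt hG, hs] with q' h1 h2
  ext v
  have := rawD_eq h1 h2 v
  have h3 : (extChartAt (𝓡 3) p).symm (extChartAt (𝓡 3) p (G q')) = G q' :=
    (extChartAt (𝓡 3) p).left_inv h2
  change rawF lam (G q') (rawD G q' v) = rawF lam _ (rawD _ _ _)
  rw [this, Function.comp_apply, h3]
  rfl

/-- Naturality of the exterior derivative: `d (G^* lam) = G^* (d lam)`. -/
theorem dOne_pullForm (hlam : IsSmoothForm lam) {G : E' → M} {q : E'}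
    (hG : ContMDiffAt 𝓘(ℝ, E') (𝓡 3) ∞ G q) (v w : E') :
    dOne (pullForm lam G) q v w = rawE lam (G q) (rawD G q v) (rawD G q w) := by
  set p := G q with hp
  have hq : G q ∈ (extChartAt (𝓡 3) p).source := mem_extChartAt_source _
  have hg := contDiffAt_chart_comp hG hq
  have h1 : ContDiffAt ℝ ∞ (formInChart lam p) ((extChartAt (𝓡 3) p ∘ G) q) :=
    (hlam p).contDiffAt ((isOpen_chart_target _).mem_nhds
      ((extChartAt (𝓡 3) p).map_source hq))
  have hmd := hG.mdifferentiableAt (by simp)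
  have hg' : DifferentiableAt ℝ (fderiv ℝ (extChartAt (𝓡 3) p ∘ G)) q :=
    (hg.fderiv_right (m := 1) (by norm_cast)).differentiableAt (by simp)
  have hA : DifferentiableAt ℝ (fun q' => formInChart lam p ((extChartAt (𝓡 3) p ∘ G) q')) q :=
    ((h1.differentiableAt (by simp)).comp q (hg.differentiableAt (by simp)))
  have hAd : ∀ v, fderiv ℝ (fun q' => formInChart lam p ((extChartAt (𝓡 3) p ∘ G) q')) q v =
      fderiv ℝ (formInChart lam p) (extChartAt (𝓡 3) p p)
        (fderiv ℝ (extChartAt (𝓡 3) p ∘ G) q v) := by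
    intro v
    have := fderiv_comp q (h1.differentiableAt (by simp)) (hg.differentiableAt (by simp))
    exact congrArg (fun L : E' →L[ℝ] E3 →L[ℝ] ℝ => L v) this
  have hsymm : IsSymmSndFDerivAt ℝ (extChartAt (𝓡 3) p ∘ G) q :=
    hg.isSymmSndFDerivAt (by
    simpa using WithTop.coe_le_coe.2 (le_top : (2 : ℕ∞) ≤ ⊤))
  rw [rawE_eq_dOne]
  unfold dOne
  rw [(pullForm_eventuallyEq hG hq).fderiv_eq, fderiv_clm_comp hA hg',
    chD_comp_rawD hmd hq, chD_comp_rawD hmd hq]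
  simp only [add_apply, ContinuousLinearMap.comp_apply,
    ContinuousLinearMap.compL_apply, ContinuousLinearMap.flip_apply, hAd]
  rw [hsymm.eq v w]
  ring

end Calculus

/-! ### The Reeb field and the contact plane in Euclidean space -/

section VectorCalculus

/-- The standard basis of the model space. -/
def eb (i : Fin 3) : E3 := EuclideanSpace.single i 1

theorem eb_apply (i k : Fin 3) : eb i k = if k = i then 1 else 0 := by
  simp [eb, PiLp.single_apply]

theorem eq_sum_eb (v : E3) : v = v 0 • eb 0 + v 1 • eb 1 + v 2 • eb 2 := by
  ext k
  fin_cases k <;> simp [eb_apply]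

theorem clm_apply_eq {F : Type*} [NormedAddCommGroup F] [NormedSpace ℝ F] (A : E3 →L[ℝ] F)
    (v : E3) : A v = v 0 • A (eb 0) + v 1 • A (eb 1) + v 2 • A (eb 2) := by
  conv_lhs => rw [eq_sum_eb v]
  simp

/-- The curl of a 1-form on Euclidean space: the vector that represents its exterior derivative. -/
def curl (A : E3 → E3 →L[ℝ] ℝ) (y : E3) : E3 :=
  dOne A y (eb 1) (eb 2) • eb 0 + dOne A y (eb 2) (eb 0) • eb 1 + dOne A y (eb 0) (eb 1) • eb 2

section
variable {E' : Type*} [NormedAddCommGroup E'] [NormedSpace ℝ E'] (A : E' → E' →L[ℝ] ℝ) (y : E')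

theorem dOne_swap (v w : E') : dOne A y v w = -dOne A y w v := by simp [dOne]

theorem dOne_add_left (v v' w : E') : dOne A y (v + v') w = dOne A y v w + dOne A y v' w := by
  simp [dOne]; ring

theorem dOne_smul_left (a : ℝ) (v w : E') : dOne A y (a • v) w = a * dOne A y v w := by
  simp [dOne]; ring

theorem dOne_add_right (v w w' : E') : dOne A y v (w + w') = dOne A y v w + dOne A y v w' := by
  simp [dOne]; ring

theorem dOne_smul_right (a : ℝ) (v w : E') : dOne A y v (a • w) = a * dOne A y v w := by
  simp [dOne]; ring

theorem dOne_self (v : E') : dOne A y v v = 0 := by simp [dOne]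

end

theorem dOne_eq_curl (A : E3 → E3 →L[ℝ] ℝ) (y v w : E3) : dOne A y v w =
    curl A y 0 * (v 1 * w 2 - v 2 * w 1) + curl A y 1 * (v 2 * w 0 - v 0 * w 2) +
      curl A y 2 * (v 0 * w 1 - v 1 * w 0) := by
  conv_lhs => rw [eq_sum_eb v, eq_sum_eb w]
  simp only [dOne_add_left, dOne_add_right, dOne_smul_left, dOne_smul_right, dOne_self]
  simp only [curl, PiLp.add_apply, PiLp.smul_apply, eb_apply]
  rw [dOne_swap A y (eb 1) (eb 0), dOne_swap A y (eb 2) (eb 1), dOne_swap A y (eb 0) (eb 2)]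
  simp
  ring

theorem contDiffAt_curl {A : E3 → E3 →L[ℝ] ℝ} {y : E3} (hA : ContDiffAt ℝ ∞ A y) :
    ContDiffAt ℝ ∞ (curl A) y := by
  have h : ContDiffAt ℝ ∞ (fderiv ℝ A) y := hA.fderiv_right (by simp)
  unfold curl dOne
  fun_prop

/-- The Reeb field of a contact form on Euclidean space. -/
def reebVec (A : E3 → E3 →L[ℝ] ℝ) (y : E3) : E3 := (A y (curl A y))⁻¹ • curl A y

theorem contDiffAt_reebVec {A : E3 → E3 →L[ℝ] ℝ} {y : E3} (hA : ContDiffAt ℝ ∞ A y)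
    (h : A y (curl A y) ≠ 0) : ContDiffAt ℝ ∞ (reebVec A) y := by
  have h1 := contDiffAt_curl hA
  exact ((hA.clm_apply h1).inv h).smul h1

theorem dOne_reebVec (A : E3 → E3 →L[ℝ] ℝ) (y w : E3) : dOne A y (reebVec A y) w = 0 := by
  rw [reebVec, dOne_smul_left, dOne_eq_curl]
  ring_nf

theorem apply_reebVec {A : E3 → E3 →L[ℝ] ℝ} {y : E3} (h : A y (curl A y) ≠ 0) :
    A y (reebVec A y) = 1 := by
  simp [reebVec, h]

/-- The 2-dimensional cross product structure on the kernel of a contact form: a field of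
endomorphisms `B` with `dA (v, B w) = ⟪v, w⟫` on the kernel and `B R = 0` on the Reeb field. -/
def crossEndo (A : E3 → E3 →L[ℝ] ℝ) (y : E3) : E3 →L[ℝ] E3 :=
  (A y (curl A y))⁻¹ •
    (((A y (eb 1)) • (EuclideanSpace.proj 2 : E3 →L[ℝ] ℝ) -
        (A y (eb 2)) • (EuclideanSpace.proj 1 : E3 →L[ℝ] ℝ)).smulRight (eb 0) +
     ((A y (eb 2)) • (EuclideanSpace.proj 0 : E3 →L[ℝ] ℝ) -
        (A y (eb 0)) • (EuclideanSpace.proj 2 : E3 →L[ℝ] ℝ)).smulRight (eb 1) +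
     ((A y (eb 0)) • (EuclideanSpace.proj 1 : E3 →L[ℝ] ℝ) -
        (A y (eb 1)) • (EuclideanSpace.proj 0 : E3 →L[ℝ] ℝ)).smulRight (eb 2)) ∘L
    (ContinuousLinearMap.id ℝ E3 - (A y).smulRight (reebVec A y))

theorem contDiffAt_crossEndo {A : E3 → E3 →L[ℝ] ℝ} {y : E3} (hA : ContDiffAt ℝ ∞ A y)
    (h : A y (curl A y) ≠ 0) : ContDiffAt ℝ ∞ (crossEndo A) y := by
  have h1 := contDiffAt_reebVec hA h
  have h2 := (hA.clm_apply (contDiffAt_curl hA)).inv h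
  have h3 : ∀ i, ContDiffAt ℝ ∞ (fun y => A y (eb i)) y := fun i =>
    hA.clm_apply contDiffAt_const
  have h4 : ∀ (i j k : Fin 3), ContDiffAt ℝ ∞ (fun y =>
      ((A y (eb i)) • (EuclideanSpace.proj j : E3 →L[ℝ] ℝ) -
        (A y (eb j)) • (EuclideanSpace.proj i : E3 →L[ℝ] ℝ)).smulRight (eb k)) y := by
    intro i j k
    exact (((h3 i).smul contDiffAt_const).sub ((h3 j).smul contDiffAt_const)).smulRight
      contDiffAt_const
  have h5 : ContDiffAt ℝ ∞ (fun y => ContinuousLinearMap.id ℝ E3 -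
      (A y).smulRight (reebVec A y)) y := contDiffAt_const.sub (hA.smulRight h1)
  exact (h2.smul (((h4 1 2 0).add (h4 2 0 1)).add (h4 0 1 2))).clm_comp h5

theorem crossEndo_apply_ker {A : E3 → E3 →L[ℝ] ℝ} {y v : E3} (hv : A y v = 0) :
    crossEndo A y v = (A y (curl A y))⁻¹ • ((A y (eb 1) * v 2 - A y (eb 2) * v 1) • eb 0 +
      (A y (eb 2) * v 0 - A y (eb 0) * v 2) • eb 1 +
      (A y (eb 0) * v 1 - A y (eb 1) * v 0) • eb 2) := by
  simp [crossEndo, hv]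

theorem crossEndo_reebVec {A : E3 → E3 →L[ℝ] ℝ} {y : E3} (h : A y (curl A y) ≠ 0) :
    crossEndo A y (reebVec A y) = 0 := by
  simp [crossEndo, apply_reebVec h]

theorem apply_crossEndo (A : E3 → E3 →L[ℝ] ℝ) (y v : E3) : A y (crossEndo A y v) = 0 := by
  simp only [crossEndo, ContinuousLinearMap.comp_apply, smul_apply,
    add_apply, ContinuousLinearMap.smulRight_apply,
    sub_apply, map_smul, map_add, smul_eq_mul]
  set w := (ContinuousLinearMap.id ℝ E3) v - (A y v) • reebVec A y
  simp
  right
  ring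

theorem dOne_crossEndo {A : E3 → E3 →L[ℝ] ℝ} {y v w : E3} (h : A y (curl A y) ≠ 0)
    (hv : A y v = 0) (hw : A y w = 0) :
    dOne A y v (crossEndo A y w) = v 0 * w 0 + v 1 * w 1 + v 2 * w 2 := by
  rw [crossEndo_apply_ker hw, dOne_smul_right, inv_mul_eq_iff_eq_mul₀ h, dOne_eq_curl]
  simp only [PiLp.add_apply, PiLp.smul_apply, eb_apply]
  rw [clm_apply_eq (A y) (curl A y)]
  rw [clm_apply_eq (A y) v] at hv
  rw [clm_apply_eq (A y) w] at hw
  simp at hv hw ⊢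
  linear_combination (-(w 0 * curl A y 0 + w 1 * curl A y 1 + w 2 * curl A y 2)) * hv

end VectorCalculus

/-! ### The Reeb field of a contact form -/

section Reeb

variable {M : Type*} [TopologicalSpace M] [ChartedSpace E3 M]
  {lam : ∀ p : M, TangentSpace (𝓡 3) p →L[ℝ] ℝ}

section ExtD
variable (lam) (p : M)

theorem rawE_swap (v w : E3) : rawE lam p v w = -rawE lam p w v := dOne_swap _ _ _ _

theorem rawE_self (v : E3) : rawE lam p v v = 0 := dOne_self _ _ _

theorem rawE_add_left (v v' w : E3) :
    rawE lam p (v + v' : E3) w = rawE lam p v w + rawE lam p v' w := by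
  simp only [rawE_eq_dOne, map_add, dOne_add_left]

theorem rawE_smul_left (a : ℝ) (v w : E3) :
    rawE lam p (a • v : E3) w = a * rawE lam p v w := by
  simp only [rawE_eq_dOne, map_smul, dOne_smul_left]

theorem rawE_add_right (v w w' : E3) :
    rawE lam p v (w + w' : E3) = rawE lam p v w + rawE lam p v w' := by
  simp only [rawE_eq_dOne, map_add, dOne_add_right]

theorem rawE_smul_right (a : ℝ) (v w : E3) :
    rawE lam p v (a • w : E3) = a * rawE lam p v w := by
  simp only [rawE_eq_dOne, map_smul, dOne_smul_right]

end ExtD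

/-- The defining equations of the Reeb vector at the point `p`. -/
def IsReebAt (lam : ∀ p : M, TangentSpace (𝓡 3) p →L[ℝ] ℝ) (p : M) (V : E3) : Prop :=
  (∀ v : E3, rawE lam p V v = 0) ∧ rawF lam p V = 1

theorem exists_linearIndependent_cons {W : E3} (hW : W ≠ 0) :
    ∃ a b : E3, LinearIndependent ℝ ![W, a, b] := by
  have h1 : LinearIndependent ℝ ![W] := by
    simpa [linearIndependent_unique_iff] using hW
  obtain ⟨a, ha⟩ := exists_linearIndependent_snoc_of_lt_finrank h1 (by simp)
  obtain ⟨b, hb⟩ := exists_linearIndependent_snoc_of_lt_finrank ha (by simp)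
  refine ⟨a, b, ?_⟩
  have h3 : (Fin.snoc (Fin.snoc ![W] a) b : Fin 3 → E3) = ![W, a, b] := by
    ext i : 1
    fin_cases i <;> rfl
  rw [← h3]
  exact hb

theorem IsReebAt.unique (hlam : IsContactForm lam) {p : M} {V V' : E3} (h : IsReebAt lam p V)
    (h' : IsReebAt lam p V') : V = V' := by
  by_contra hne
  obtain ⟨a, b, hab⟩ := exists_linearIndependent_cons (sub_ne_zero.2 hne)
  apply hlam.contact p _ hab
  have h1 : ∀ v, rawE lam p (V - V' : E3) v = 0 := by
    intro v
    have := rawE_add_left lam p V ((-1 : ℝ) • V') v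
    rw [rawE_smul_left, h.1, h'.1] at this
    simpa [sub_eq_add_neg] using this
  have h2 : rawF lam p (V - V') = 0 := by
    rw [map_sub, h.2, h'.2, sub_self]
  have h3 : ∀ v, rawE lam p v (V - V' : E3) = 0 := by
    intro v
    rw [rawE_swap, h1, neg_zero]
  change rawF lam p (V - V') * rawE lam p a b + rawF lam p a * rawE lam p b (V - V' : E3) +
    rawF lam p b * rawE lam p (V - V' : E3) a = 0
  rw [h1, h2, h3]; ring

variable [IsManifold (𝓡 3) ∞ M]

/-- The contact condition `lam ∧ dlam ≠ 0`, expressed by the curl. -/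
theorem curl_formInChart_ne_zero (hlam : IsContactForm lam) (p : M) {y : E3}
    (hy : y ∈ (extChartAt (𝓡 3) p).target) :
    formInChart lam p y (curl (formInChart lam p) y) ≠ 0 := by
  have hsm := contMDiffAt_chart_symm p hy
  have hd := dOne_pullForm hlam.smooth hsm
  change ∀ v w, dOne (formInChart lam p) y v w = _ at hd
  have hli : LinearIndependent ℝ (fun i : Fin 3 => rawD (extChartAt (𝓡 3) p).symm y (eb i)) := by
    have h0 : LinearIndependent ℝ (fun i : Fin 3 => eb i) := by
      have := (EuclideanSpace.basisFun (Fin 3) ℝ).toBasis.linearIndependent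
      have h3 : ⇑(EuclideanSpace.basisFun (Fin 3) ℝ).toBasis = fun i : Fin 3 => eb i := by
        ext i : 1
        simp [eb]
      rw [h3] at this
      exact this
    refine h0.map' ((rawD (extChartAt (𝓡 3) p).symm y : E3 →L[ℝ] E3) : E3 →ₗ[ℝ] E3) ?_
    rw [LinearMap.ker_eq_bot]
    intro v w hvw
    rw [← chD_comp_rawD_symm p hy v, ← chD_comp_rawD_symm p hy w]
    exact congrArg _ hvw
  have := hlam.contact ((extChartAt (𝓡 3) p).symm y) _ hli
  change rawF lam _ (rawD _ y (eb 0)) * rawE lam _ (rawD _ y (eb 1)) (rawD _ y (eb 2)) +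
    rawF lam _ (rawD _ y (eb 1)) * rawE lam _ (rawD _ y (eb 2)) (rawD _ y (eb 0)) +
    rawF lam _ (rawD _ y (eb 2)) * rawE lam _ (rawD _ y (eb 0)) (rawD _ y (eb 1)) ≠ 0 at this
  rw [clm_apply_eq]
  rw [← hd, ← hd, ← hd] at this
  convert this using 1
  simp only [curl, PiLp.add_apply, PiLp.smul_apply, eb_apply]
  simp
  change _ = formInChart lam p y (eb 0) * _ + formInChart lam p y (eb 1) * _ +
    formInChart lam p y (eb 2) * _
  ring

/-- The Reeb field of a contact form. -/
def reeb (lam : ∀ p : M, TangentSpace (𝓡 3) p →L[ℝ] ℝ) (p : M) : TangentSpace (𝓡 3) p :=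
  rawD (extChartAt (𝓡 3) p).symm (extChartAt (𝓡 3) p p)
    (reebVec (formInChart lam p) (extChartAt (𝓡 3) p p))

theorem isReebAt_chart (hlam : IsContactForm lam) (p : M) {y : E3}
    (hy : y ∈ (extChartAt (𝓡 3) p).target) :
    IsReebAt lam ((extChartAt (𝓡 3) p).symm y)
      (rawD (extChartAt (𝓡 3) p).symm y (reebVec (formInChart lam p) y)) := by
  have hsm := contMDiffAt_chart_symm p hy
  have hd := dOne_pullForm hlam.smooth hsm
  have hr : (extChartAt (𝓡 3) p).symm y ∈ (extChartAt (𝓡 3) p).source :=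
    (extChartAt (𝓡 3) p).map_target hy
  refine ⟨fun v => ?_, apply_reebVec (curl_formInChart_ne_zero hlam p hy)⟩
  have hv := rawD_symm_comp_chD p hr v
  rw [(extChartAt (𝓡 3) p).right_inv hy] at hv
  rw [← hv, ← hd]
  exact dOne_reebVec _ _ _

theorem isReebAt_reeb (hlam : IsContactForm lam) (p : M) : IsReebAt lam p (reeb lam p) := by
  have h := isReebAt_chart hlam p (mem_extChartAt_target (I := 𝓡 3) p)
  have h2 : (extChartAt (𝓡 3) p).symm (extChartAt (𝓡 3) p p) = p := extChartAt_to_inv p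
  rw [h2] at h
  exact h

theorem isReebField_reeb (hlam : IsContactForm lam) : IsReebField lam (reeb lam) :=
  fun p => isReebAt_reeb hlam p

theorem reeb_eq (hlam : IsContactForm lam) {p : M} {V : E3} (h : IsReebAt lam p V) :
    reeb lam p = V := (isReebAt_reeb hlam p).unique hlam h

theorem chD_reeb (hlam : IsContactForm lam) (p : M) {y : E3}
    (hy : y ∈ (extChartAt (𝓡 3) p).target) :
    chD p ((extChartAt (𝓡 3) p).symm y) (reeb lam ((extChartAt (𝓡 3) p).symm y)) =
      reebVec (formInChart lam p) y := by
  have := reeb_eq hlam (isReebAt_chart hlam p hy)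
  exact (congrArg (chD p _) this).trans (chD_comp_rawD_symm p hy _)

/-- The Reeb field, in the chart around `p`. -/
theorem contDiffOn_reebVec (hlam : IsContactForm lam) (p : M) :
    ContDiffOn ℝ ∞ (reebVec (formInChart lam p)) (extChartAt (𝓡 3) p).target := fun _ hy =>
  (contDiffAt_reebVec ((hlam.smooth p).contDiffAt ((isOpen_chart_target p).mem_nhds hy))
    (curl_formInChart_ne_zero hlam p hy)).contDiffWithinAt

end Reeb

/-! ### Flows of vector fields on compact manifolds -/

section Flow

variable {M : Type*} [TopologicalSpace M] [ChartedSpace E3 M]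

/-- A vector field is smooth if its components are smooth in every chart. -/
def IsSmoothField (V : ∀ p : M, TangentSpace (𝓡 3) p) : Prop :=
  ∀ p : M, ContDiffOn ℝ ∞ (fun y => chD p ((extChartAt (𝓡 3) p).symm y)
    (V ((extChartAt (𝓡 3) p).symm y))) (extChartAt (𝓡 3) p).target

/-- The differential of a function on `M`, as a functional on the model space. -/
def rawG (f : M → ℝ) (p : M) : E3 →L[ℝ] ℝ := mfderiv (𝓡 3) 𝓘(ℝ, ℝ) f p

theorem hasDerivAt_comp_integralCurve {V : ∀ p : M, TangentSpace (𝓡 3) p} {γ : ℝ → M}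
    (hγ : IsMIntegralCurve γ V) {f : M → ℝ} {t : ℝ}
    (hf : MDifferentiableAt (𝓡 3) 𝓘(ℝ, ℝ) f (γ t)) :
    HasDerivAt (f ∘ γ) (rawG f (γ t) (V (γ t))) t := by
  have h : HasFDerivAt (f ∘ γ) ((rawG f (γ t)).comp
      ((1 : ℝ →L[ℝ] ℝ).smulRight (show E3 from V (γ t)))) t :=
    (HasMFDerivAt.comp t hf.hasMFDerivAt (hγ t)).hasFDerivAt
  have h2 := h.hasDerivAt
  have h3 : ((rawG f (γ t)).comp ((1 : ℝ →L[ℝ] ℝ).smulRight (show E3 from V (γ t)))) 1 =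
      rawG f (γ t) (V (γ t)) :=
    congrArg (rawG f (γ t)) (one_smul ℝ (show E3 from V (γ t)))
  rwa [h3] at h2

/-- The velocity of a curve in `M` of the form `G ∘ α`. -/
theorem hasMFDerivAt_comp_curve {E' : Type*} [NormedAddCommGroup E'] [NormedSpace ℝ E']
    {G : E' → M} {α : ℝ → E'} {t : ℝ} {w : E'}
    (hG : MDifferentiableAt 𝓘(ℝ, E') (𝓡 3) G (α t)) (hα : HasDerivAt α w t) :
    HasMFDerivAt 𝓘(ℝ, ℝ) (𝓡 3) (G ∘ α) t
      ((1 : ℝ →L[ℝ] ℝ).smulRight (show TangentSpace (𝓡 3) (G (α t)) from rawD G (α t) w)) := by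
  have h := HasMFDerivAt.comp t hG.hasMFDerivAt hα.hasFDerivAt.hasMFDerivAt
  have e : (rawD G (α t)).comp ((1 : ℝ →L[ℝ] ℝ).smulRight w) =
      (1 : ℝ →L[ℝ] ℝ).smulRight (rawD G (α t) w) := by
    ext; simp
  exact cast (congrArg (fun L : ℝ →L[ℝ] E3 => HasMFDerivAt 𝓘(ℝ, ℝ) (𝓡 3) (G ∘ α) t L) e) h

variable [IsManifold (𝓡 3) ∞ M]

theorem contMDiff_of_isSmoothField {V : ∀ p : M, TangentSpace (𝓡 3) p} (hV : IsSmoothField V) :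
    ContMDiff (𝓡 3) (𝓡 3).tangent 1 (fun p => (⟨p, V p⟩ : TangentBundle (𝓡 3) M)) := by
  have : IsManifold (𝓡 3) 1 M := .of_le (n := ∞) (by simp)
  intro p
  rw [Bundle.contMDiffAt_section]
  have hsrc : (extChartAt (𝓡 3) p).source ∈ 𝓝 p := extChartAt_source_mem_nhds p
  have h1 : ContMDiffAt (𝓡 3) 𝓘(ℝ, E3) 1 (fun r => chD p ((extChartAt (𝓡 3) p).symm
      (extChartAt (𝓡 3) p r)) (V ((extChartAt (𝓡 3) p).symm (extChartAt (𝓡 3) p r)))) p := by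
    have h2 := ((hV p).contDiffAt ((isOpen_chart_target p).mem_nhds
      (mem_extChartAt_target p))).contMDiffAt
    exact (h2.of_le (by simp)).comp p (contMDiffAt_extChartAt (n := 1))
  refine h1.congr_of_eventuallyEq ?_
  filter_upwards [hsrc] with r hr
  have hl : (extChartAt (𝓡 3) p).symm (extChartAt (𝓡 3) p r) = r :=
    (extChartAt (𝓡 3) p).left_inv hr
  rw [hl]
  have hr' : r ∈ (chartAt E3 p).source := by simpa using hr
  have h3 := TangentBundle.continuousLinearMapAt_trivializationAt (I := 𝓡 3) (𝕜 := ℝ) hr'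
  have h4 : (trivializationAt E3 (TangentSpace (𝓡 3)) p ⟨r, V r⟩).2 =
      (trivializationAt E3 (TangentSpace (𝓡 3)) p).continuousLinearMapAt ℝ r (V r) := by
    rw [Bundle.Trivialization.continuousLinearMapAt_apply,
      Bundle.Trivialization.linearMapAt_apply, if_pos]
    simpa using hr'
  rw [h4, h3]
  rfl

theorem exists_local_integralCurve {V : ∀ p : M, TangentSpace (𝓡 3) p} (hV : IsSmoothField V)
    (p : M) : ∃ U ∈ 𝓝 p, ∃ ε > (0 : ℝ), ∀ x ∈ U, ∃ γ : ℝ → M, γ 0 = x ∧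
      IsMIntegralCurveOn γ V (Ioo (-ε) ε) := by
  set c := extChartAt (𝓡 3) p with hc
  set v : E3 → E3 := fun y => chD p (c.symm y) (V (c.symm y)) with hv
  have hcp : c p ∈ c.target := mem_extChartAt_target p
  have hv1 : ContDiffAt ℝ 1 v (c p) :=
    ((hV p).contDiffAt ((isOpen_chart_target p).mem_nhds hcp)).of_le (by simp)
  obtain ⟨ε, hε, a, r, L, K, hr, hpl⟩ := IsPicardLindelof.of_contDiffAt_one hv1
  obtain ⟨α, hα, hcont⟩ := (hpl 0).exists_forall_mem_closedBall_eq_hasDerivWithinAt_continuousOn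
  have h0 : α (c p, 0) = c p := (hα (c p) (Metric.mem_closedBall_self (by positivity))).1
  have hnhds : Metric.closedBall (c p) r ×ˢ Icc ((0 : ℝ) - ε) (0 + ε) ∈ 𝓝 (c p, (0 : ℝ)) :=
    prod_mem_nhds (Metric.closedBall_mem_nhds _ (by positivity)) (Icc_mem_nhds (by linarith) (by linarith))
  have hca : ContinuousAt α (c p, (0 : ℝ)) := hcont.continuousAt hnhds
  have h1 : ∀ᶠ z in 𝓝 (c p, (0 : ℝ)), α z ∈ c.target :=
    hca.eventually (by rw [h0]; exact (isOpen_chart_target p).mem_nhds hcp)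
  rw [nhds_prod_eq] at h1
  obtain ⟨A, hA, B, hB, hAB⟩ := eventually_prod_iff.1 h1
  obtain ⟨ε', hε', hball⟩ := Metric.eventually_nhds_iff.1 hB
  have hU : c ⁻¹' {y | A y ∧ y ∈ Metric.closedBall (c p) r} ∈ 𝓝 p :=
    (continuousAt_extChartAt p).preimage_mem_nhds
      (hA.and (Metric.closedBall_mem_nhds _ (by positivity)))
  refine ⟨_, inter_mem hU (extChartAt_source_mem_nhds (I := 𝓡 3) p), min ε ε', lt_min hε hε', ?_⟩
  rintro x ⟨⟨hxA, hxr⟩, hxs⟩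
  obtain ⟨hx0, hxd⟩ := hα (c x) hxr
  refine ⟨c.symm ∘ fun t => α (c x, t), ?_, ?_⟩
  · change c.symm (α (c x, 0)) = x
    rw [hx0]
    exact c.left_inv hxs
  · intro t ht
    have ht1 : -ε < t := lt_of_le_of_lt (neg_le_neg (min_le_left _ _)) ht.1
    have ht2 : t < ε := lt_of_lt_of_le ht.2 (min_le_left _ _)
    have htB : B t := hball (by
      rw [Real.dist_eq, sub_zero, abs_lt]
      exact ⟨lt_of_le_of_lt (neg_le_neg (min_le_right _ _)) ht.1,
        lt_of_lt_of_le ht.2 (min_le_right _ _)⟩)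
    have htar : α (c x, t) ∈ c.target := hAB hxA htB
    have hd : HasDerivAt (fun t => α (c x, t)) (v (α (c x, t))) t :=
      (hxd t ⟨by linarith, by linarith⟩).hasDerivAt (Icc_mem_nhds (by linarith) (by linarith))
    have hm : MDifferentiableAt 𝓘(ℝ, E3) (𝓡 3) c.symm (α (c x, t)) :=
      (contMDiffAt_chart_symm p htar).mdifferentiableAt (by simp)
    have h2 := hasMFDerivAt_comp_curve hm hd
    have h3 : rawD c.symm (α (c x, t)) (v (α (c x, t))) = V (c.symm (α (c x, t))) := by
      have := rawD_symm_comp_chD p (c.map_target htar) (V (c.symm (α (c x, t))))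
      rwa [← hc, c.right_inv htar] at this
    rw [h3] at h2
    exact h2.hasMFDerivWithinAt

/-- A smooth vector field on a compact manifold is complete. -/
theorem exists_isFlowOf [CompactSpace M] [T2Space M] {V : ∀ p : M, TangentSpace (𝓡 3) p}
    (hV : IsSmoothField V) : ∃ φ : ℝ → M → M, IsFlowOf V φ := by
  have : IsManifold (𝓡 3) 1 M := .of_le (n := ∞) (by simp)
  choose U hU ε hε hγ using exists_local_integralCurve hV
  obtain ⟨s, hs⟩ := isCompact_univ.elim_nhds_subcover U fun p _ => hU p
  obtain ⟨ε₀, hε₀, hle⟩ : ∃ ε₀ > 0, ∀ p ∈ s, ε₀ ≤ ε p := by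
    rcases s.eq_empty_or_nonempty with rfl | hne
    · exact ⟨1, one_pos, by simp⟩
    · obtain ⟨p, hp, hmin⟩ := s.exists_min_image ε hne
      exact ⟨ε p, hε p, hmin⟩
  have key : ∀ x : M, ∃ γ : ℝ → M, γ 0 = x ∧ IsMIntegralCurveOn γ V (Ioo (-ε₀) ε₀) := by
    intro x
    obtain ⟨p, hp, hx⟩ := mem_iUnion₂.1 (hs.2 (mem_univ x))
    obtain ⟨γ, h0, h1⟩ := hγ p x hx
    exact ⟨γ, h0, h1.mono (Ioo_subset_Ioo (neg_le_neg (hle p hp)) (hle p hp))⟩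
  choose γ h0 h1 using exists_isMIntegralCurve_of_isMIntegralCurveOn
    (contMDiff_of_isSmoothField hV) hε₀ key
  exact ⟨fun t p => γ p t, fun p => ⟨h0 p, h1 p⟩⟩

theorem isMIntegralCurve_eq [T2Space M] {V : ∀ p : M, TangentSpace (𝓡 3) p}
    (hV : IsSmoothField V) {γ γ' : ℝ → M} (h : IsMIntegralCurve γ V) (h' : IsMIntegralCurve γ' V)
    (h0 : γ 0 = γ' 0) : γ = γ' := by
  have : IsManifold (𝓡 3) 1 M := .of_le (n := ∞) (by simp)
  exact isMIntegralCurve_Ioo_eq_of_contMDiff_boundaryless (t₀ := 0)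
    (contMDiff_of_isSmoothField hV) h h' h0

theorem isSmoothField_reeb {lam : ∀ p : M, TangentSpace (𝓡 3) p →L[ℝ] ℝ}
    (hlam : IsContactForm lam) : IsSmoothField (reeb lam) := fun p =>
  (contDiffOn_reebVec hlam p).congr fun _ hy => chD_reeb hlam p hy

omit [IsManifold (𝓡 3) ∞ M] in
/-- A bump function argument which bounds the period of a closed orbit from below. If `f` has speed at most `K` along
the curve, `1 / 2 < f` on a region where `g` is strictly increasing along the curve, and the curve
starts where `f = 1`, then its period is at least `1 / (2 K)`. -/
theorem period_ge_of_bump {γ : ℝ → M} {V : ∀ p : M, TangentSpace (𝓡 3) p}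
    (hγ : IsMIntegralCurve γ V) {f g : M → ℝ} {K T : ℝ} (hK : 0 < K) (hT : 0 < T)
    (hf : ∀ t, MDifferentiableAt (𝓡 3) 𝓘(ℝ, ℝ) f (γ t))
    (hfK : ∀ t, -K ≤ rawG f (γ t) (V (γ t)))
    (hg : ∀ t, 1 / 2 < f (γ t) → MDifferentiableAt (𝓡 3) 𝓘(ℝ, ℝ) g (γ t) ∧
      0 < rawG g (γ t) (V (γ t)))
    (h0 : f (γ 0) = 1) (hper : γ T = γ 0) : 1 / (2 * K) ≤ T := by
  by_contra hlt
  push Not at hlt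
  have hF := fun t => hasDerivAt_comp_integralCurve hγ (hf t)
  have hfd : Differentiable ℝ (f ∘ γ) := fun t => (hF t).differentiableAt
  have hlow : ∀ t ∈ Icc 0 T, 1 / 2 < f (γ t) := by
    intro t ht
    have h1 := mul_sub_le_image_sub_of_le_deriv (C := -K) hfd
      (fun t => by rw [(hF t).deriv]; exact hfK t) ht.1
    simp only [Function.comp_apply, h0] at h1
    have h2 : K * T < 1 / 2 := by
      rw [lt_div_iff₀ (by positivity)] at hlt
      linarith
    have h3 : K * t ≤ K * T := mul_le_mul_of_nonneg_left ht.2 hK.le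
    linarith
  have hG := fun t (ht : t ∈ Icc 0 T) => hasDerivAt_comp_integralCurve hγ (hg t (hlow t ht)).1
  have hmono : StrictMonoOn (g ∘ γ) (Icc 0 T) := by
    refine strictMonoOn_of_deriv_pos (convex_Icc 0 T)
      (fun t ht => (hG t ht).continuousAt.continuousWithinAt) ?_
    intro t ht
    have ht' := interior_subset ht
    rw [(hG t ht').deriv]
    exact (hg t (hlow t ht')).2
  have := hmono (left_mem_Icc.2 hT.le) (right_mem_Icc.2 hT.le) hT
  simp [hper] at this

end Flow

/-! ### Lower bounds for the periods of closed orbits -/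

section PeriodBound

variable {M : Type*} [TopologicalSpace M] [ChartedSpace E3 M] [IsManifold (𝓡 3) ∞ M]

theorem rawG_comp_chart {p r : M} (hr : r ∈ (extChartAt (𝓡 3) p).source) {k : E3 → ℝ}
    (hk : DifferentiableAt ℝ k (extChartAt (𝓡 3) p r)) (V : E3) :
    MDifferentiableAt (𝓡 3) 𝓘(ℝ, ℝ) (k ∘ extChartAt (𝓡 3) p) r ∧
    rawG (k ∘ extChartAt (𝓡 3) p) r V = fderiv ℝ k (extChartAt (𝓡 3) p r) (chD p r V) := by
  have : IsManifold (𝓡 3) 1 M := .of_le (n := ∞) (by simp)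
  have h1 : MDifferentiableAt (𝓡 3) 𝓘(ℝ, E3) (extChartAt (𝓡 3) p) r :=
    mdifferentiableAt_extChartAt (by simpa using hr)
  refine ⟨hk.mdifferentiableAt.comp r h1, ?_⟩
  have h2 := mfderiv_comp r hk.mdifferentiableAt h1
  rw [mfderiv_eq_fderiv] at h2
  exact congrArg (fun L : E3 →L[ℝ] ℝ => L V) h2

/-- A bump function at `p` whose derivative along every vector `V` is bounded by the size of `V` in
the chart around `p`. -/
theorem exists_bump_with_bounded_speed [T2Space M] {p : M} {U : Set M} (hU : U ∈ 𝓝 p) :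
    ∃ f : M → ℝ, ∃ B > (0 : ℝ), ContMDiff (𝓡 3) 𝓘(ℝ, ℝ) ∞ f ∧ (∀ᶠ r in 𝓝 p, f r = 1) ∧
      (∀ r, f r ≠ 0 → r ∈ U ∩ (extChartAt (𝓡 3) p).source) ∧
      ∀ r V, |rawG f r V| ≤ B * ‖chD p r V‖ ∧ (r ∉ U → rawG f r V = 0) := by
  obtain ⟨f, -, hf⟩ := (SmoothBumpFunction.nhds_basis_tsupport (I := 𝓡 3) p).mem_iff.1 hU
  obtain ⟨B, hB⟩ := ((f.toContDiffBump.contDiff (n := 1)).continuous_fderiv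
    (by simp)).bounded_above_of_compact_support (f.toContDiffBump.hasCompactSupport.fderiv ℝ)
  have hB0 : 0 ≤ B := (norm_nonneg _).trans (hB 0)
  refine ⟨f, B + 1, by linarith, f.contMDiff, f.eventuallyEq_one, ?_, ?_⟩
  · intro r hr
    have : r ∈ tsupport f := subset_tsupport _ hr
    refine ⟨hf this, ?_⟩
    rw [extChartAt_source]
    exact f.tsupport_subset_chartAt_source this
  · intro r V
    have hout : r ∉ tsupport f → rawG f r V = 0 := by
      intro hr
      have h0 : (f : M → ℝ) =ᶠ[𝓝 r] fun _ => 0 := notMem_tsupport_iff_eventuallyEq.1 hr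
      have := h0.mfderiv_eq (I := 𝓡 3) (I' := 𝓘(ℝ, ℝ))
      rw [mfderiv_const] at this
      exact congrArg (fun L : E3 →L[ℝ] ℝ => L V) this
    refine ⟨?_, fun hr => hout fun h => hr (hf h)⟩
    by_cases hr : r ∈ tsupport f
    · have hs := f.tsupport_subset_chartAt_source hr
      have hs' : r ∈ (extChartAt (𝓡 3) p).source := by rwa [extChartAt_source]
      have h1 : (f : M → ℝ) =ᶠ[𝓝 r] f.toContDiffBump ∘ extChartAt (𝓡 3) p :=
        f.eqOn_source.eventuallyEq_of_mem ((chartAt E3 p).open_source.mem_nhds hs)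
      have h2 : rawG f r V = rawG (f.toContDiffBump ∘ extChartAt (𝓡 3) p) r V :=
        congrArg (fun L : E3 →L[ℝ] ℝ => L V) (h1.mfderiv_eq (I := 𝓡 3) (I' := 𝓘(ℝ, ℝ)))
      rw [h2, (rawG_comp_chart hs'
        ((f.toContDiffBump.contDiff (n := 1)).differentiable (by simp) _) V).2]
      calc _ ≤ ‖fderiv ℝ f.toContDiffBump (extChartAt (𝓡 3) p r)‖ * ‖chD p r V‖ :=
            ContinuousLinearMap.le_opNorm _ _
        _ ≤ _ := by gcongr; linarith [hB (extChartAt (𝓡 3) p r)]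
    · rw [hout hr, abs_zero]; positivity

/-- A uniform lower bound for the periods of the closed orbits of a family of vector fields, which
stay in sets `S δ` that shrink to the compact set `O`. It is enough that near each point of `O` the
fields are uniformly bounded and lie in a fixed open half space. -/
theorem exists_period_lower_bound [T2Space M] {O : Set M} (hO : IsCompact O) {S : ℝ → Set M}
    (hS : ∀ U, IsOpen U → O ⊆ U → ∃ δ₀ > (0 : ℝ), ∀ δ ∈ Ioo 0 δ₀, S δ ⊆ U)
    {A : ℝ → M → E3 → Prop}
    (hloc : ∀ p ∈ O, ∃ U ∈ 𝓝 p, ∃ l : E3 →L[ℝ] ℝ, ∃ K > (0 : ℝ), ∃ δ₀ > (0 : ℝ),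
      ∀ δ ∈ Ioo 0 δ₀, ∀ r ∈ U ∩ S δ, ∀ V, A δ r V → 0 < l (chD p r V) ∧ ‖chD p r V‖ ≤ K) :
    ∃ c > (0 : ℝ), ∃ δ₁ > (0 : ℝ), ∀ δ ∈ Ioo 0 δ₁, ∀ (V : ∀ p : M, TangentSpace (𝓡 3) p)
      (γ : ℝ → M), IsMIntegralCurve γ V → (∀ t, γ t ∈ S δ ∧ A δ (γ t) (V (γ t))) →
      ∀ T > 0, γ T = γ 0 → c ≤ T := by
  have : IsManifold (𝓡 3) 1 M := .of_le (n := ∞) (by simp)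
  have step : ∀ p ∈ O, ∃ W ∈ 𝓝 p, ∃ c > (0 : ℝ), ∃ δ₁ > (0 : ℝ), ∀ δ ∈ Ioo 0 δ₁,
      ∀ (V : ∀ p : M, TangentSpace (𝓡 3) p) (γ : ℝ → M), IsMIntegralCurve γ V →
      (∀ t, γ t ∈ S δ ∧ A δ (γ t) (V (γ t))) → γ 0 ∈ W → ∀ T > 0, γ T = γ 0 → c ≤ T := by
    intro p hp
    obtain ⟨U, hU, l, K, hK, δ₀, hδ₀, h⟩ := hloc p hp
    obtain ⟨f, B, hB, hfs, hf1, hfU, hfB⟩ := exists_bump_with_bounded_speed hU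
    refine ⟨_, hf1, 1 / (2 * (B * K)), by positivity, δ₀, hδ₀, ?_⟩
    intro δ hδ V γ hγ hA h0 T hT hper
    refine period_ge_of_bump hγ (f := f) (g := l ∘ extChartAt (𝓡 3) p) (by positivity) hT
      (fun t => (hfs _).mdifferentiableAt (by simp)) ?_ ?_ h0 hper
    · intro t
      by_cases ht : γ t ∈ U
      · have h1 := (h δ hδ (γ t) ⟨ht, (hA t).1⟩ _ (hA t).2).2
        have h2 := (abs_le.1 (hfB (γ t) (V (γ t))).1).1
        refine le_trans ?_ h2
        have := mul_le_mul_of_nonneg_left h1 hB.le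
        linarith
      · rw [(hfB (γ t) (V (γ t))).2 ht]
        have : 0 < B * K := by positivity
        linarith
    · intro t ht
      obtain ⟨h1, h2⟩ := hfU (γ t) (by linarith)
      have h3 := rawG_comp_chart h2 l.differentiableAt (V (γ t))
      refine ⟨h3.1, ?_⟩
      rw [h3.2, l.fderiv]
      exact (h δ hδ (γ t) ⟨h1, (hA t).1⟩ _ (hA t).2).1
  choose! W hW c hc δ₁ hδ₁ hmain using step
  obtain ⟨s, hsO, hs⟩ := hO.elim_nhds_subcover (fun p => interior (W p))
    (fun p hp => interior_mem_nhds.2 (hW p hp))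
  obtain ⟨δ₂, hδ₂, hsub⟩ := hS _ (isOpen_biUnion fun p _ => isOpen_interior) hs
  obtain ⟨c₀, hc₀, hcle⟩ : ∃ c₀ > 0, ∀ p ∈ s, c₀ ≤ c p := by
    rcases s.eq_empty_or_nonempty with rfl | hne
    · exact ⟨1, one_pos, by simp⟩
    · obtain ⟨p, hp, hmin⟩ := s.exists_min_image c hne
      exact ⟨c p, hc p (hsO p hp), hmin⟩
  obtain ⟨d₀, hd₀, hdle⟩ : ∃ d₀ > 0, ∀ p ∈ s, d₀ ≤ δ₁ p := by
    rcases s.eq_empty_or_nonempty with rfl | hne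
    · exact ⟨1, one_pos, by simp⟩
    · obtain ⟨p, hp, hmin⟩ := s.exists_min_image δ₁ hne
      exact ⟨δ₁ p, hδ₁ p (hsO p hp), hmin⟩
  refine ⟨c₀, hc₀, min d₀ δ₂, lt_min hd₀ hδ₂, ?_⟩
  intro δ hδ V γ hγ hA T hT hper
  obtain ⟨p, hp, h0⟩ := mem_iUnion₂.1
    (hsub δ ⟨hδ.1, hδ.2.trans_le (min_le_right _ _)⟩ (hA 0).1)
  exact (hcle p hp).trans (hmain p (hsO p hp) δ
    ⟨hδ.1, hδ.2.trans_le ((min_le_left _ _).trans (hdle p hp))⟩ V γ hγ hA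
    (interior_subset h0) T hT hper)

end PeriodBound

/-! ### Charts from immersions -/

section LocalCharts

variable {M : Type*} [TopologicalSpace M] [ChartedSpace E3 M] [IsManifold (𝓡 3) ∞ M]
variable {E' : Type*} [NormedAddCommGroup E'] [NormedSpace ℝ E']

/-- The inverse function theorem: an immersion `G` of an open subset of a 3-dimensional space is,
locally, the inverse of a chart. -/
theorem exists_chart_of_immersion (A : E3 ≃L[ℝ] E') {G : E' → M} {Ω : Set E'} (hΩ : IsOpen Ω)
    (hG : ContMDiffOn 𝓘(ℝ, E') (𝓡 3) ∞ G Ω) {q₀ : E'} (hq₀ : q₀ ∈ Ω)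
    (hinj : Function.Injective (rawD G q₀)) :
    ∃ e ∈ IsManifold.maximalAtlas (𝓡 3) ∞ M, A.symm q₀ ∈ e.target ∧
      ∀ y ∈ e.target, A y ∈ Ω ∧ e.symm y = G (A y) := by
  set p := G q₀ with hp
  set c := chartAt E3 p with hc
  have hGat : ∀ q ∈ Ω, ContMDiffAt 𝓘(ℝ, E') (𝓡 3) ∞ G q := fun q hq =>
    hG.contMDiffAt (hΩ.mem_nhds hq)
  have hpre : IsOpen (Ω ∩ G ⁻¹' c.source) := hG.continuousOn.isOpen_inter_preimage hΩ c.open_source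
  have hsm : ∀ q ∈ Ω ∩ G ⁻¹' c.source, ContDiffAt ℝ ∞ (c ∘ G) q := by
    intro q hq
    have := contDiffAt_chart_comp (p := p) (hGat q hq.1) (by rw [extChartAt_source]; exact hq.2)
    exact this
  set f : E3 → E3 := fun y => c (G (A y)) with hf
  set D : Set E3 := A ⁻¹' (Ω ∩ G ⁻¹' c.source) with hD
  have hDo : IsOpen D := hpre.preimage A.continuous
  have hfs : ∀ y ∈ D, ContDiffAt ℝ ∞ f y := fun y hy =>
    (hsm (A y) hy).comp y A.contDiff.contDiffAt
  have hy₀ : A.symm q₀ ∈ D := by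
    simp only [hD, mem_preimage, ContinuousLinearEquiv.apply_symm_apply]
    exact ⟨hq₀, mem_chart_source E3 p⟩
  have hfd : ContinuousOn (fderiv ℝ f) D := fun y hy =>
    (((hfs y hy).fderiv_right (m := 0) (by simp)).continuousAt).continuousWithinAt
  -- the differential of `f` at the base point is injective, hence invertible
  have hinv : fderiv ℝ f (A.symm q₀) ∈ range ((↑) : (E3 ≃L[ℝ] E3) → E3 →L[ℝ] E3) := by
    have h1 : fderiv ℝ f (A.symm q₀) = (fderiv ℝ (c ∘ G) q₀).comp (A : E3 →L[ℝ] E') := by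
      have h2 : DifferentiableAt ℝ (c ∘ G) (A (A.symm q₀)) :=
        (hsm _ hy₀).differentiableAt (by simp)
      have := fderiv_comp (A.symm q₀) h2 A.differentiableAt
      rw [A.fderiv, A.apply_symm_apply] at this
      exact this
    have hi : Function.Injective (fderiv ℝ f (A.symm q₀)) := by
      rw [h1]
      refine Function.Injective.comp (g := fderiv ℝ (c ∘ G) q₀) ?_ A.injective
      intro v w hvw
      have hs : G q₀ ∈ (extChartAt (𝓡 3) p).source := mem_extChartAt_source _
      have hmd := (hGat q₀ hq₀).mdifferentiableAt (by simp)
      have h3 := rawD_eq hmd hs v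
      have h4 := rawD_eq hmd hs w
      change fderiv ℝ (extChartAt (𝓡 3) p ∘ G) q₀ v = fderiv ℝ (extChartAt (𝓡 3) p ∘ G) q₀ w at hvw
      rw [hvw, ← h4] at h3
      exact hinj h3
    exact ⟨(LinearEquiv.ofInjectiveEndo (fderiv ℝ f (A.symm q₀) : E3 →ₗ[ℝ] E3)
      hi).toContinuousLinearEquiv, by ext; rfl⟩
  have hnh : ∀ᶠ y in 𝓝 (A.symm q₀),
      y ∈ D ∧ fderiv ℝ f y ∈ range ((↑) : (E3 ≃L[ℝ] E3) → E3 →L[ℝ] E3) :=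
    Filter.Eventually.and (hDo.mem_nhds hy₀) ((hfd.continuousAt (hDo.mem_nhds hy₀)).eventually
      (ContinuousLinearEquiv.isOpen.mem_nhds hinv))
  obtain ⟨S, hS, hSo, hyS⟩ := eventually_nhds_iff.1 hnh
  obtain ⟨L, hL⟩ := hinv
  have hLd : HasFDerivAt f (L : E3 →L[ℝ] E3) (A.symm q₀) := by
    rw [hL]; exact ((hfs _ hy₀).differentiableAt (by simp)).hasFDerivAt
  set h₀ := (hfs _ hy₀).toOpenPartialHomeomorph f hLd (by simp) with hh₀
  set h := h₀.restrOpen S hSo with hh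
  have hcoe : ∀ y, h y = f y := fun y => rfl
  have hsrc : h.source = h₀.source ∩ S := rfl
  have hsymm : ∀ x ∈ h.target, ContDiffAt ℝ ∞ h.symm x := by
    intro x hx
    have hx' := h.map_target hx
    obtain ⟨L', hL'⟩ := (hS _ (hsrc ▸ hx').2).2
    refine h.contDiffAt_symm (f₀' := L') hx ?_ (hfs _ (hS _ (hsrc ▸ hx').2).1)
    rw [hL']
    exact ((hfs _ (hS _ (hsrc ▸ hx').2).1).differentiableAt (by simp)).hasFDerivAt
  set e := c.trans h.symm with he
  have htar : ∀ y, y ∈ e.target ↔ y ∈ h.source := by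
    intro y
    rw [he, OpenPartialHomeomorph.trans_target]
    constructor
    · exact fun hy => hy.1
    · intro hy
      refine ⟨hy, ?_⟩
      change h y ∈ c.target
      rw [hcoe]
      exact c.map_source (hS y (hsrc ▸ hy).2).1.2
  have hesymm : ∀ y ∈ e.target, e.symm y = G (A y) := by
    intro y hy
    have hy' := (htar y).1 hy
    change c.symm (h y) = G (A y)
    rw [hcoe]
    exact c.left_inv (hS y (hsrc ▸ hy').2).1.2
  refine ⟨e, ?_, ?_, ?_⟩
  · refine e.mem_maximalAtlas_of_contMDiffOn ?_ ?_
    · have h1 : ContMDiffOn (𝓡 3) (𝓡 3) ∞ c c.source :=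
        contMDiffOn_of_mem_maximalAtlas (IsManifold.chart_mem_maximalAtlas p)
      have h2 : ContMDiffOn (𝓡 3) (𝓡 3) ∞ h.symm h.target := fun x hx =>
        (hsymm x hx).contMDiffAt.contMDiffWithinAt
      exact h2.comp (h1.mono fun x hx => hx.1) fun x hx => hx.2
    · have h1 : ContMDiffOn (𝓡 3) (𝓡 3) ∞ (fun y => G (A y)) e.target := by
        have hA : ContMDiff (𝓡 3) 𝓘(ℝ, E') ∞ A := A.contDiff.contMDiff
        exact hG.comp hA.contMDiffOn fun y hy => (hS y (hsrc ▸ (htar y).1 hy).2).1.1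
      exact h1.congr hesymm
  · rw [htar, hsrc]
    exact ⟨(hfs _ hy₀).mem_toOpenPartialHomeomorph_source hLd (by simp), hyS⟩
  · intro y hy
    exact ⟨(hS y (hsrc ▸ (htar y).1 hy).2).1.1, hesymm y hy⟩

end LocalCharts

/-! ### Rescaling of contact forms -/

section Scaling

variable {M : Type*} [TopologicalSpace M] [ChartedSpace E3 M]

/-- The product of a function and a 1-form. -/
def scale (h : M → ℝ) (lam : ∀ p : M, TangentSpace (𝓡 3) p →L[ℝ] ℝ) :
    ∀ p : M, TangentSpace (𝓡 3) p →L[ℝ] ℝ := fun p => (h p • rawF lam p : E3 →L[ℝ] ℝ)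

theorem rawF_scale (h : M → ℝ) (lam : ∀ p : M, TangentSpace (𝓡 3) p →L[ℝ] ℝ) (p : M) :
    rawF (scale h lam) p = h p • rawF lam p := rfl

theorem formInChart_scale (h : M → ℝ) (lam : ∀ p : M, TangentSpace (𝓡 3) p →L[ℝ] ℝ) (p : M) :
    formInChart (scale h lam) p =
      fun y => h ((extChartAt (𝓡 3) p).symm y) • formInChart lam p y := rfl

variable [IsManifold (𝓡 3) ∞ M]
variable {lam : ∀ p : M, TangentSpace (𝓡 3) p →L[ℝ] ℝ} {h : M → ℝ}

theorem contDiffAt_comp_chart_symm (hh : ContMDiff (𝓡 3) 𝓘(ℝ, ℝ) ∞ h) (p : M) {y : E3}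
    (hy : y ∈ (extChartAt (𝓡 3) p).target) :
    ContDiffAt ℝ ∞ (fun y => h ((extChartAt (𝓡 3) p).symm y)) y :=
  (hh.contMDiffAt.comp y (contMDiffAt_chart_symm p hy)).contDiffAt

theorem isSmoothForm_scale (hh : ContMDiff (𝓡 3) 𝓘(ℝ, ℝ) ∞ h) (hlam : IsSmoothForm lam) :
    IsSmoothForm (scale h lam) := by
  intro p
  rw [formInChart_scale]
  have h1 : ContDiffOn ℝ ∞ (fun y => h ((extChartAt (𝓡 3) p).symm y))
      (extChartAt (𝓡 3) p).target := fun y hy =>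
    (contDiffAt_comp_chart_symm hh p hy).contDiffWithinAt
  exact h1.smul (hlam p)

theorem fderiv_comp_chart_symm (hh : ContMDiff (𝓡 3) 𝓘(ℝ, ℝ) ∞ h) (p : M) (V : E3) :
    fderiv ℝ (fun y => h ((extChartAt (𝓡 3) p).symm y)) (extChartAt (𝓡 3) p p) (chD p p V) =
      rawG h p V := by
  have hy := mem_extChartAt_target (I := 𝓡 3) p
  have hs := mem_extChartAt_source (I := 𝓡 3) p
  have hl : (extChartAt (𝓡 3) p).symm (extChartAt (𝓡 3) p p) = p := extChartAt_to_inv p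
  have h1 := mfderiv_comp (extChartAt (𝓡 3) p p)
    ((hh.mdifferentiable (by simp)) ((extChartAt (𝓡 3) p).symm (extChartAt (𝓡 3) p p)))
    ((contMDiffAt_chart_symm p hy).mdifferentiableAt (by simp))
  rw [mfderiv_eq_fderiv] at h1
  have h2 : fderiv ℝ (fun y => h ((extChartAt (𝓡 3) p).symm y)) (extChartAt (𝓡 3) p p)
      (chD p p V) = rawG h ((extChartAt (𝓡 3) p).symm (extChartAt (𝓡 3) p p))
        (rawD (extChartAt (𝓡 3) p).symm (extChartAt (𝓡 3) p p) (chD p p V)) :=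
    congrArg (fun L : E3 →L[ℝ] ℝ => L (chD p p V)) h1
  rw [h2, hl, rawD_symm_comp_chD p hs]

theorem formInChart_chD (lam : ∀ p : M, TangentSpace (𝓡 3) p →L[ℝ] ℝ) {p r : M}
    (hr : r ∈ (extChartAt (𝓡 3) p).source) (V : E3) :
    formInChart lam p (extChartAt (𝓡 3) p r) (chD p r V) = rawF lam r V := by
  have h1 := rawD_symm_comp_chD p hr V
  have h2 : (extChartAt (𝓡 3) p).symm (extChartAt (𝓡 3) p r) = r := (extChartAt (𝓡 3) p).left_inv hr
  change rawF lam ((extChartAt (𝓡 3) p).symm (extChartAt (𝓡 3) p r)) (rawD _ _ _) = _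
  rw [h1, h2]

theorem rawE_scale (hh : ContMDiff (𝓡 3) 𝓘(ℝ, ℝ) ∞ h) (hlam : IsSmoothForm lam) (p : M)
    (v w : E3) : rawE (scale h lam) p v w =
      rawG h p v * rawF lam p w - rawG h p w * rawF lam p v + h p * rawE lam p v w := by
  have hy := mem_extChartAt_target (I := 𝓡 3) p
  have hs := mem_extChartAt_source (I := 𝓡 3) p
  have hl : (extChartAt (𝓡 3) p).symm (extChartAt (𝓡 3) p p) = p := extChartAt_to_inv p
  have h1 := (contDiffAt_comp_chart_symm hh p hy).differentiableAt (by simp)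
  have h2 : DifferentiableAt ℝ (formInChart lam p) (extChartAt (𝓡 3) p p) :=
    ((hlam p).contDiffAt ((isOpen_chart_target p).mem_nhds hy)).differentiableAt (by simp)
  rw [rawE_eq_dOne, rawE_eq_dOne, dOne, dOne, formInChart_scale, fderiv_fun_smul h1 h2]
  simp only [add_apply, smul_apply,
    ContinuousLinearMap.smulRight_apply, fderiv_comp_chart_symm hh, hl, formInChart_chD lam hs,
    smul_eq_mul]
  ring

theorem isContactFormFor_scale {ξ : ∀ p : M, Submodule ℝ (TangentSpace (𝓡 3) p)}
    (hlam : IsContactFormFor ξ lam) (hh : ContMDiff (𝓡 3) 𝓘(ℝ, ℝ) ∞ h) (h0 : ∀ p, h p ≠ 0) :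
    IsContactFormFor ξ (scale h lam) := by
  refine ⟨⟨isSmoothForm_scale hh hlam.1.smooth, ?_⟩, ?_⟩
  · intro p v hv
    have h1 := hlam.1.contact p v hv
    change rawF lam p (v 0) * rawE lam p (v 1) (v 2) + rawF lam p (v 1) * rawE lam p (v 2) (v 0) +
      rawF lam p (v 2) * rawE lam p (v 0) (v 1) ≠ 0 at h1
    have key : ∀ a b c : E3, rawF (scale h lam) p a * rawE (scale h lam) p b c +
        rawF (scale h lam) p b * rawE (scale h lam) p c a +
        rawF (scale h lam) p c * rawE (scale h lam) p a b =
        h p * h p * (rawF lam p a * rawE lam p b c + rawF lam p b * rawE lam p c a +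
          rawF lam p c * rawE lam p a b) := by
      intro a b c
      simp only [rawE_scale hh hlam.1.smooth, rawF_scale, smul_apply,
        smul_eq_mul]
      ring
    exact (key _ _ _).trans_ne (mul_ne_zero (mul_ne_zero (h0 p) (h0 p)) h1)
  · intro p v
    rw [hlam.2 p v]
    change rawF lam p v = 0 ↔ h p * rawF lam p v = 0
    simp [h0 p]

end Scaling

/-! ### The standard form `cos (2πθ) dx + sin (2πθ) dy` -/

section Torsion

/-- Coordinates `(x, y, θ)` on the universal cover of the thickened torus. -/
abbrev T3 : Type := ℝ × ℝ × ℝ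

/-- The 1-form `cos (2πθ) dx + sin (2πθ) dy`. -/
def alpha (q : T3) : T3 →L[ℝ] ℝ :=
  Real.cos (2 * Real.pi * q.2.2) • ContinuousLinearMap.fst ℝ ℝ (ℝ × ℝ) +
    Real.sin (2 * Real.pi * q.2.2) •
      (ContinuousLinearMap.fst ℝ ℝ ℝ).comp (ContinuousLinearMap.snd ℝ ℝ (ℝ × ℝ))

theorem alpha_apply (q v : T3) : alpha q v =
    Real.cos (2 * Real.pi * q.2.2) * v.1 + Real.sin (2 * Real.pi * q.2.2) * v.2.1 := by
  simp [alpha]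

theorem hasFDerivAt_alpha_apply (q w : T3) : HasFDerivAt (fun q => alpha q w)
    ((2 * Real.pi * (-Real.sin (2 * Real.pi * q.2.2) * w.1 +
      Real.cos (2 * Real.pi * q.2.2) * w.2.1)) •
      (ContinuousLinearMap.snd ℝ ℝ ℝ).comp (ContinuousLinearMap.snd ℝ ℝ (ℝ × ℝ))) q := by
  have h0 : HasFDerivAt (fun q : T3 => 2 * Real.pi * q.2.2) ((2 * Real.pi) •
      (ContinuousLinearMap.snd ℝ ℝ ℝ).comp (ContinuousLinearMap.snd ℝ ℝ (ℝ × ℝ))) q :=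
    (((ContinuousLinearMap.snd ℝ ℝ ℝ).comp
      (ContinuousLinearMap.snd ℝ ℝ (ℝ × ℝ))).hasFDerivAt).const_mul _
  have h1 := (h0.cos.mul_const w.1).add (h0.sin.mul_const w.2.1)
  simp only [alpha_apply]
  refine h1.congr_fderiv ?_
  ext v <;> simp <;> ring

theorem contDiff_alpha : ContDiff ℝ ∞ alpha := by
  unfold alpha
  fun_prop

theorem dOne_smul_alpha {P : T3 → ℝ} {q : T3} (hP : DifferentiableAt ℝ P q) (v w : T3) :
    dOne (fun q => P q • alpha q) q v w = fderiv ℝ P q v * alpha q w - fderiv ℝ P q w * alpha q v +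
      P q * (2 * Real.pi) * (v.2.2 * (-Real.sin (2 * Real.pi * q.2.2) * w.1 +
        Real.cos (2 * Real.pi * q.2.2) * w.2.1) - w.2.2 * (-Real.sin (2 * Real.pi * q.2.2) * v.1 +
        Real.cos (2 * Real.pi * q.2.2) * v.2.1)) := by
  have ha : DifferentiableAt ℝ alpha q := contDiff_alpha.differentiable (by simp) q
  have key : ∀ v w, fderiv ℝ alpha q v w = 2 * Real.pi * (-Real.sin (2 * Real.pi * q.2.2) * w.1 +
      Real.cos (2 * Real.pi * q.2.2) * w.2.1) * v.2.2 := by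
    intro v w
    have h1 : fderiv ℝ (fun q => alpha q w) q v = fderiv ℝ alpha q v w := by
      rw [fderiv_clm_apply ha (differentiableAt_const w)]
      simp
    rw [← h1, (hasFDerivAt_alpha_apply q w).fderiv]
    simp
  rw [dOne, fderiv_fun_smul hP ha]
  simp only [add_apply, smul_apply,
    ContinuousLinearMap.smulRight_apply, smul_eq_mul, key]
  ring

/-- The Reeb vector of the 1-form `P (cos (2πθ) dx + sin (2πθ) dy)`. -/
def torsVec (P : T3 → ℝ) (q : T3) : T3 :=
  let s := Real.sin (2 * Real.pi * q.2.2)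
  let c := Real.cos (2 * Real.pi * q.2.2)
  let b := -fderiv ℝ P q (0, 0, 1) / (2 * Real.pi * P q ^ 2)
  (c / P q - s * b, s / P q + c * b, fderiv ℝ P q (-s, c, 0) / (2 * Real.pi * P q ^ 2))

theorem smul_alpha_torsVec {P : T3 → ℝ} {q : T3} (h0 : P q ≠ 0) :
    (P q • alpha q) (torsVec P q) = 1 := by
  have hcs := Real.cos_sq_add_sin_sq (2 * Real.pi * q.2.2)
  simp only [smul_apply, alpha_apply, torsVec, smul_eq_mul]
  field_simp
  linear_combination (2 * Real.pi * P q) * hcs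

theorem dOne_torsVec {P : T3 → ℝ} {q : T3} (hP : DifferentiableAt ℝ P q) (h0 : P q ≠ 0) (w : T3) :
    dOne (fun q => P q • alpha q) q (torsVec P q) w = 0 := by
  have hcs := Real.cos_sq_add_sin_sq (2 * Real.pi * q.2.2)
  have hlin : ∀ v : T3, fderiv ℝ P q v = v.1 * fderiv ℝ P q (1, 0, 0) +
      v.2.1 * fderiv ℝ P q (0, 1, 0) + v.2.2 * fderiv ℝ P q (0, 0, 1) := by
    intro v
    have : v = v.1 • (1, 0, 0) + v.2.1 • (0, 1, 0) + v.2.2 • ((0, 0, 1) : T3) := by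
      ext <;> simp
    conv_lhs => rw [this]
    simp only [map_add, map_smul, smul_eq_mul]
  rw [dOne_smul_alpha hP, hlin w, hlin (torsVec P q)]
  simp only [alpha_apply, torsVec]
  rw [hlin (-_, _, 0)]
  set s := Real.sin (2 * Real.pi * q.2.2)
  set c := Real.cos (2 * Real.pi * q.2.2)
  set Px := fderiv ℝ P q (1, 0, 0)
  set Py := fderiv ℝ P q (0, 1, 0)
  set Pt := fderiv ℝ P q (0, 0, 1)
  have hpi := Real.pi_pos.ne'
  field_simp
  ring_nf

/-- The linear coordinates of the model space, as coordinates `(x, y, θ)`. -/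
def toT3 : E3 ≃L[ℝ] T3 :=
  LinearEquiv.toContinuousLinearEquiv
    { toFun := fun v => (v 0, v 1, v 2)
      map_add' := fun _ _ => rfl
      map_smul' := fun _ _ => rfl
      invFun := fun q => !₂[q.1, q.2.1, q.2.2]
      left_inv := fun v => by ext i; fin_cases i <;> rfl
      right_inv := fun q => rfl }

/-- The interior of the slab. -/
def slabInt : Set T3 := {q | q.2.2 ∈ Ioo (0 : ℝ) 1}

theorem isOpen_slabInt : IsOpen slabInt :=
  isOpen_Ioo.preimage (continuous_snd.comp continuous_snd)

theorem slabInt_subset_slab : slabInt ⊆ slab := fun _ hq => Ioo_subset_Icc_self hq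

theorem slab_mem_nhds {q : T3} (hq : q ∈ slabInt) : slab ∈ 𝓝 q :=
  mem_of_superset (isOpen_slabInt.mem_nhds hq) slabInt_subset_slab

theorem slab_eq : slab = univ ×ˢ univ ×ˢ Icc (0 : ℝ) 1 := by
  ext q; simp [slab]

theorem slabInt_eq : slabInt = univ ×ˢ univ ×ˢ Ioo (0 : ℝ) 1 := by
  ext q; simp [slabInt]

theorem convex_slab : Convex ℝ slab := by
  rw [slab_eq]
  exact convex_univ.prod (convex_univ.prod (convex_Icc 0 1))

theorem uniqueDiffOn_slab : UniqueDiffOn ℝ slab := by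
  rw [slab_eq]
  exact uniqueDiffOn_univ.prod (uniqueDiffOn_univ.prod (uniqueDiffOn_Icc one_pos))

theorem slab_subset_closure : slab ⊆ closure slabInt := by
  rw [slab_eq, slabInt_eq, closure_prod_eq, closure_prod_eq, closure_Ioo zero_ne_one]
  simp

end Torsion

/-! ### The thickened torus -/

section TorsionMap

variable {M : Type*} [TopologicalSpace M] [ChartedSpace E3 M]

/-- `F` parametrizes a Giroux torsion domain of `ξ`: these are the conditions of `HasGirouxTorsion`. -/
structure IsTorsionMap (ξ : ∀ p : M, Submodule ℝ (TangentSpace (𝓡 3) p)) (F : T3 → M) : Prop where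
  smooth : ContMDiffOn 𝓘(ℝ, T3) (𝓡 3) ∞ F slab
  eq_iff : ∀ q ∈ slab, ∀ q' ∈ slab, F q = F q' ↔
    ∃ m n : ℤ, q'.1 = q.1 + m ∧ q'.2.1 = q.2.1 + n ∧ q'.2.2 = q.2.2
  immersion : ∀ q ∈ slab, Function.Injective (mfderivWithin 𝓘(ℝ, T3) (𝓡 3) F slab q)
  mem_iff : ∀ q ∈ slab, ∀ v : T3, mfderivWithin 𝓘(ℝ, T3) (𝓡 3) F slab q v ∈ ξ (F q) ↔
    Real.cos (2 * Real.pi * q.2.2) * v.1 + Real.sin (2 * Real.pi * q.2.2) * v.2.1 = 0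

/-- The differential of `F` within the slab. -/
def rawW (F : T3 → M) (q : T3) : T3 →L[ℝ] E3 := mfderivWithin 𝓘(ℝ, T3) (𝓡 3) F slab q

/-- The deck transformation of the slab by the integers `m` and `n`. -/
def deck (m n : ℤ) (q : T3) : T3 := (q.1 + m, q.2.1 + n, q.2.2)

theorem deck_eq_add (m n : ℤ) (q : T3) : deck m n q = q + ((m : ℝ), (n : ℝ), (0 : ℝ)) := by
  ext <;> simp [deck]

theorem deck_mem_slab {m n : ℤ} {q : T3} (hq : q ∈ slab) : deck m n q ∈ slab := hq

theorem deck_mem_slabInt {m n : ℤ} {q : T3} (hq : q ∈ slabInt) : deck m n q ∈ slabInt := hq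

variable {ξ : ∀ p : M, Submodule ℝ (TangentSpace (𝓡 3) p)} {F : T3 → M}

namespace IsTorsionMap

variable (hF : IsTorsionMap ξ F)
include hF

theorem deck_eq (m n : ℤ) {q : T3} (hq : q ∈ slab) : F (deck m n q) = F q :=
  ((hF.eq_iff q hq _ (deck_mem_slab hq)).2 ⟨m, n, rfl, rfl, rfl⟩).symm

theorem exists_deck {q q' : T3} (hq : q ∈ slab) (hq' : q' ∈ slab) (h : F q = F q') :
    ∃ m n : ℤ, q' = deck m n q := by
  obtain ⟨m, n, h1, h2, h3⟩ := (hF.eq_iff q hq q' hq').1 h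
  exact ⟨m, n, by ext <;> simp [deck, h1, h2, h3]⟩

theorem theta_eq {q q' : T3} (hq : q ∈ slab) (hq' : q' ∈ slab) (h : F q = F q') :
    q.2.2 = q'.2.2 := by
  obtain ⟨m, n, -, -, h3⟩ := (hF.eq_iff q hq q' hq').1 h
  exact h3.symm

theorem contMDiffAt {q : T3} (hq : q ∈ slabInt) : ContMDiffAt 𝓘(ℝ, T3) (𝓡 3) ∞ F q :=
  hF.smooth.contMDiffAt (slab_mem_nhds hq)

theorem contMDiffOn_slabInt : ContMDiffOn 𝓘(ℝ, T3) (𝓡 3) ∞ F slabInt :=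
  hF.smooth.mono slabInt_subset_slab

omit hF in
theorem _root_.ContactThree.rawW_eq_rawD {F : T3 → M} {q : T3} (hq : q ∈ slabInt) :
    rawW F q = rawD F q :=
  mfderivWithin_of_mem_nhds (slab_mem_nhds hq)

theorem rawW_injective {q : T3} (hq : q ∈ slab) : Function.Injective (rawW F q) :=
  hF.immersion q hq

theorem rawW_surjective {q : T3} (hq : q ∈ slab) : Function.Surjective (rawW F q) := by
  have h : Function.Surjective (rawW F q : T3 →ₗ[ℝ] E3) :=
    (LinearMap.injective_iff_surjective_of_finrank_eq_finrank (by simp)).1 (hF.rawW_injective hq)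
  exact h

theorem rawD_injective {q : T3} (hq : q ∈ slabInt) : Function.Injective (rawD F q) := by
  rw [← rawW_eq_rawD hq]; exact hF.rawW_injective (slabInt_subset_slab hq)

theorem rawD_surjective {q : T3} (hq : q ∈ slabInt) : Function.Surjective (rawD F q) := by
  rw [← rawW_eq_rawD hq]; exact hF.rawW_surjective (slabInt_subset_slab hq)

theorem isCompact_image {K : Set ℝ} (hK : IsCompact K) (hK1 : K ⊆ Icc 0 1) :
    IsCompact (F '' {q | q.2.2 ∈ K}) := by
  have h1 : IsCompact (F '' (Icc (0 : ℝ) 1 ×ˢ Icc (0 : ℝ) 1 ×ˢ K)) := by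
    refine (isCompact_Icc.prod (isCompact_Icc.prod hK)).image_of_continuousOn
      (hF.smooth.continuousOn.mono ?_)
    rintro q ⟨-, -, hq⟩
    exact hK1 hq
  convert h1 using 1
  refine subset_antisymm ?_ (image_mono fun q hq => hq.2.2)
  rintro _ ⟨q, hq, rfl⟩
  refine ⟨deck (-⌊q.1⌋) (-⌊q.2.1⌋) q, ⟨?_, ?_, hq⟩, hF.deck_eq _ _ (hK1 hq)⟩
  · simp only [deck, mem_Icc, Int.cast_neg]
    exact ⟨by linarith [Int.floor_le q.1], by linarith [Int.lt_floor_add_one q.1]⟩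
  · simp only [deck, mem_Icc, Int.cast_neg]
    exact ⟨by linarith [Int.floor_le q.2.1], by linarith [Int.lt_floor_add_one q.2.1]⟩

/-- The inverse of `F` is continuous, up to deck transformations. -/
theorem exists_nhds_deck [T2Space M] {q₀ : T3} (hq₀ : q₀ ∈ slab) {W : Set T3}
    (hW : W ∈ 𝓝 q₀) :
    ∃ U ∈ 𝓝 (F q₀), ∀ q ∈ slab, F q ∈ U → ∃ m n : ℤ, deck m n q ∈ W := by
  obtain ⟨W', hW'W, hW'o, hq₀W'⟩ := mem_nhds_iff.1 hW
  set K : Set T3 := (Icc (q₀.1 - 1 / 2) (q₀.1 + 1 / 2) ×ˢ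
    Icc (q₀.2.1 - 1 / 2) (q₀.2.1 + 1 / 2) ×ˢ Icc (0 : ℝ) 1) \ W' with hK
  have hKc : IsCompact K := (isCompact_Icc.prod (isCompact_Icc.prod isCompact_Icc)).diff hW'o
  have hKs : K ⊆ slab := fun q hq => hq.1.2.2
  have hc : IsClosed (F '' K) :=
    (hKc.image_of_continuousOn (hF.smooth.continuousOn.mono hKs)).isClosed
  refine ⟨(F '' K)ᶜ, hc.isOpen_compl.mem_nhds ?_, ?_⟩
  · rintro ⟨q, hq, he⟩
    obtain ⟨m, n, h⟩ := hF.exists_deck hq₀ (hKs hq) he.symm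
    have h1 := hq.1.1
    have h2 := hq.1.2.1
    rw [h] at h1 h2
    simp only [deck, mem_Icc] at h1 h2
    have hm : m = 0 := by
      have h3 : (m : ℝ) < 1 := by linarith
      have h4 : (-1 : ℝ) < m := by linarith
      have h5 : m < 1 := by exact_mod_cast h3
      have h6 : -1 < m := by exact_mod_cast h4
      omega
    have hn : n = 0 := by
      have h3 : (n : ℝ) < 1 := by linarith
      have h4 : (-1 : ℝ) < n := by linarith
      have h5 : n < 1 := by exact_mod_cast h3
      have h6 : -1 < n := by exact_mod_cast h4
      omega
    have : q = q₀ := by rw [h, hm, hn]; ext <;> simp [deck]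
    exact hq.2 (this ▸ hq₀W')
  · intro q hq hqU
    refine ⟨-round (q.1 - q₀.1), -round (q.2.1 - q₀.2.1), ?_⟩
    by_contra hcon
    refine hqU ⟨deck (-round (q.1 - q₀.1)) (-round (q.2.1 - q₀.2.1)) q,
      ⟨⟨?_, ?_, hq⟩, fun h => hcon (hW'W h)⟩, hF.deck_eq _ _ hq⟩
    · have := abs_le.1 (abs_sub_round (q.1 - q₀.1))
      simp only [deck, mem_Icc, Int.cast_neg]
      exact ⟨by linarith, by linarith⟩
    · have := abs_le.1 (abs_sub_round (q.2.1 - q₀.2.1))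
      simp only [deck, mem_Icc, Int.cast_neg]
      exact ⟨by linarith, by linarith⟩

variable [IsManifold (𝓡 3) ∞ M]

/-- The inverse of `F` is a chart, locally. -/
theorem exists_chart (A : E3 ≃L[ℝ] T3) {q₀ : T3} (hq₀ : q₀ ∈ slabInt) {W : Set T3}
    (hW : W ∈ 𝓝 q₀) :
    ∃ e ∈ IsManifold.maximalAtlas (𝓡 3) ∞ M, A.symm q₀ ∈ e.target ∧
      ∀ y ∈ e.target, A y ∈ W ∩ slabInt ∧ e.symm y = F (A y) := by
  obtain ⟨W', hW'W, hW'o, hq₀W'⟩ := mem_nhds_iff.1 hW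
  obtain ⟨e, he, h1, h2⟩ := exists_chart_of_immersion A (hW'o.inter isOpen_slabInt)
    (hF.contMDiffOn_slabInt.mono inter_subset_right) ⟨hq₀W', hq₀⟩ (hF.rawD_injective hq₀)
  exact ⟨e, he, h1, fun y hy => ⟨⟨hW'W (h2 y hy).1.1, (h2 y hy).1.2⟩, (h2 y hy).2⟩⟩

theorem image_mem_nhds {q₀ : T3} (hq₀ : q₀ ∈ slabInt) {W : Set T3} (hW : W ∈ 𝓝 q₀) :
    F '' W ∈ 𝓝 (F q₀) := by
  obtain ⟨e, -, h1, h2⟩ := hF.exists_chart toT3 hq₀ hW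
  have h3 : F q₀ ∈ e.source := by
    have := e.map_target h1
    rwa [(h2 _ h1).2, toT3.apply_symm_apply] at this
  refine mem_of_superset (e.open_source.mem_nhds h3) fun r hr => ?_
  have h4 := h2 (e r) (e.map_source hr)
  rw [e.left_inv hr] at h4
  exact ⟨_, h4.1.1, h4.2.symm⟩

theorem isOpen_image {K : Set ℝ} (hK : IsOpen K) (hK1 : K ⊆ Ioo 0 1) :
    IsOpen (F '' {q | q.2.2 ∈ K}) := by
  rw [isOpen_iff_mem_nhds]
  rintro _ ⟨q, hq, rfl⟩
  exact hF.image_mem_nhds (hK1 hq)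
    ((hK.preimage (continuous_snd.comp continuous_snd)).mem_nhds hq)

theorem contMDiffAt_of_comp {F' : Type*} [NormedAddCommGroup F'] [NormedSpace ℝ F'] {f : M → F'}
    {q : T3} (hq : q ∈ slabInt) (hf : ContDiffAt ℝ ∞ (f ∘ F) q) :
    ContMDiffAt (𝓡 3) 𝓘(ℝ, F') ∞ f (F q) := by
  obtain ⟨e, he, h1, h2⟩ := hF.exists_chart toT3 hq univ_mem
  have h3 : F q ∈ e.source := by
    have := e.map_target h1
    rwa [(h2 _ h1).2, toT3.apply_symm_apply] at this
  have h5 : toT3 (e (F q)) = q := by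
    have := e.right_inv h1
    rw [(h2 _ h1).2, toT3.apply_symm_apply] at this
    rw [this, toT3.apply_symm_apply]
  have h6 : ContMDiffAt (𝓡 3) 𝓘(ℝ, F') ∞ ((f ∘ F) ∘ fun r => toT3 (e r)) (F q) := by
    have h7 : ContMDiffAt (𝓡 3) (𝓡 3) ∞ e (F q) := contMDiffAt_of_mem_maximalAtlas he h3
    have h8 : ContMDiffAt (𝓡 3) 𝓘(ℝ, T3) ∞ (fun r => toT3 (e r)) (F q) :=
      (toT3.contDiff.contMDiff).contMDiffAt.comp _ h7
    refine ContMDiffAt.comp (F q) ?_ h8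
    rw [h5]
    exact hf.contMDiffAt
  refine h6.congr_of_eventuallyEq ?_
  filter_upwards [e.open_source.mem_nhds h3] with r hr
  have h4 := h2 (e r) (e.map_source hr)
  rw [e.left_inv hr] at h4
  simp only [Function.comp_apply, ← h4.2]

/-- A deck invariant function on the slab that is constant near the boundary extends to a smooth
function on `M`. -/
theorem exists_smooth_extension [T2Space M] {F' : Type*} [NormedAddCommGroup F'] [NormedSpace ℝ F']
    {k : T3 → F'} (hk : ContDiffOn ℝ ∞ k slabInt) (hper : ∀ m n q, q ∈ slab → k (deck m n q) = k q)
    {a : F'} {η : ℝ} (hη : 0 < η) (ha : ∀ q ∈ slab, q.2.2 ∉ Icc η (1 - η) → k q = a) :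
    ∃ h : M → F', ContMDiff (𝓡 3) 𝓘(ℝ, F') ∞ h ∧ (∀ q ∈ slab, h (F q) = k q) ∧
      ∀ r, r ∉ F '' {q | q.2.2 ∈ Icc η (1 - η)} → h r = a := by
  classical
  set h : M → F' := fun r => if hr : ∃ q ∈ slab, F q = r then k hr.choose else a with hh
  have h1 : ∀ q ∈ slab, h (F q) = k q := by
    intro q hq
    have hex : ∃ q' ∈ slab, F q' = F q := ⟨q, hq, rfl⟩
    rw [hh]
    simp only [dif_pos hex]
    obtain ⟨m, n, hd⟩ := hF.exists_deck hex.choose_spec.1 hq hex.choose_spec.2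
    conv_rhs => rw [hd]
    exact (hper m n _ hex.choose_spec.1).symm
  have h2 : ∀ r, r ∉ F '' {q | q.2.2 ∈ Icc η (1 - η)} → h r = a := by
    intro r hr
    by_cases hex : ∃ q ∈ slab, F q = r
    · obtain ⟨q, hq, rfl⟩ := hex
      rw [h1 q hq]
      exact ha q hq fun h => hr ⟨q, h, rfl⟩
    · rw [hh]
      simp only [dif_neg hex]
  refine ⟨h, fun r => ?_, h1, h2⟩
  have hsub : Icc η (1 - η) ⊆ Ioo 0 1 := fun t ht => ⟨by linarith [ht.1], by linarith [ht.2]⟩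
  by_cases hr : r ∈ F '' {q | q.2.2 ∈ Icc η (1 - η)}
  · obtain ⟨q, hq, rfl⟩ := hr
    have hqi : q ∈ slabInt := hsub hq
    refine hF.contMDiffAt_of_comp hqi ?_
    refine ((hk.contDiffAt (isOpen_slabInt.mem_nhds hqi))).congr_of_eventuallyEq ?_
    filter_upwards [slab_mem_nhds hqi] with q' hq'
    exact h1 q' hq'
  · have hcl : IsClosed (F '' {q | q.2.2 ∈ Icc η (1 - η)}) :=
      (hF.isCompact_image isCompact_Icc (hsub.trans Ioo_subset_Icc_self)).isClosed
    refine (contMDiffAt_const (c := a)).congr_of_eventuallyEq ?_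
    filter_upwards [hcl.isOpen_compl.mem_nhds hr] with r' hr'
    exact h2 r' hr'

end IsTorsionMap
end TorsionMap

/-! ### Contact forms on the thickened torus -/

section Kappa

variable {M : Type*} [TopologicalSpace M] [ChartedSpace E3 M]
variable {ξ : ∀ p : M, Submodule ℝ (TangentSpace (𝓡 3) p)} {F : T3 → M}
variable {lam : ∀ p : M, TangentSpace (𝓡 3) p →L[ℝ] ℝ}

/-- The vector `cos (2πθ) ∂_x + sin (2πθ) ∂_y`. -/
def radial (q : T3) : T3 :=
  (Real.cos (2 * Real.pi * q.2.2), Real.sin (2 * Real.pi * q.2.2), 0)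

theorem alpha_radial (q : T3) : alpha q (radial q) = 1 := by
  simp only [alpha_apply, radial]
  nlinarith [Real.cos_sq_add_sin_sq (2 * Real.pi * q.2.2)]

theorem contDiff_radial : ContDiff ℝ ∞ radial := by
  unfold radial
  fun_prop

/-- The factor of proportionality between the pullback of a contact form to the thickened torus
and the standard form. -/
def kappa (lam : ∀ p : M, TangentSpace (𝓡 3) p →L[ℝ] ℝ) (F : T3 → M) (q : T3) : ℝ :=
  rawF lam (F q) (rawW F q (radial q))

theorem kappa_scale (h : M → ℝ) (q : T3) : kappa (scale h lam) F q = h (F q) * kappa lam F q := rfl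

namespace IsTorsionMap

variable (hF : IsTorsionMap ξ F)
include hF

theorem mdifferentiableWithinAt {q : T3} (hq : q ∈ slab) :
    MDifferentiableWithinAt 𝓘(ℝ, T3) (𝓡 3) F slab q :=
  (hF.smooth q hq).mdifferentiableWithinAt (by simp)

theorem rawF_rawW (hlam : IsContactFormFor ξ lam) {q : T3} (hq : q ∈ slab) (v : T3) :
    rawF lam (F q) (rawW F q v) = kappa lam F q * alpha q v := by
  have key : ∀ v, alpha q v = 0 → rawF lam (F q) (rawW F q v) = 0 := by
    intro v hv
    rw [alpha_apply] at hv
    exact (hlam.2 (F q) _).1 ((hF.mem_iff q hq v).2 hv)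
  have h1 : alpha q (v - alpha q v • radial q) = 0 := by
    rw [map_sub, map_smul, alpha_radial]; simp
  have h2 := key _ h1
  rw [map_sub, map_smul, map_sub, map_smul, sub_eq_zero] at h2
  rw [h2, kappa, smul_eq_mul, mul_comm]

theorem kappa_ne_zero (hlam : IsContactFormFor ξ lam) {q : T3} (hq : q ∈ slab) :
    kappa lam F q ≠ 0 := by
  intro h
  have h1 := (hF.mem_iff q hq (radial q)).1 ((hlam.2 (F q) _).2 h)
  rw [← alpha_apply, alpha_radial] at h1
  exact one_ne_zero h1

theorem pullForm_eq (hlam : IsContactFormFor ξ lam) {q : T3} (hq : q ∈ slabInt) :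
    pullForm lam F q = kappa lam F q • alpha q := by
  refine ContinuousLinearMap.ext fun v => ?_
  have := hF.rawF_rawW hlam (slabInt_subset_slab hq) v
  rw [rawW_eq_rawD hq] at this
  exact this

theorem rawW_deck (m n : ℤ) {q : T3} (hq : q ∈ slab) : rawW F (deck m n q) = rawW F q := by
  have h1 : HasFDerivWithinAt (deck m n) (ContinuousLinearMap.id ℝ T3) slab q := by
    have : deck m n = fun q => q + ((m : ℝ), (n : ℝ), (0 : ℝ)) := funext (deck_eq_add m n)
    rw [this]
    exact (hasFDerivWithinAt_id q slab).add_const _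
  have h2 : HasMFDerivWithinAt 𝓘(ℝ, T3) (𝓡 3) F slab (deck m n q) (rawW F (deck m n q)) :=
    (hF.mdifferentiableWithinAt (deck_mem_slab hq)).hasMFDerivWithinAt
  have h3 := HasMFDerivWithinAt.comp q h2 h1.hasMFDerivWithinAt
    (fun q' hq' => deck_mem_slab (m := m) (n := n) hq')
  have h4 : HasMFDerivWithinAt 𝓘(ℝ, T3) (𝓡 3) (F ∘ deck m n) slab q (rawW F q) := by
    have h5 : HasMFDerivWithinAt 𝓘(ℝ, T3) (𝓡 3) F slab q (rawW F q) :=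
      (hF.mdifferentiableWithinAt hq).hasMFDerivWithinAt
    exact HasMFDerivWithinAt.congr_mono h5 (fun q' hq' => hF.deck_eq m n hq')
      (hF.deck_eq m n hq) subset_rfl
  have hu : UniqueMDiffWithinAt 𝓘(ℝ, T3) slab q := (uniqueDiffOn_slab q hq).uniqueMDiffWithinAt
  have := hu.eq h3 h4
  exact this

theorem rawD_deck (m n : ℤ) {q : T3} (hq : q ∈ slabInt) : rawD F (deck m n q) = rawD F q := by
  rw [← rawW_eq_rawD hq, ← rawW_eq_rawD (deck_mem_slabInt hq),
    hF.rawW_deck m n (slabInt_subset_slab hq)]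

theorem kappa_deck (m n : ℤ) {q : T3} (hq : q ∈ slab) :
    kappa lam F (deck m n q) = kappa lam F q := by
  have : radial (deck m n q) = radial q := rfl
  rw [kappa, hF.rawW_deck m n hq, hF.deck_eq m n hq, this, kappa]

variable [IsManifold (𝓡 3) ∞ M]

theorem chD_comp_rawW {q : T3} (hq : q ∈ slab) {p : M}
    (hp : F q ∈ (extChartAt (𝓡 3) p).source) (v : T3) :
    chD p (F q) (rawW F q v) = fderivWithin ℝ (extChartAt (𝓡 3) p ∘ F) slab q v := by
  have : IsManifold (𝓡 3) 1 M := .of_le (n := ∞) (by simp)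
  have h1 : MDifferentiableAt (𝓡 3) 𝓘(ℝ, E3) (extChartAt (𝓡 3) p) (F q) :=
    mdifferentiableAt_extChartAt (by simpa using hp)
  have hu : UniqueMDiffWithinAt 𝓘(ℝ, T3) slab q := (uniqueDiffOn_slab q hq).uniqueMDiffWithinAt
  have := mfderiv_comp_mfderivWithin q h1 (hF.mdifferentiableWithinAt hq) hu
  rw [mfderivWithin_eq_fderivWithin] at this
  exact (congrArg (fun L : T3 →L[ℝ] E3 => L v) this).symm

theorem contDiffWithinAt_chart {q : T3} (hq : q ∈ slab) {p : M}
    (hp : F q ∈ (extChartAt (𝓡 3) p).source) :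
    ContDiffWithinAt ℝ ∞ (extChartAt (𝓡 3) p ∘ F) slab q := by
  have h1 : ContMDiffAt (𝓡 3) 𝓘(ℝ, E3) ∞ (extChartAt (𝓡 3) p) (F q) :=
    contMDiffAt_extChartAt' (by simpa using hp)
  exact (h1.comp_contMDiffWithinAt q (hF.smooth q hq)).contDiffWithinAt

theorem contDiffWithinAt_fderivWithin {q : T3} (hq : q ∈ slab) {p : M}
    (hp : F q ∈ (extChartAt (𝓡 3) p).source) :
    ContDiffWithinAt ℝ ∞ (fderivWithin ℝ (extChartAt (𝓡 3) p ∘ F) slab) slab q :=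
  (hF.contDiffWithinAt_chart hq hp).fderivWithin_right uniqueDiffOn_slab (by simp) hq

omit [IsManifold (𝓡 3) ∞ M] in
theorem eventually_mem_source {q : T3} (hq : q ∈ slab) {p : M}
    (hp : F q ∈ (extChartAt (𝓡 3) p).source) :
    ∀ᶠ q' in 𝓝[slab] q, F q' ∈ (extChartAt (𝓡 3) p).source :=
  (hF.smooth.continuousOn q hq).eventually ((isOpen_extChartAt_source p).mem_nhds hp)

theorem contDiffOn_kappa (hlam : IsSmoothForm lam) : ContDiffOn ℝ ∞ (kappa lam F) slab := by
  intro q hq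
  set p := F q with hp
  have hs : F q ∈ (extChartAt (𝓡 3) p).source := mem_extChartAt_source p
  have h1 := hF.contDiffWithinAt_fderivWithin hq hs
  have h2 := hF.contDiffWithinAt_chart hq hs
  have h3 : ContDiffAt ℝ ∞ (formInChart lam p) ((extChartAt (𝓡 3) p ∘ F) q) :=
    (hlam p).contDiffAt ((isOpen_chart_target p).mem_nhds ((extChartAt (𝓡 3) p).map_source hs))
  have h4 : ContDiffWithinAt ℝ ∞ (fun q => formInChart lam p ((extChartAt (𝓡 3) p ∘ F) q)
      (fderivWithin ℝ (extChartAt (𝓡 3) p ∘ F) slab q (radial q))) slab q :=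
    (h3.comp_contDiffWithinAt q h2).clm_apply
      (h1.clm_apply contDiff_radial.contDiffAt.contDiffWithinAt)
  refine h4.congr_of_eventuallyEq_of_mem ?_ hq
  filter_upwards [hF.eventually_mem_source hq hs, self_mem_nhdsWithin] with q' h5 h6
  rw [← hF.chD_comp_rawW h6 h5, Function.comp_apply, formInChart_chD lam h5]
  rfl

theorem kappa_pos_or_neg (hlam : IsContactFormFor ξ lam) :
    (∀ q ∈ slab, 0 < kappa lam F q) ∨ ∀ q ∈ slab, kappa lam F q < 0 := by
  have hc := (hF.contDiffOn_kappa hlam.1.smooth).continuousOn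
  have hpre := convex_slab.isPreconnected.image _ hc
  by_contra hcon
  push Not at hcon
  obtain ⟨⟨q, hq, h1⟩, q', hq', h2⟩ := hcon
  have := hpre.Icc_subset (mem_image_of_mem _ hq) (mem_image_of_mem _ hq') ⟨h1, h2⟩
  obtain ⟨q'', hq'', h3⟩ := this
  exact hF.kappa_ne_zero hlam hq'' h3

/-- There is a contact form that is a positive multiple of the standard form on the torsion
domain. -/
theorem exists_contactForm_kappa_pos (hξ : IsContactStructure ξ) :
    ∃ lam, IsContactFormFor ξ lam ∧ ∀ q ∈ slab, 0 < kappa lam F q := by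
  obtain ⟨lam, hlam⟩ := hξ
  rcases hF.kappa_pos_or_neg hlam with h | h
  · exact ⟨lam, hlam, h⟩
  · refine ⟨scale (fun _ => -1) lam, isContactFormFor_scale hlam contMDiff_const (by simp), ?_⟩
    intro q hq
    rw [kappa_scale]
    linarith [h q hq]

/-- The Reeb field on the interior of the thickened torus. -/
theorem reeb_eq_torsVec (hlam : IsContactFormFor ξ lam) {q : T3} (hq : q ∈ slabInt) :
    reeb lam (F q) = rawD F q (torsVec (kappa lam F) q) := by
  have hd : DifferentiableAt ℝ (kappa lam F) q :=
    ((hF.contDiffOn_kappa hlam.1.smooth).contDiffAt (slab_mem_nhds hq)).differentiableAt (by simp)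
  have h0 := hF.kappa_ne_zero hlam (slabInt_subset_slab hq)
  refine reeb_eq hlam.1 ⟨fun w => ?_, ?_⟩
  · obtain ⟨w, rfl⟩ := hF.rawD_surjective hq w
    rw [← dOne_pullForm hlam.1.smooth (hF.contMDiffAt hq), ← dOne_torsVec hd h0 w]
    have he : pullForm lam F =ᶠ[𝓝 q] fun q => kappa lam F q • alpha q := by
      filter_upwards [isOpen_slabInt.mem_nhds hq] with q' hq'
      exact hF.pullForm_eq hlam hq'
    rw [dOne, dOne, he.fderiv_eq]
  · have h1 := smul_alpha_torsVec h0
    rw [← hF.pullForm_eq hlam hq] at h1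
    exact h1

end IsTorsionMap
end Kappa

/-! ### Normalization at the boundary of the thickened torus -/

section Normalization

variable {M : Type*} [TopologicalSpace M] [ChartedSpace E3 M]
variable {ξ : ∀ p : M, Submodule ℝ (TangentSpace (𝓡 3) p)} {F : T3 → M}
variable {lam : ∀ p : M, TangentSpace (𝓡 3) p →L[ℝ] ℝ}

namespace IsTorsionMap

variable (hF : IsTorsionMap ξ F)
include hF

variable [IsManifold (𝓡 3) ∞ M] [T2Space M]

/-- Near a boundary point of the thickened torus, a function on the boundary torus has a smooth
extension. The parametrization is extended beyond the boundary torus along straight lines in a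
chart, which are transverse to the torus. -/
theorem exists_local_extension {q₀ : T3} (hq₀ : q₀ ∈ slab) (hθ : q₀.2.2 = 0 ∨ q₀.2.2 = 1)
    {k : T3 → ℝ} (hk : ContDiffOn ℝ ∞ k slab) (hper : ∀ m n q, q ∈ slab → k (deck m n q) = k q)
    (hpos : ∀ q ∈ slab, 0 < k q) :
    ∃ U ∈ 𝓝 (F q₀), ∃ g : M → ℝ, ContMDiffOn (𝓡 3) 𝓘(ℝ, ℝ) ∞ g U ∧ ∀ r ∈ U, 0 < g r ∧
      ∀ q ∈ slab, (q.2.2 = 0 ∨ q.2.2 = 1) → F q = r → g r = k q := by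
  have hman : IsManifold (𝓡 3) 1 M := .of_le (n := ∞) (by simp)
  set p := F q₀ with hp
  have hs : F q₀ ∈ (extChartAt (𝓡 3) p).source := mem_extChartAt_source p
  set c := extChartAt (𝓡 3) p with hc
  -- the projection to the boundary torus
  set π₀ : T3 → T3 := fun q => (q.1, q.2.1, q₀.2.2) with hπ₀
  have hπs : ∀ q, π₀ q ∈ slab := fun q => hq₀
  have hπd : ContDiff ℝ ∞ π₀ := by rw [hπ₀]; fun_prop
  set w : E3 := chD p (F q₀) (rawW F q₀ (0, 0, 1)) with hw
  set H : T3 → E3 := fun q => (c ∘ F) (π₀ q) + q.2.2 • w with hH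
  set G : T3 → M := fun q => c.symm (H q) with hG
  set o : T3 := (q₀.1, q₀.2.1, 0) with ho
  have hπo : π₀ o = q₀ := rfl
  have hcont : ContinuousAt (fun q => F (π₀ q)) o := by
    have h1 : ContinuousWithinAt F slab (π₀ o) := hF.smooth.continuousOn _ (hπs o)
    exact (h1.tendsto.comp (tendsto_nhdsWithin_iff.2
      ⟨hπd.continuous.continuousAt, Eventually.of_forall hπs⟩))
  have hHat : ∀ q, F (π₀ q) ∈ c.source → ContDiffAt ℝ ∞ H q := by
    intro q hq
    have h1 : ContDiffWithinAt ℝ ∞ (c ∘ F) slab (π₀ q) := hF.contDiffWithinAt_chart (hπs q) hq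
    have h2 : ContDiffAt ℝ ∞ (fun q => (c ∘ F) (π₀ q)) q := by
      have := h1.comp (s := univ) q hπd.contDiffAt.contDiffWithinAt fun q' _ => hπs q'
      rwa [contDiffWithinAt_univ] at this
    exact h2.add (by fun_prop)
  have hHo : H o = c (F q₀) := by
    change (c ∘ F) (π₀ o) + (0 : ℝ) • w = _
    rw [hπo, zero_smul, add_zero, Function.comp_apply]
  -- a neighbourhood on which the extended parametrization is smooth
  have hev : ∀ᶠ q in 𝓝 o, F (π₀ q) ∈ c.source ∧ H q ∈ c.target := by
    refine (hcont.eventually ((isOpen_extChartAt_source p).mem_nhds hs)).and ?_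
    refine (hHat o hs).continuousAt.eventually ((isOpen_chart_target p).mem_nhds ?_)
    rw [hHo]
    exact c.map_source hs
  obtain ⟨Ω, hΩ, hΩo, hoΩ⟩ := eventually_nhds_iff.1 hev
  have hGs : ContMDiffOn 𝓘(ℝ, T3) (𝓡 3) ∞ G Ω := fun q hq =>
    ((contMDiffAt_chart_symm p (hΩ q hq).2).comp q
      (hHat q (hΩ q hq).1).contMDiffAt).contMDiffWithinAt
  have hHd : ∀ v, fderiv ℝ H o v = chD p (F q₀) (rawW F q₀ v) := by
    intro v
    have h1 : HasFDerivWithinAt (c ∘ F) (fderivWithin ℝ (c ∘ F) slab q₀) slab (π₀ o) :=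
      ((hF.contDiffWithinAt_chart hq₀ hs).differentiableWithinAt (by simp)).hasFDerivWithinAt
    have h2 : HasFDerivAt π₀ ((ContinuousLinearMap.fst ℝ ℝ (ℝ × ℝ)).prod
        (((ContinuousLinearMap.fst ℝ ℝ ℝ).comp (ContinuousLinearMap.snd ℝ ℝ (ℝ × ℝ))).prod 0)) o :=
      hasFDerivAt_fst.prodMk ((hasFDerivAt_fst.comp o hasFDerivAt_snd).prodMk
        (hasFDerivAt_const _ _))
    have h3 := h1.comp_hasFDerivAt o h2 (Eventually.of_forall hπs)
    have h4 : HasFDerivAt (fun q : T3 => q.2.2 • w) (((ContinuousLinearMap.snd ℝ ℝ ℝ).comp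
        (ContinuousLinearMap.snd ℝ ℝ (ℝ × ℝ))).smulRight w) o :=
      ((hasFDerivAt_snd.comp o hasFDerivAt_snd)).smul_const w
    have h5 := (h3.add h4).fderiv
    have h6 : fderiv ℝ H o v = fderivWithin ℝ (c ∘ F) slab q₀ (v.1, v.2.1, 0) + v.2.2 • w := by
      have := congrArg (fun L : T3 →L[ℝ] E3 => L v) h5
      exact this
    rw [h6, hw, hF.chD_comp_rawW hq₀ hs, hF.chD_comp_rawW hq₀ hs, ← map_smul, ← map_add]
    congr 1
    ext <;> simp
  have hinj : Function.Injective (rawD G o) := by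
    intro v v' hvv
    have hGo : G o ∈ c.source := by
      rw [hG]; simp only [hHo]; rw [c.left_inv hs]; exact hs
    have hmd := (hGs.contMDiffAt (hΩo.mem_nhds hoΩ)).mdifferentiableAt (by simp)
    have he : c ∘ G =ᶠ[𝓝 o] H := by
      filter_upwards [hΩo.mem_nhds hoΩ] with q hq
      exact c.right_inv (hΩ q hq).2
    have h1 : ∀ v, chD p (F q₀) (rawW F q₀ v) = chD p (G o) (rawD G o v) := by
      intro v
      rw [chD_comp_rawD hmd hGo, ← hHd, he.fderiv_eq]
    have h2 : rawW F q₀ v = rawW F q₀ v' := by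
      have h3 : chD p (F q₀) (rawW F q₀ v) = chD p (F q₀) (rawW F q₀ v') := by
        rw [h1, h1, hvv]
      rw [← rawD_symm_comp_chD p hs (rawW F q₀ v), h3, rawD_symm_comp_chD p hs]
    exact hF.rawW_injective hq₀ h2
  obtain ⟨e, he, heo, hes⟩ := exists_chart_of_immersion toT3 hΩo hGs hoΩ hinj
  have hGo : G o = F q₀ := by
    rw [hG]; simp only [hHo]; exact c.left_inv hs
  have hsrc : F q₀ ∈ e.source := by
    have := e.map_target heo
    rwa [(hes _ heo).2, toT3.apply_symm_apply, hGo] at this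
  -- points of the slab close to the base point lie in the domain of the chart
  have hW : {q : T3 | toT3.symm (q.1, q.2.1, 0) ∈ e.target ∧ |q.2.2 - q₀.2.2| < 1} ∈ 𝓝 q₀ := by
    refine Filter.inter_mem ?_ ?_
    · have h1 : Continuous fun q : T3 => toT3.symm (q.1, q.2.1, (0 : ℝ)) :=
        toT3.symm.continuous.comp (by fun_prop)
      exact h1.continuousAt.preimage_mem_nhds (e.open_target.mem_nhds heo)
    · have h1 : Continuous fun q : T3 => |q.2.2 - q₀.2.2| := by fun_prop
      exact h1.continuousAt.preimage_mem_nhds (Iio_mem_nhds (by simp))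
  obtain ⟨U, hU, hUW⟩ := hF.exists_nhds_deck hq₀ hW
  refine ⟨U ∩ e.source, inter_mem hU (e.open_source.mem_nhds hsrc),
    fun r => k (π₀ (toT3 (e r))), ?_, ?_⟩
  · have h1 : ContMDiffOn (𝓡 3) (𝓡 3) ∞ e e.source := contMDiffOn_of_mem_maximalAtlas he
    have h2 : ContDiff ℝ ∞ fun y => k (π₀ (toT3 y)) := by
      rw [← contDiffOn_univ]
      exact hk.comp (hπd.comp toT3.contDiff).contDiffOn fun y _ => hπs _
    exact (h2.contMDiff.comp_contMDiffOn h1).mono inter_subset_right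
  · intro r hr
    refine ⟨hpos _ (hπs _), ?_⟩
    intro q hq hqθ hqr
    obtain ⟨m, n, hmn⟩ := hUW q hq (hqr ▸ hr.1)
    have hθ' : q.2.2 = q₀.2.2 := by
      have h1 : |q.2.2 - q₀.2.2| < 1 := hmn.2
      rcases hqθ with h | h <;> rcases hθ with h' | h'
      · rw [h, h']
      · rw [h, h'] at h1; norm_num at h1
      · rw [h, h'] at h1; norm_num at h1
      · rw [h, h']
    have h1 := hes _ hmn.1
    have h2 : G ((deck m n q).1, (deck m n q).2.1, 0) = F q := by
      have h3 : π₀ ((deck m n q).1, (deck m n q).2.1, 0) = deck m n q := by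
        ext <;> simp [hπ₀, deck, hθ']
      have h4 := h1.1
      rw [toT3.apply_symm_apply] at h4
      have h5 := (hΩ _ h4).1
      rw [h3] at h5
      rw [hG]
      simp only [hH, Function.comp_apply, h3, zero_smul, add_zero]
      rw [c.left_inv h5, hF.deck_eq m n hq]
    have h3 : e r = toT3.symm ((deck m n q).1, (deck m n q).2.1, 0) := by
      rw [← hqr, ← h2, ← toT3.apply_symm_apply ((deck m n q).1, (deck m n q).2.1, (0 : ℝ)),
        ← h1.2, e.right_inv hmn.1, toT3.apply_symm_apply]
    have h4 : π₀ (toT3 (e r)) = deck m n q := by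
      rw [h3, toT3.apply_symm_apply]
      ext <;> simp [hπ₀, deck, hθ']
    change k (π₀ (toT3 (e r))) = k q
    rw [h4, hper m n q hq]

/-- There is a contact form whose pullback to the thickened torus agrees with the standard form on
the boundary. -/
theorem exists_normalized_contactForm [CompactSpace M] (hξ : IsContactStructure ξ) :
    ∃ lam, IsContactFormFor ξ lam ∧ (∀ q ∈ slab, 0 < kappa lam F q) ∧
      ∀ q ∈ slab, (q.2.2 = 0 ∨ q.2.2 = 1) → kappa lam F q = 1 := by
  obtain ⟨lam, hlam, hpos⟩ := hF.exists_contactForm_kappa_pos hξ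
  set t : M → Set ℝ := fun r => {a | 0 < a ∧ ∀ q ∈ slab, (q.2.2 = 0 ∨ q.2.2 = 1) → F q = r →
    a = (kappa lam F q)⁻¹} with ht
  have hconv : ∀ r, Convex ℝ (t r) := by
    intro r
    refine (convex_Ioi (0 : ℝ)).inter ?_
    intro a ha b hb u v hu hv huv q hq hθ hr
    rw [ha q hq hθ hr, hb q hq hθ hr, ← add_smul, huv, one_smul]
  have hloc : ∀ r, ∃ U ∈ 𝓝 r, ∃ g : M → ℝ, ContMDiffOn (𝓡 3) 𝓘(ℝ, ℝ) ∞ g U ∧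
      ∀ y ∈ U, g y ∈ t y := by
    intro r
    by_cases hr : r ∈ F '' {q | q.2.2 ∈ ({0, 1} : Set ℝ)}
    · obtain ⟨q₀, hq₀, rfl⟩ := hr
      have hsl : q₀ ∈ slab := by
        rcases hq₀ with h | h <;> simp only [slab, mem_ofPred_eq, mem_singleton_iff] at * <;>
          rw [h] <;> simp
      obtain ⟨U, hU, g, hg, hgU⟩ := hF.exists_local_extension (k := fun q => (kappa lam F q)⁻¹) hsl hq₀
        ((hF.contDiffOn_kappa hlam.1.smooth).inv fun q hq => (hpos q hq).ne')
        (fun m n q hq => by rw [hF.kappa_deck m n hq]) (fun q hq => inv_pos.2 (hpos q hq))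
      exact ⟨U, hU, g, hg, hgU⟩
    · have hcl : IsClosed (F '' {q | q.2.2 ∈ ({0, 1} : Set ℝ)}) :=
        (hF.isCompact_image (Set.toFinite _).isCompact (by
          intro x hx; rcases hx with rfl | rfl <;> simp)).isClosed
      refine ⟨_, hcl.isOpen_compl.mem_nhds hr, fun _ => 1, contMDiffOn_const, ?_⟩
      intro y hy
      refine ⟨one_pos, fun q hq hθ hqy => (hy ⟨q, hθ, hqy⟩).elim⟩
  obtain ⟨μ, hμ⟩ := exists_contMDiffMap_forall_mem_convex_of_local (𝓡 3) hconv hloc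
  refine ⟨scale μ lam, isContactFormFor_scale hlam μ.contMDiff fun p => (hμ p).1.ne', ?_, ?_⟩
  · intro q hq
    rw [kappa_scale]
    exact mul_pos (hμ _).1 (hpos q hq)
  · intro q hq hθ
    rw [kappa_scale, (hμ (F q)).2 q hq hθ rfl, inv_mul_cancel₀ (hpos q hq).ne']

end IsTorsionMap
end Normalization

/-! ### The profile curve -/

section Profile

/-- A cutoff function on `[0, 1]`: it vanishes at distance at most `δ / 2` from the ends, and is `1`
at distance at least `δ` from them. -/
def cutoff (δ θ : ℝ) : ℝ :=
  Real.smoothTransition (2 * θ / δ - 1) * Real.smoothTransition (2 * (1 - θ) / δ - 1)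

theorem contDiff_cutoff (δ : ℝ) : ContDiff ℝ ∞ (cutoff δ) := by
  have h : ContDiff ℝ ∞ Real.smoothTransition := Real.smoothTransition.contDiff
  exact (h.comp (by fun_prop)).mul (h.comp (by fun_prop))

theorem cutoff_nonneg (δ θ : ℝ) : 0 ≤ cutoff δ θ :=
  mul_nonneg (Real.smoothTransition.nonneg _) (Real.smoothTransition.nonneg _)

theorem cutoff_le_one (δ θ : ℝ) : cutoff δ θ ≤ 1 :=
  mul_le_one₀ (Real.smoothTransition.le_one _) (Real.smoothTransition.nonneg _)
    (Real.smoothTransition.le_one _)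

theorem cutoff_eq_one {δ θ : ℝ} (hδ : 0 < δ) (hθ : θ ∈ Icc δ (1 - δ)) : cutoff δ θ = 1 := by
  rw [cutoff, Real.smoothTransition.one_of_one_le, Real.smoothTransition.one_of_one_le, one_mul]
  · have : 2 ≤ 2 * (1 - θ) / δ := by rw [le_div_iff₀ hδ]; linarith [hθ.2]
    linarith
  · have : 2 ≤ 2 * θ / δ := by rw [le_div_iff₀ hδ]; linarith [hθ.1]
    linarith

theorem cutoff_eq_zero {δ θ : ℝ} (hδ : 0 < δ) (hθ : θ ≤ δ / 2 ∨ 1 - δ / 2 ≤ θ) :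
    cutoff δ θ = 0 := by
  rcases hθ with h | h
  · rw [cutoff, Real.smoothTransition.zero_of_nonpos, zero_mul]
    have : 2 * θ / δ ≤ 1 := by rw [div_le_iff₀ hδ]; linarith
    linarith
  · rw [cutoff, mul_comm, Real.smoothTransition.zero_of_nonpos, zero_mul]
    have : 2 * (1 - θ) / δ ≤ 1 := by rw [div_le_iff₀ hδ]; linarith
    linarith

/-- The derivative of the cutoff function is of order `1 / δ`. -/
theorem exists_deriv_cutoff_le : ∃ C > (0 : ℝ), ∀ δ > 0, ∀ θ, |deriv (cutoff δ) θ| ≤ C / δ := by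
  have hsm : ContDiff ℝ 1 Real.smoothTransition := Real.smoothTransition.contDiff (n := 1)
  have hc : Continuous (deriv Real.smoothTransition) := hsm.continuous_deriv le_rfl
  obtain ⟨B, hB⟩ := isCompact_Icc.exists_bound_of_continuousOn (s := Icc (0 : ℝ) 1) hc.continuousOn
  have hB' : ∀ x, |deriv Real.smoothTransition x| ≤ B := by
    intro x
    by_cases hx : x ∈ Icc (0 : ℝ) 1
    · exact hB x hx
    · have h0 : 0 ≤ B := (norm_nonneg _).trans (hB 0 (by simp))
      have h1 : deriv Real.smoothTransition x = 0 := by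
        rw [mem_Icc, not_and_or, not_le, not_le] at hx
        rcases hx with h | h
        · have : Real.smoothTransition =ᶠ[𝓝 x] fun _ => 0 := by
            filter_upwards [Iio_mem_nhds h] with y hy
            exact Real.smoothTransition.zero_of_nonpos (le_of_lt hy)
          rw [this.deriv_eq, deriv_const]
        · have : Real.smoothTransition =ᶠ[𝓝 x] fun _ => 1 := by
            filter_upwards [Ioi_mem_nhds h] with y hy
            exact Real.smoothTransition.one_of_one_le (le_of_lt hy)
          rw [this.deriv_eq, deriv_const]
      rw [h1, abs_zero]; exact h0
  have h0 : 0 ≤ B := (abs_nonneg _).trans (hB' 0)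
  refine ⟨4 * B + 1, by linarith, fun δ hδ θ => ?_⟩
  have hd : ∀ x, HasDerivAt Real.smoothTransition (deriv Real.smoothTransition x) x := fun x =>
    (hsm.differentiable (by simp) x).hasDerivAt
  have h1 : HasDerivAt (fun θ : ℝ => 2 * θ / δ - 1) (2 / δ) θ := by
    have := (((hasDerivAt_id θ).const_mul 2).div_const δ).sub_const 1
    simpa using this
  have h2 : HasDerivAt (fun θ : ℝ => 2 * (1 - θ) / δ - 1) (-2 / δ) θ := by
    have := ((((hasDerivAt_id θ).const_sub 1).const_mul 2).div_const δ).sub_const 1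
    simpa using this
  have h3 := ((hd _).comp θ h1).mul ((hd _).comp θ h2)
  have h4 : deriv (cutoff δ) θ = _ := h3.deriv
  rw [h4]
  have hp : 0 < 2 / δ := by positivity
  have b1 := hB' (2 * θ / δ - 1)
  have b2 := hB' (2 * (1 - θ) / δ - 1)
  have key : ∀ a b s : ℝ, |a| ≤ B → 0 ≤ s → s ≤ 1 → |b| = 2 / δ → |a * b * s| ≤ B * (2 / δ) := by
    intro a b s ha hs hs' hb
    rw [abs_mul, abs_mul, hb, abs_of_nonneg hs]
    calc |a| * (2 / δ) * s ≤ B * (2 / δ) * 1 := by gcongr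
      _ = _ := mul_one _
  have e1 := key _ (2 / δ) (Real.smoothTransition (2 * (1 - θ) / δ - 1)) b1
    (Real.smoothTransition.nonneg _) (Real.smoothTransition.le_one _) (abs_of_pos hp)
  have e2 := key _ (-2 / δ) (Real.smoothTransition (2 * θ / δ - 1)) b2
    (Real.smoothTransition.nonneg _) (Real.smoothTransition.le_one _)
    (by rw [neg_div, abs_neg, abs_of_pos hp])
  refine (abs_add_le _ _).trans ?_
  simp only [Function.comp_apply]
  rw [mul_comm (Real.smoothTransition (2 * θ / δ - 1))]
  calc _ ≤ B * (2 / δ) + B * (2 / δ) := add_le_add e1 e2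
    _ = 4 * B / δ := by ring
    _ ≤ _ := by gcongr; linarith

theorem deriv_cutoff_eq_zero {δ θ : ℝ} (hδ : 0 < δ) (hθ : θ ∈ Ioo δ (1 - δ)) :
    deriv (cutoff δ) θ = 0 := by
  have : cutoff δ =ᶠ[𝓝 θ] fun _ => 1 := by
    filter_upwards [isOpen_Ioo.mem_nhds hθ] with y hy
    exact cutoff_eq_one hδ (Ioo_subset_Icc_self hy)
  rw [this.deriv_eq, deriv_const]

/-- The weight of `sin²` in the profile: `ε⁻²` in the middle, and `1` near the ends. -/
def weight (ε δ θ : ℝ) : ℝ := 1 + ((ε ^ 2)⁻¹ - 1) * cutoff (4 * δ) θ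

/-- `cos² + w sin²`, the square of the inverse of the radius of the profile curve. -/
def quad (ε δ θ : ℝ) : ℝ :=
  Real.cos (2 * Real.pi * θ) ^ 2 + weight ε δ θ * Real.sin (2 * Real.pi * θ) ^ 2

/-- The radius `ρ` of the profile curve `(f, g) = ρ (cos, sin)`. In the middle part the curve is the
ellipse `f² + g² / ε² = 1`, and near the ends it is the unit circle. -/
def prof (ε δ θ : ℝ) : ℝ := (√(quad ε δ θ))⁻¹

theorem contDiff_weight (ε δ : ℝ) : ContDiff ℝ ∞ (weight ε δ) :=
  contDiff_const.add (contDiff_const.mul (contDiff_cutoff _))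

theorem contDiff_quad (ε δ : ℝ) : ContDiff ℝ ∞ (quad ε δ) := by
  have := contDiff_weight ε δ
  unfold quad
  fun_prop

theorem one_le_weight {ε : ℝ} (hε : 0 < ε) (hε1 : ε ≤ 1) (δ θ : ℝ) : 1 ≤ weight ε δ θ := by
  have h1 : 1 ≤ (ε ^ 2)⁻¹ := (one_le_inv₀ (by positivity)).2 (by nlinarith)
  have := mul_nonneg (sub_nonneg.2 h1) (cutoff_nonneg (4 * δ) θ)
  rw [weight]; linarith

theorem one_le_quad {ε : ℝ} (hε : 0 < ε) (hε1 : ε ≤ 1) (δ θ : ℝ) : 1 ≤ quad ε δ θ := by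
  have h1 := one_le_weight hε hε1 δ θ
  have h2 := Real.cos_sq_add_sin_sq (2 * Real.pi * θ)
  rw [quad]
  nlinarith [sq_nonneg (Real.sin (2 * Real.pi * θ))]

theorem prof_pos {ε : ℝ} (hε : 0 < ε) (hε1 : ε ≤ 1) (δ θ : ℝ) : 0 < prof ε δ θ :=
  inv_pos.2 (Real.sqrt_pos.2 (one_pos.trans_le (one_le_quad hε hε1 δ θ)))

theorem contDiff_prof {ε : ℝ} (hε : 0 < ε) (hε1 : ε ≤ 1) (δ : ℝ) : ContDiff ℝ ∞ (prof ε δ) := by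
  have h : ∀ θ, quad ε δ θ ≠ 0 := fun θ => (one_pos.trans_le (one_le_quad hε hε1 δ θ)).ne'
  refine ((contDiff_quad ε δ).sqrt h).inv fun θ => ?_
  exact (Real.sqrt_pos.2 (one_pos.trans_le (one_le_quad hε hε1 δ θ))).ne'

theorem prof_eq_one {ε δ θ : ℝ} (hδ : 0 < δ) (hθ : θ ≤ 2 * δ ∨ 1 - 2 * δ ≤ θ) :
    prof ε δ θ = 1 := by
  have h1 : cutoff (4 * δ) θ = 0 := cutoff_eq_zero (by linarith) (by
    rcases hθ with h | h
    · left; linarith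
    · right; linarith)
  rw [prof, quad, weight, h1]
  simp

theorem weight_eq {ε δ θ : ℝ} (hδ : 0 < δ) (hθ : θ ∈ Icc (4 * δ) (1 - 4 * δ)) :
    weight ε δ θ = (ε ^ 2)⁻¹ := by
  rw [weight, cutoff_eq_one (by linarith) hθ]; ring

theorem deriv_weight (ε δ θ : ℝ) :
    deriv (weight ε δ) θ = ((ε ^ 2)⁻¹ - 1) * deriv (cutoff (4 * δ)) θ := by
  have h := ((contDiff_cutoff (4 * δ)).differentiable (by simp) θ).hasDerivAt
  exact ((h.const_mul ((ε ^ 2)⁻¹ - 1)).const_add 1).deriv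

/-- The `x`-component of the Reeb field of `f dx + g dy`, where `(f, g) = ρ (cos, sin)`. -/
def velX (ε δ θ : ℝ) : ℝ := (Real.cos (2 * Real.pi * θ) -
  deriv (weight ε δ) θ * Real.sin (2 * Real.pi * θ) ^ 3 / (4 * Real.pi)) * prof ε δ θ

/-- The `y`-component of the Reeb field of `f dx + g dy`, where `(f, g) = ρ (cos, sin)`. -/
def velY (ε δ θ : ℝ) : ℝ := (weight ε δ θ * Real.sin (2 * Real.pi * θ) +
  deriv (weight ε δ) θ * Real.sin (2 * Real.pi * θ) ^ 2 * Real.cos (2 * Real.pi * θ) /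
    (4 * Real.pi)) * prof ε δ θ

theorem hasDerivAt_quad (ε δ θ : ℝ) : HasDerivAt (quad ε δ)
    (4 * Real.pi * (weight ε δ θ - 1) * Real.sin (2 * Real.pi * θ) * Real.cos (2 * Real.pi * θ) +
      deriv (weight ε δ) θ * Real.sin (2 * Real.pi * θ) ^ 2) θ := by
  have h0 : HasDerivAt (fun θ : ℝ => 2 * Real.pi * θ) (2 * Real.pi) θ := by
    simpa using (hasDerivAt_id θ).const_mul (2 * Real.pi)
  have hw := ((contDiff_weight ε δ).differentiable (by simp) θ).hasDerivAt
  have h1 := (h0.cos.pow 2).add (hw.mul (h0.sin.pow 2))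
  refine h1.congr_deriv ?_
  simp
  ring

theorem hasDerivAt_prof {ε : ℝ} (hε : 0 < ε) (hε1 : ε ≤ 1) (δ θ : ℝ) :
    HasDerivAt (prof ε δ) (-(prof ε δ θ ^ 3 * (4 * Real.pi * (weight ε δ θ - 1) *
      Real.sin (2 * Real.pi * θ) * Real.cos (2 * Real.pi * θ) +
      deriv (weight ε δ) θ * Real.sin (2 * Real.pi * θ) ^ 2) / 2)) θ := by
  have hQ := one_pos.trans_le (one_le_quad hε hε1 δ θ)
  have h1 := ((hasDerivAt_quad ε δ θ).sqrt hQ.ne').inv (Real.sqrt_pos.2 hQ).ne'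
  refine h1.congr_deriv ?_
  have hs := (Real.sqrt_pos.2 hQ).ne'
  rw [prof]
  field_simp

/-- The Reeb field of `f dx + g dy` has no `θ`-component: the orbits are lines on the tori of
constant `θ`. -/
theorem torsVec_prof {ε : ℝ} (hε : 0 < ε) (hε1 : ε ≤ 1) (δ : ℝ) (q : T3) :
    torsVec (fun q => prof ε δ q.2.2) q = (velX ε δ q.2.2, velY ε δ q.2.2, 0) := by
  have hP := HasDerivAt.comp_hasFDerivAt (h₂ := prof ε δ) (f := fun q : T3 => q.2.2) q
    (hasDerivAt_prof hε hε1 δ q.2.2)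
      (((ContinuousLinearMap.snd ℝ ℝ ℝ).comp (ContinuousLinearMap.snd ℝ ℝ (ℝ × ℝ))).hasFDerivAt)
  have hQ := one_pos.trans_le (one_le_quad hε hε1 δ q.2.2)
  have hp := (prof_pos hε hε1 δ q.2.2).ne'
  have hcs := Real.cos_sq_add_sin_sq (2 * Real.pi * q.2.2)
  have hpq : prof ε δ q.2.2 ^ 2 * (Real.cos (2 * Real.pi * q.2.2) ^ 2 +
      weight ε δ q.2.2 * Real.sin (2 * Real.pi * q.2.2) ^ 2) = 1 := by
    rw [← quad, prof, inv_pow, Real.sq_sqrt hQ.le, inv_mul_cancel₀ hQ.ne']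
  rw [torsVec]
  rw [show (fun q : T3 => prof ε δ q.2.2) = prof ε δ ∘ fun q : T3 => q.2.2 from rfl]
  simp only [hP.fderiv, velX, velY, Function.comp_apply]
  set s := Real.sin (2 * Real.pi * q.2.2)
  set c := Real.cos (2 * Real.pi * q.2.2)
  set w := weight ε δ q.2.2
  set w' := deriv (weight ε δ) q.2.2
  set r := prof ε δ q.2.2
  have hpi := Real.pi_pos.ne'
  ext
  · simp
    field_simp
    linear_combination (-16 * Real.pi * c) * hpq + 16 * Real.pi * c * r ^ 2 * hcs
  · simp
    field_simp
    linear_combination (-16 * Real.pi * s) * hpq + 16 * Real.pi * s * r ^ 2 * w * hcs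
  · simp

/-- The weight varies only at distance `O(δ)` from the ends, where `sin³` is `O(δ³)`; as its
derivative is `O(1 / δ)` for fixed `ε`, the product of the two is small. -/
theorem exists_small_slope {ε : ℝ} (hε : 0 < ε) (hε1 : ε ≤ 1) : ∃ δ₀ > (0 : ℝ), ∀ δ ∈ Ioo 0 δ₀,
    ∀ θ ∈ Ioo (0 : ℝ) 1,
      |deriv (weight ε δ) θ * Real.sin (2 * Real.pi * θ) ^ 3 / (4 * Real.pi)| ≤ 1 / 2 ∧
      (deriv (weight ε δ) θ ≠ 0 → 1 / 2 < Real.cos (2 * Real.pi * θ)) := by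
  obtain ⟨C, hC, hCle⟩ := exists_deriv_cutoff_le
  have hpi := Real.pi_pos
  have hpi4 := Real.pi_lt_d2
  refine ⟨min (1 / 32) (ε ^ 2 / (64 * C * Real.pi ^ 2)), lt_min (by norm_num) (by positivity), ?_⟩
  intro δ hδ θ hθ
  have hδ0 : 0 < δ := hδ.1
  have hδ1 : δ < 1 / 32 := hδ.2.trans_le (min_le_left _ _)
  have hδ2 : δ < ε ^ 2 / (64 * C * Real.pi ^ 2) := hδ.2.trans_le (min_le_right _ _)
  by_cases h0 : deriv (weight ε δ) θ = 0
  · rw [h0]; norm_num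
  have hθ' : θ ≤ 4 * δ ∨ 1 - 4 * δ ≤ θ := by
    by_contra hcon
    push Not at hcon
    refine h0 ?_
    rw [deriv_weight, deriv_cutoff_eq_zero (by linarith) hcon, mul_zero]
  obtain ⟨x, hx0, hx1, hsin, hcos⟩ : ∃ x, 0 ≤ x ∧ x ≤ 4 * δ ∧
      |Real.sin (2 * Real.pi * θ)| = |Real.sin (2 * Real.pi * x)| ∧
      Real.cos (2 * Real.pi * θ) = Real.cos (2 * Real.pi * x) := by
    rcases hθ' with h | h
    · exact ⟨θ, hθ.1.le, h, rfl, rfl⟩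
    · refine ⟨1 - θ, by linarith [hθ.2], by linarith, ?_, ?_⟩
      · rw [show 2 * Real.pi * (1 - θ) = 2 * Real.pi - 2 * Real.pi * θ by ring,
          Real.sin_two_pi_sub, abs_neg]
      · rw [show 2 * Real.pi * (1 - θ) = 2 * Real.pi - 2 * Real.pi * θ by ring,
          Real.cos_two_pi_sub]
  have hs : |Real.sin (2 * Real.pi * θ)| ≤ 8 * Real.pi * δ := by
    rw [hsin]
    refine Real.abs_sin_le_abs.trans ?_
    rw [abs_of_nonneg (by positivity)]
    nlinarith
  have hw : |deriv (weight ε δ) θ| ≤ (ε ^ 2)⁻¹ * (C / (4 * δ)) := by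
    rw [deriv_weight, abs_mul]
    have h1 : 1 ≤ (ε ^ 2)⁻¹ := (one_le_inv₀ (by positivity)).2 (by nlinarith)
    have h2 : |(ε ^ 2)⁻¹ - 1| ≤ (ε ^ 2)⁻¹ := by
      rw [abs_of_nonneg (by linarith)]; linarith
    exact mul_le_mul h2 (hCle _ (by linarith) _) (abs_nonneg _) (by positivity)
  refine ⟨?_, fun _ => ?_⟩
  · rw [abs_div, abs_mul, abs_pow, abs_of_pos (by positivity : 0 < 4 * Real.pi),
      div_le_iff₀ (by positivity)]
    calc |deriv (weight ε δ) θ| * |Real.sin (2 * Real.pi * θ)| ^ 3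
        ≤ (ε ^ 2)⁻¹ * (C / (4 * δ)) * (8 * Real.pi * δ) ^ 3 := by gcongr
      _ = 128 * Real.pi ^ 3 * C * (ε ^ 2)⁻¹ * δ * δ := by field_simp; ring
      _ ≤ 128 * Real.pi ^ 3 * C * (ε ^ 2)⁻¹ * (ε ^ 2 / (64 * C * Real.pi ^ 2)) * 1 := by
          gcongr; linarith
      _ = 1 / 2 * (4 * Real.pi) := by field_simp; norm_num
  · rw [hcos]
    have h1 := Real.one_sub_sq_div_two_le_cos (x := 2 * Real.pi * x)
    have h2 : 2 * Real.pi * x ≤ 2 * 3.15 * (1 / 8) := by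
      have : x ≤ 1 / 8 := by linarith
      gcongr
    have h3 : 0 ≤ 2 * Real.pi * x := by positivity
    nlinarith

theorem cos_eq_zero_iff_of_mem {θ : ℝ} (hθ : θ ∈ Ioo (0 : ℝ) 1) :
    Real.cos (2 * Real.pi * θ) = 0 ↔ θ = 1 / 4 ∨ θ = 3 / 4 := by
  have hpi := Real.pi_pos
  constructor
  · intro h
    obtain ⟨k, hk⟩ := Real.cos_eq_zero_iff.1 h
    have h1 : θ = (2 * k + 1) / 4 := by
      field_simp at hk
      linarith
    have h2 := hθ.1
    have h3 := hθ.2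
    rw [h1] at h2 h3
    have h4 : (-1 : ℝ) < 2 * k := by linarith
    have h5 : (2 : ℝ) * k < 3 := by linarith
    have h6 : (-1 : ℤ) < 2 * k := by exact_mod_cast h4
    have h7 : 2 * k < (3 : ℤ) := by exact_mod_cast h5
    have h8 : k = 0 ∨ k = 1 := by omega
    rcases h8 with rfl | rfl
    · left; rw [h1]; norm_num
    · right; rw [h1]; norm_num
  · rintro (rfl | rfl)
    · rw [show 2 * Real.pi * (1 / 4) = Real.pi / 2 by ring, Real.cos_pi_div_two]
    · rw [show 2 * Real.pi * (3 / 4) = Real.pi / 2 + Real.pi by ring, Real.cos_add_pi,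
        Real.cos_pi_div_two, neg_zero]

theorem prof_le_one {ε : ℝ} (hε : 0 < ε) (hε1 : ε ≤ 1) (δ θ : ℝ) : prof ε δ θ ≤ 1 :=
  inv_le_one_of_one_le₀ (Real.one_le_sqrt.2 (one_le_quad hε hε1 δ θ))

/-- For a small transition region, the `x`-component of the Reeb field is bounded by `3 / 2`, and it
vanishes only on the tori `θ = 1 / 4` and `θ = 3 / 4`, where the profile curve meets the minor axis of
the ellipse. -/
theorem velX_bound {ε δ θ : ℝ} (hε : 0 < ε) (hε1 : ε ≤ 1) (hθ : θ ∈ Ioo (0 : ℝ) 1)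
    (h : |deriv (weight ε δ) θ * Real.sin (2 * Real.pi * θ) ^ 3 / (4 * Real.pi)| ≤ 1 / 2 ∧
      (deriv (weight ε δ) θ ≠ 0 → 1 / 2 < Real.cos (2 * Real.pi * θ))) :
    |velX ε δ θ| ≤ 3 / 2 ∧ (velX ε δ θ = 0 → θ = 1 / 4 ∨ θ = 3 / 4) := by
  constructor
  · rw [velX, abs_mul, abs_of_pos (prof_pos hε hε1 δ θ)]
    have h1 := abs_sub (Real.cos (2 * Real.pi * θ))
      (deriv (weight ε δ) θ * Real.sin (2 * Real.pi * θ) ^ 3 / (4 * Real.pi))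
    have h2 := Real.abs_cos_le_one (2 * Real.pi * θ)
    have h3 := mul_le_mul (h1.trans (add_le_add h2 h.1)) (prof_le_one hε hε1 δ θ)
      (prof_pos hε hε1 δ θ).le (by norm_num)
    linarith
  · intro h0
    rw [velX, mul_eq_zero, or_iff_left (prof_pos hε hε1 δ θ).ne'] at h0
    by_cases hw : deriv (weight ε δ) θ = 0
    · rw [hw] at h0
      simp only [zero_mul, zero_div, sub_zero] at h0
      exact (cos_eq_zero_iff_of_mem hθ).1 h0
    · have h1 := h.2 hw
      have h2 := (abs_le.1 h.1).2
      linarith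

end Profile

/-! ### Estimates near the boundary of the thickened torus -/

section BoundaryEstimates

/-- The interpolation between the factor `κ` at the ends and `1` in the middle of the thickened
torus. -/
def interp (δ : ℝ) (κ : T3 → ℝ) (q : T3) : ℝ := 1 + (1 - cutoff δ q.2.2) * (κ q - 1)

/-- If the factor `P` is close to `1`, then near `θ = 0` or `1` the Reeb vector of `P α` has
`x`-component at least `1 / 2`, as soon as `sin (2πθ)` times the derivative of `P` is small. -/
theorem torsVec_bound {P : T3 → ℝ} {q : T3} {K : ℝ} (h1 : |P q - 1| ≤ 1 / 4)
    (hK : ‖fderiv ℝ P q‖ ≤ K) (hc : 9 / 10 ≤ Real.cos (2 * Real.pi * q.2.2))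
    (hs : |Real.sin (2 * Real.pi * q.2.2)| * K ≤ 1 / 10) :
    ‖torsVec P q‖ ≤ 2 + K ∧ 1 / 2 ≤ (torsVec P q).1 := by
  have hP := abs_le.1 h1
  have hP0 : 3 / 4 ≤ P q := by linarith
  have hP1 : P q ≤ 5 / 4 := by linarith
  have hpi := Real.pi_gt_three
  have hK0 : 0 ≤ K := (norm_nonneg _).trans hK
  have hd : ∀ v : T3, ‖v‖ ≤ 1 → |fderiv ℝ P q v / (2 * Real.pi * P q ^ 2)| ≤ K := by
    intro v hv
    have h2 : |fderiv ℝ P q v| ≤ K := by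
      refine ((fderiv ℝ P q).le_opNorm v).trans ?_
      calc _ ≤ K * 1 := by gcongr
        _ = K := mul_one K
    have h3 : 1 ≤ 2 * Real.pi * P q ^ 2 := by nlinarith
    rw [abs_div, abs_of_pos (by linarith : 0 < 2 * Real.pi * P q ^ 2)]
    exact (div_le_self (abs_nonneg _) h3).trans h2
  have hc1 := Real.abs_cos_le_one (2 * Real.pi * q.2.2)
  have hs1 := Real.abs_sin_le_one (2 * Real.pi * q.2.2)
  have hv1 : ‖((0 : ℝ), (0 : ℝ), (1 : ℝ))‖ ≤ 1 := by simp [Prod.norm_def]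
  have hv2 : ‖(-Real.sin (2 * Real.pi * q.2.2), Real.cos (2 * Real.pi * q.2.2), (0 : ℝ))‖ ≤ 1 := by
    simp [Prod.norm_def, hs1, hc1]
  have b1 := hd _ hv1
  have b2 := hd _ hv2
  rw [torsVec]
  simp only
  set s := Real.sin (2 * Real.pi * q.2.2)
  set c := Real.cos (2 * Real.pi * q.2.2)
  rw [neg_div]
  set b := fderiv ℝ P q (0, 0, 1) / (2 * Real.pi * P q ^ 2)
  have hsb : |s * b| ≤ 1 / 10 := by
    rw [abs_mul]
    exact (mul_le_mul_of_nonneg_left b1 (abs_nonneg _)).trans hs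
  have hsb' := abs_le.1 hsb
  have hcb : |c * b| ≤ K := by
    rw [abs_mul]
    calc |c| * |b| ≤ 1 * K := by gcongr
      _ = K := one_mul K
  have hcP : |c / P q| ≤ 4 / 3 := by
    rw [abs_div, abs_of_pos (by linarith : 0 < P q), div_le_iff₀ (by linarith)]
    linarith
  have hsP : |s / P q| ≤ 4 / 3 := by
    rw [abs_div, abs_of_pos (by linarith : 0 < P q), div_le_iff₀ (by linarith)]
    linarith
  have hcP' : 7 / 10 ≤ c / P q := by
    rw [le_div_iff₀ (by linarith)]
    linarith
  refine ⟨?_, by nlinarith⟩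
  rw [Prod.norm_def, Prod.norm_def]
  simp only [Real.norm_eq_abs]
  refine max_le ?_ (max_le ?_ ?_)
  · rw [mul_neg, sub_neg_eq_add]
    exact (abs_add_le _ _).trans (by linarith)
  · rw [mul_neg]
    refine (abs_add_le _ _).trans ?_
    rw [abs_neg]
    linarith
  · linarith

/-- Near the boundary of the thickened torus, the Reeb vectors of the interpolated forms are bounded
and lie in a half space, uniformly in the size `δ` of the transition region: although the
derivative of the cutoff function is of order `1 / δ`, it is multiplied by `κ - 1 = O(δ)`. -/
theorem exists_torsVec_interp_bound {κ : T3 → ℝ} (hκ : ContDiffOn ℝ ∞ κ slab)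
    (h1 : ∀ q ∈ slab, (q.2.2 = 0 ∨ q.2.2 = 1) → κ q = 1) {q₀ : T3}
    (hθ : q₀.2.2 = 0 ∨ q₀.2.2 = 1) :
    ∃ W ∈ 𝓝 q₀, ∃ K > (0 : ℝ), ∀ q ∈ W ∩ slabInt, ∀ P : T3 → ℝ,
      (P =ᶠ[𝓝 q] κ ∨ ∃ δ ∈ Ioo (0 : ℝ) (1 / 4), P =ᶠ[𝓝 q] interp δ κ) →
      ‖torsVec P q‖ ≤ K ∧ 1 / 2 ≤ (torsVec P q).1 := by
  obtain ⟨C, hC, hCle⟩ := exists_deriv_cutoff_le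
  have hq₀ : q₀ ∈ slab := by
    rcases hθ with h | h <;> simp [slab, h]
  have hcont : ContinuousWithinAt (fderivWithin ℝ κ slab) slab q₀ :=
    ((hκ.fderivWithin uniqueDiffOn_slab (m := 0) (by simp)).continuousOn) q₀ hq₀
  set K1 := ‖fderivWithin ℝ κ slab q₀‖ + 1 with hK1
  have hK1pos : 0 < K1 := by positivity
  have e1 : ∀ᶠ q in 𝓝[slab] q₀, ‖fderivWithin ℝ κ slab q‖ ≤ K1 := by
    filter_upwards [hcont.norm.eventually (Iio_mem_nhds (lt_add_one _))] with q hq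
    exact le_of_lt hq
  have hsin0 : Real.sin (2 * Real.pi * q₀.2.2) = 0 := by
    rcases hθ with h | h <;> simp [h]
  have hcos0 : Real.cos (2 * Real.pi * q₀.2.2) = 1 := by
    rcases hθ with h | h <;> simp [h]
  have e2 : ∀ᶠ q : T3 in 𝓝 q₀, 9 / 10 < Real.cos (2 * Real.pi * q.2.2) := by
    have hc : Continuous fun q : T3 => Real.cos (2 * Real.pi * q.2.2) := by fun_prop
    exact hc.continuousAt.eventually (Ioi_mem_nhds (by simp only [hcos0]; norm_num))
  have e3 : ∀ᶠ q : T3 in 𝓝 q₀, |Real.sin (2 * Real.pi * q.2.2)| * (K1 * (1 + C)) < 1 / 10 := by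
    have hc : Continuous fun q : T3 => |Real.sin (2 * Real.pi * q.2.2)| * (K1 * (1 + C)) := by
      fun_prop
    exact hc.continuousAt.eventually (Iio_mem_nhds (by simp only [hsin0]; norm_num))
  obtain ⟨r, hr, hball⟩ := Metric.eventually_nhds_iff_ball.1
    ((eventually_nhdsWithin_iff.1 e1).and (e2.and e3))
  set r' := min r (min (1 / 4) (1 / (4 * K1))) with hr'
  have hr'0 : 0 < r' := by positivity
  have hr'1 : r' ≤ r := min_le_left _ _
  have hr'2 : r' ≤ 1 / 4 := (min_le_right _ _).trans (min_le_left _ _)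
  have hr'3 : r' ≤ 1 / (4 * K1) := (min_le_right _ _).trans (min_le_right _ _)
  refine ⟨Metric.ball q₀ r', Metric.ball_mem_nhds _ hr'0, 2 + K1 * (1 + C), by positivity, ?_⟩
  rintro q ⟨hqb, hqi⟩ P hP
  have hqs := slabInt_subset_slab hqi
  have hqb' := Metric.ball_subset_ball hr'1 hqb
  obtain ⟨b1, b2, b3⟩ := hball q hqb'
  -- the factor is close to 1, by the mean value inequality along the segment to the boundary
  have hθd : |q.2.2 - q₀.2.2| < r' := by
    have h2 : ‖q - q₀‖ < r' := by rwa [← dist_eq_norm]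
    exact ((norm_snd_le (q - q₀).2).trans (norm_snd_le (q - q₀))).trans_lt h2
  have hκ1 : |κ q - 1| ≤ K1 * |q.2.2 - q₀.2.2| := by
    set q' : T3 := (q.1, q.2.1, q₀.2.2) with hq'
    have hq's : q' ∈ slab := hq₀
    have hq'b : q' ∈ Metric.ball q₀ r' := by
      rw [Metric.mem_ball, Prod.dist_eq, Prod.dist_eq] at hqb ⊢
      simp only [max_lt_iff, hq', dist_self] at hqb ⊢
      exact ⟨hqb.1, hqb.2.1, hr'0⟩
    have hmv := Convex.norm_image_sub_le_of_norm_hasFDerivWithin_le (𝕜 := ℝ) (f := κ)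
      (s := Metric.ball q₀ r' ∩ slab) (f' := fderivWithin ℝ κ slab) (C := K1) (x := q') (y := q)
      (fun x hx => (((hκ.differentiableOn (by simp)) x hx.2).hasFDerivWithinAt).mono
        inter_subset_right)
      (fun x hx => (hball x (Metric.ball_subset_ball hr'1 hx.1)).1 hx.2)
      ((convex_ball _ _).inter convex_slab) ⟨hq'b, hq's⟩ ⟨hqb, hqs⟩
    rw [h1 q' hq's hθ, Real.norm_eq_abs] at hmv
    refine hmv.trans (le_of_eq ?_)
    congr 1
    simp [Prod.norm_def, hq']
  have hκ2 : |κ q - 1| ≤ 1 / 4 := by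
    refine hκ1.trans ?_
    calc K1 * |q.2.2 - q₀.2.2| ≤ K1 * (1 / (4 * K1)) := by
          gcongr; exact hθd.le.trans hr'3
      _ = 1 / 4 := by field_simp
  have hκd : DifferentiableAt ℝ κ q :=
    (hκ.contDiffAt (slab_mem_nhds hqi)).differentiableAt (by simp)
  have hκK : ‖fderiv ℝ κ q‖ ≤ K1 := by
    rw [← fderivWithin_of_mem_nhds (slab_mem_nhds hqi)]; exact b1 hqs
  rcases hP with hP | ⟨δ, hδ, hP⟩
  · refine torsVec_bound ?_ ?_ b2.le b3.le
    · rw [hP.eq_of_nhds]; exact hκ2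
    · rw [hP.fderiv_eq]
      nlinarith
  · refine torsVec_bound ?_ ?_ b2.le b3.le
    · rw [hP.eq_of_nhds, interp, add_sub_cancel_left, abs_mul]
      have h2 : |1 - cutoff δ q.2.2| ≤ 1 := by
        rw [abs_le]
        constructor <;> linarith [cutoff_nonneg δ q.2.2, cutoff_le_one δ q.2.2]
      calc _ ≤ 1 * (1 / 4 : ℝ) := by gcongr
        _ = _ := one_mul _
    · rw [hP.fderiv_eq]
      have hχ : HasFDerivAt (fun q : T3 => 1 - cutoff δ q.2.2)
          (-(deriv (cutoff δ) q.2.2 • (ContinuousLinearMap.snd ℝ ℝ ℝ).comp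
            (ContinuousLinearMap.snd ℝ ℝ (ℝ × ℝ)))) q :=
        (HasDerivAt.comp_hasFDerivAt (h₂ := cutoff δ) (f := fun q : T3 => q.2.2) q
          ((contDiff_cutoff δ).differentiable (by simp) _).hasDerivAt
          ((ContinuousLinearMap.snd ℝ ℝ ℝ).comp
            (ContinuousLinearMap.snd ℝ ℝ (ℝ × ℝ))).hasFDerivAt).const_sub 1
      have hI : HasFDerivAt (interp δ κ) _ q := (hχ.mul (hκd.hasFDerivAt.sub_const 1)).const_add 1
      rw [hI.fderiv]
      have h2 : |1 - cutoff δ q.2.2| ≤ 1 := by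
        rw [abs_le]
        constructor <;> linarith [cutoff_nonneg δ q.2.2, cutoff_le_one δ q.2.2]
      have h3 : |κ q - 1| * |deriv (cutoff δ) q.2.2| ≤ K1 * C := by
        by_cases h0 : deriv (cutoff δ) q.2.2 = 0
        · rw [h0, abs_zero, mul_zero]; positivity
        have h4 : q.2.2 ≤ δ ∨ 1 - δ ≤ q.2.2 := by
          by_contra hcon
          push Not at hcon
          exact h0 (deriv_cutoff_eq_zero hδ.1 hcon)
        have h5 : |q.2.2 - q₀.2.2| ≤ δ := by
          have h6 := abs_lt.1 (hθd.trans_le hr'2)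
          have h7 := hqi.1
          have h8 := hqi.2
          have h9 := hδ.2
          rcases hθ with h | h <;> rw [h] at h6 ⊢ <;> rw [abs_le] <;> rcases h4 with h4 | h4 <;>
            constructor <;> linarith
        calc _ ≤ (K1 * δ) * (C / δ) := by
              have := hδ.1
              exact mul_le_mul (hκ1.trans (by gcongr)) (hCle δ hδ.1 _) (abs_nonneg _)
                (by positivity)
          _ = K1 * C := by have := hδ.1.ne'; field_simp
      have h4 : ‖(ContinuousLinearMap.snd ℝ ℝ ℝ).comp (ContinuousLinearMap.snd ℝ ℝ (ℝ × ℝ))‖ ≤ 1 := by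
        refine ContinuousLinearMap.opNorm_le_bound _ zero_le_one fun v => ?_
        rw [one_mul]
        exact (norm_snd_le v.2).trans (norm_snd_le v)
      refine (norm_add_le _ _).trans ?_
      rw [norm_smul, norm_smul, norm_neg, norm_smul, Real.norm_eq_abs, Real.norm_eq_abs,
        Real.norm_eq_abs, ← mul_assoc]
      calc _ ≤ 1 * K1 + K1 * C * 1 := by gcongr
        _ = _ := by ring

end BoundaryEstimates

/-! ### Periods of the orbits outside of the torsion domain -/

section PeriodEstimate

variable {M : Type*} [TopologicalSpace M] [ChartedSpace E3 M] [IsManifold (𝓡 3) ∞ M]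
variable {ξ : ∀ p : M, Submodule ℝ (TangentSpace (𝓡 3) p)} {F : T3 → M}
variable {lam : ∀ p : M, TangentSpace (𝓡 3) p →L[ℝ] ℝ}

theorem continuousAt_chD_reeb (hlam : IsContactForm lam) (p : M) :
    ContinuousAt (fun r => chD p r (reeb lam r)) p := by
  have h1 : ContinuousAt (fun r => reebVec (formInChart lam p) (extChartAt (𝓡 3) p r)) p := by
    have h2 : ContinuousAt (reebVec (formInChart lam p)) (extChartAt (𝓡 3) p p) :=
      ((contDiffOn_reebVec hlam p).continuousOn).continuousAt
        ((isOpen_chart_target p).mem_nhds (mem_extChartAt_target p))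
    exact h2.comp (continuousAt_extChartAt p)
  refine h1.congr ?_
  filter_upwards [extChartAt_source_mem_nhds (I := 𝓡 3) p] with r hr
  have h3 := chD_reeb hlam p ((extChartAt (𝓡 3) p).map_source hr)
  rw [(extChartAt (𝓡 3) p).left_inv hr] at h3
  exact h3.symm

theorem reeb_ne_zero (hlam : IsContactForm lam) (p : M) : (reeb lam p : E3) ≠ 0 := by
  intro h
  have h1 : rawF lam p (reeb lam p) = 1 := (isReebAt_reeb hlam p).2
  have h2 : rawF lam p (reeb lam p) = rawF lam p (0 : E3) := congrArg (rawF lam p) h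
  exact zero_ne_one ((map_zero (rawF lam p)).symm.trans (h2.symm.trans h1))

theorem eventually_reeb_bounds (hlam : IsContactForm lam) (p : M) {l : E3 →L[ℝ] ℝ} {a : ℝ}
    (ha : a < l (chD p p (reeb lam p))) :
    ∃ K > (0 : ℝ), ∀ᶠ r in 𝓝 p, a < l (chD p r (reeb lam r)) ∧ ‖chD p r (reeb lam r)‖ ≤ K := by
  have h1 := continuousAt_chD_reeb hlam p
  refine ⟨‖chD p p (reeb lam p)‖ + 1, by positivity, ?_⟩
  have h2 : ContinuousAt (fun r => l (chD p r (reeb lam r))) p := l.continuous.continuousAt.comp h1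
  filter_upwards [h2.eventually (Ioi_mem_nhds ha),
    h1.norm.eventually (Iio_mem_nhds (lt_add_one _))] with r h3 h4
  exact ⟨h3, le_of_lt h4⟩

theorem reeb_scale_of_eventually_one (hlam : IsContactFormFor ξ lam) {h : M → ℝ}
    (hh : ContMDiff (𝓡 3) 𝓘(ℝ, ℝ) ∞ h) (h0 : ∀ p, h p ≠ 0) {r : M} (h1 : ∀ᶠ r' in 𝓝 r, h r' = 1) :
    (reeb (scale h lam) r : E3) = reeb lam r := by
  have key : ∀ X : E3, IsReebAt lam r X → IsReebAt (scale h lam) r X := by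
    intro X hX
    refine ⟨fun v => ?_, by rw [rawF_scale, h1.self_of_nhds, one_smul, hX.2]⟩
    have h2 : rawG h r = 0 := by
      have : h =ᶠ[𝓝 r] fun _ => 1 := h1
      have := this.mfderiv_eq (I := 𝓡 3) (I' := 𝓘(ℝ, ℝ))
      rw [mfderiv_const] at this
      exact this
    rw [rawE_scale hh hlam.1.smooth, h2, hX.1 v]
    simp
  exact reeb_eq (isContactFormFor_scale hlam hh h0).1 (key _ (isReebAt_reeb hlam.1 r))

/-- The vector `V` is the value at `r` of the Reeb field of a form `h lam` that interpolates, on a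
transition region of size `δ`, between `lam` outside of the thickened torus and a form that
depends only on `θ`. -/
def IsTransitionReeb (lam : ∀ p : M, TangentSpace (𝓡 3) p →L[ℝ] ℝ) (F : T3 → M) (δ : ℝ) (r : M)
    (V : E3) : Prop :=
  ∃ h : M → ℝ, ContMDiff (𝓡 3) 𝓘(ℝ, ℝ) ∞ h ∧ (∀ r, h r ≠ 0) ∧
    (∀ r, r ∉ F '' {q | q.2.2 ∈ Icc (δ / 2) (1 - δ / 2)} → h r = 1) ∧
    (∀ q ∈ slab, q.2.2 ∉ Icc (2 * δ) (1 - 2 * δ) →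
      h (F q) * kappa lam F q = interp δ (kappa lam F) q) ∧
    V = reeb (scale h lam) r

namespace IsTorsionMap

variable (hF : IsTorsionMap ξ F)
include hF

variable [T2Space M]

theorem isTransitionReeb_outside (hlam : IsContactFormFor ξ lam) {δ : ℝ} (hδ : 0 < δ) {r : M}
    {V : E3} (hV : IsTransitionReeb lam F δ r V)
    (hr : r ∉ F '' {q | q.2.2 ∈ Icc (δ / 2) (1 - δ / 2)}) : V = reeb lam r := by
  obtain ⟨h, hh, h0, h1, -, rfl⟩ := hV
  refine reeb_scale_of_eventually_one hlam hh h0 ?_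
  have hcl : IsClosed (F '' {q | q.2.2 ∈ Icc (δ / 2) (1 - δ / 2)}) :=
    (hF.isCompact_image isCompact_Icc fun t ht => ⟨by linarith [ht.1], by linarith [ht.2]⟩).isClosed
  filter_upwards [hcl.isOpen_compl.mem_nhds hr] with r' hr'
  exact h1 r' hr'

/-- Away from the thickened torus the transition fields are the Reeb field of `lam`, which is
bounded and lies in a half space near each point. -/
theorem exists_local_bounds_outside (hlam : IsContactFormFor ξ lam) {p : M} (hp : p ∉ F '' slab) :
    ∃ U ∈ 𝓝 p, ∃ l : E3 →L[ℝ] ℝ, ∃ K > (0 : ℝ), ∃ δ₀ > (0 : ℝ), ∀ δ ∈ Ioo 0 δ₀, ∀ r ∈ U,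
      ∀ V, IsTransitionReeb lam F δ r V → 0 < l (chD p r V) ∧ ‖chD p r V‖ ≤ K := by
  have hcl : IsClosed (F '' slab) := (hF.isCompact_image isCompact_Icc subset_rfl).isClosed
  set X : E3 := chD p p (reeb lam p) with hX
  have hX0 : X ≠ 0 := by
    intro h
    apply reeb_ne_zero hlam.1 p
    have h1 := rawD_symm_comp_chD p (mem_extChartAt_source (I := 𝓡 3) p) (reeb lam p)
    change rawD _ _ X = _ at h1
    rw [h, map_zero] at h1
    exact h1.symm
  have hpos : 0 < innerSL ℝ X X := by
    rw [innerSL_apply_apply]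
    exact real_inner_self_pos.2 hX0
  obtain ⟨K, hK, hev⟩ := eventually_reeb_bounds hlam.1 p hpos
  refine ⟨_, inter_mem (hcl.isOpen_compl.mem_nhds hp) hev, innerSL ℝ X, K, hK, 1, one_pos, ?_⟩
  rintro δ hδ r ⟨hr1, hr2⟩ V hV
  have : V = reeb lam r := by
    refine hF.isTransitionReeb_outside hlam hδ.1 hV fun hmem => hr1 ?_
    obtain ⟨q, hq, h⟩ := hmem
    exact ⟨q, ⟨by linarith [hq.1, hδ.1], by linarith [hq.2, hδ.1]⟩, h⟩
  rw [this]
  exact hr2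

/-- At the boundary of the thickened torus, where the factor of the form is `1`, the transition
fields are bounded and lie in a half space, independently of `δ`. -/
theorem exists_local_bounds_boundary (hlam : IsContactFormFor ξ lam)
    (h1 : ∀ q ∈ slab, (q.2.2 = 0 ∨ q.2.2 = 1) → kappa lam F q = 1) {q₀ : T3}
    (hθ : q₀.2.2 = 0 ∨ q₀.2.2 = 1) :
    ∃ U ∈ 𝓝 (F q₀), ∃ l : E3 →L[ℝ] ℝ, ∃ K > (0 : ℝ), ∃ δ₀ > (0 : ℝ), ∀ δ ∈ Ioo 0 δ₀,
      ∀ r ∈ U ∩ (F '' {q | q.2.2 ∈ Ioo δ (1 - δ)})ᶜ,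
      ∀ V, IsTransitionReeb lam F δ r V → 0 < l (chD (F q₀) r V) ∧ ‖chD (F q₀) r V‖ ≤ K := by
  have hq₀ : q₀ ∈ slab := by
    rcases hθ with h | h <;> simp [slab, h]
  obtain ⟨W, hW, K, hK, hWK⟩ := exists_torsVec_interp_bound
    (hF.contDiffOn_kappa hlam.1.smooth) h1 hθ
  set p := F q₀ with hp
  have hs : F q₀ ∈ (extChartAt (𝓡 3) p).source := mem_extChartAt_source p
  set D : T3 → T3 →L[ℝ] E3 := fderivWithin ℝ (extChartAt (𝓡 3) p ∘ F) slab with hD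
  have hDc : ContinuousWithinAt D slab q₀ :=
    (hF.contDiffWithinAt_fderivWithin hq₀ hs).continuousWithinAt
  -- the first coordinate of the inverse of the differential at the base point
  obtain ⟨l, hl⟩ : ∃ l : E3 →L[ℝ] ℝ, ∀ v, l (D q₀ v) = v.1 := by
    have hinj : Function.Injective (D q₀) := by
      intro v w hvw
      rw [hD, ← hF.chD_comp_rawW hq₀ hs, ← hF.chD_comp_rawW hq₀ hs] at hvw
      apply hF.rawW_injective hq₀
      rw [← rawD_symm_comp_chD p hs (rawW F q₀ v), hvw, rawD_symm_comp_chD p hs]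
    obtain ⟨g, hg⟩ := (D q₀ : T3 →ₗ[ℝ] E3).exists_leftInverse_of_injective
      (LinearMap.ker_eq_bot.2 hinj)
    refine ⟨((LinearMap.fst ℝ ℝ (ℝ × ℝ)).comp g).toContinuousLinearMap, fun v => ?_⟩
    have := congrArg (fun L : T3 →ₗ[ℝ] T3 => (L v).1) hg
    exact this
  set ν := 1 / (4 * (‖l‖ + 1) * K) with hν
  have hν0 : 0 < ν := by positivity
  have hev : ∀ᶠ q in 𝓝[slab] q₀, ‖D q - D q₀‖ < ν ∧ ‖D q‖ < ‖D q₀‖ + 1 ∧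
      F q ∈ (extChartAt (𝓡 3) p).source := by
    have h2 : ContinuousWithinAt (fun q => ‖D q - D q₀‖) slab q₀ :=
      (hDc.sub continuousWithinAt_const).norm
    exact (h2.eventually (Iio_mem_nhds (by simpa using hν0))).and
      ((hDc.norm.eventually (Iio_mem_nhds (lt_add_one _))).and (hF.eventually_mem_source hq₀ hs))
  -- the basic estimate in the interior of the thickened torus
  have est : ∀ q ∈ slabInt, ‖D q - D q₀‖ < ν → ‖D q‖ < ‖D q₀‖ + 1 →
      F q ∈ (extChartAt (𝓡 3) p).source → ∀ v : T3, ‖v‖ ≤ K → 1 / 2 ≤ v.1 →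
      1 / 4 ≤ l (chD p (F q) (rawD F q v)) ∧ ‖chD p (F q) (rawD F q v)‖ ≤ (‖D q₀‖ + 1) * K := by
    intro q hq e1 e2 e3 v hv1 hv2
    have hqs := slabInt_subset_slab hq
    rw [← rawW_eq_rawD hq, hF.chD_comp_rawW hqs e3]
    constructor
    · have h2 : l (D q v) = v.1 + l ((D q - D q₀) v) := by
        rw [sub_apply, map_sub, hl]; ring
      have h3 : ‖l ((D q - D q₀) v)‖ ≤ 1 / 4 := by
        calc ‖l ((D q - D q₀) v)‖ ≤ ‖l‖ * (‖D q - D q₀‖ * ‖v‖) :=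
              (l.le_opNorm _).trans (by gcongr; exact ContinuousLinearMap.le_opNorm _ _)
          _ ≤ (‖l‖ + 1) * (ν * K) := by gcongr; linarith
          _ = 1 / 4 := by rw [hν]; field_simp
      have h4 := (abs_le.1 h3).1
      change 1 / 4 ≤ l (D q v)
      rw [h2]; linarith
    · calc _ ≤ ‖D q‖ * ‖v‖ := ContinuousLinearMap.le_opNorm _ _
        _ ≤ _ := by gcongr
  -- the Reeb field of `lam` at the base point
  have hbase : 1 / 4 ≤ l (chD p p (reeb lam p)) := by
    have hne : (𝓝[slabInt] q₀).NeBot :=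
      mem_closure_iff_nhdsWithin_neBot.1 (slab_subset_closure hq₀)
    have hFc : Tendsto F (𝓝[slabInt] q₀) (𝓝 p) :=
      (hF.smooth.continuousOn q₀ hq₀).mono_left (nhdsWithin_mono _ slabInt_subset_slab)
    have hlim : Tendsto (fun q => l (chD p (F q) (reeb lam (F q)))) (𝓝[slabInt] q₀)
        (𝓝 (l (chD p p (reeb lam p)))) :=
      ((l.continuous.tendsto _).comp (continuousAt_chD_reeb hlam.1 p).tendsto).comp hFc
    refine ge_of_tendsto hlim ?_
    filter_upwards [hev.filter_mono (nhdsWithin_mono _ slabInt_subset_slab), self_mem_nhdsWithin,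
      nhdsWithin_le_nhds hW] with q e1 hq e2
    rw [show (reeb lam (F q) : E3) = rawD F q (torsVec (kappa lam F) q) from
      hF.reeb_eq_torsVec hlam hq]
    have h3 := hWK q ⟨e2, hq⟩ _ (Or.inl (EventuallyEq.refl _ _))
    exact (est q hq e1.1 e1.2.1 e1.2.2 _ h3.1 h3.2).1
  obtain ⟨K', hK', hev'⟩ := eventually_reeb_bounds hlam.1 p (l := l) (a := 1 / 8)
    (by linarith)
  rw [eventually_nhdsWithin_iff] at hev
  obtain ⟨U, hU, hUW⟩ := hF.exists_nhds_deck hq₀ (inter_mem hW hev)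
  refine ⟨_, inter_mem hU hev', l, max K' ((‖D q₀‖ + 1) * K), lt_max_of_lt_left hK', 1 / 4,
    by norm_num, ?_⟩
  rintro δ hδ r ⟨⟨hr1, hr2⟩, hr3⟩ V hV
  have hδ0 := hδ.1
  by_cases hr : r ∈ F '' {q | q.2.2 ∈ Icc (δ / 2) (1 - δ / 2)}
  · obtain ⟨q, hq, rfl⟩ := hr
    have hqi : q ∈ slabInt := ⟨by linarith [hq.1], by linarith [hq.2]⟩
    obtain ⟨m, n, hmn⟩ := hUW q (slabInt_subset_slab hqi) hr1
    rw [← hF.deck_eq m n (slabInt_subset_slab hqi)] at hV hr3 ⊢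
    set q' := deck m n q with hq'
    have hqi' : q' ∈ slabInt := hqi
    obtain ⟨h, hh, h0, -, h3, rfl⟩ := hV
    have e0 := hmn.2 (slabInt_subset_slab hqi')
    have hnot : q'.2.2 ∉ Icc (2 * δ) (1 - 2 * δ) := fun hc =>
      hr3 ⟨q', ⟨by linarith [hc.1], by linarith [hc.2]⟩, rfl⟩
    have hPe : kappa (scale h lam) F =ᶠ[𝓝 q'] interp δ (kappa lam F) := by
      have ho : {q : T3 | q.2.2 ∉ Icc (2 * δ) (1 - 2 * δ)} ∈ 𝓝 q' :=
        (isClosed_Icc.isOpen_compl.preimage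
          (continuous_snd.comp continuous_snd)).mem_nhds hnot
      filter_upwards [ho, slab_mem_nhds hqi'] with q'' h4 h5
      rw [kappa_scale]
      exact h3 q'' h5 h4
    have h4 := hWK q' ⟨hmn.1, hqi'⟩ _ (Or.inr ⟨δ, hδ, hPe⟩)
    rw [show (reeb (scale h lam) (F q') : E3) = rawD F q' (torsVec (kappa (scale h lam) F) q') from
      hF.reeb_eq_torsVec (isContactFormFor_scale hlam hh h0) hqi']
    have h5 := est q' hqi' e0.1 e0.2.1 e0.2.2 _ h4.1 h4.2
    exact ⟨by linarith [h5.1], h5.2.trans (le_max_right _ _)⟩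
  · rw [hF.isTransitionReeb_outside hlam hδ0 hV hr]
    exact ⟨by linarith [hr2.1], hr2.2.trans (le_max_left _ _)⟩

/-- The closed Reeb orbits outside of the pure region `δ < θ < 1 - δ` have periods that are bounded
below independently of `δ` and of the form inside the pure region. -/
theorem exists_uniform_period_bound [CompactSpace M] (hlam : IsContactFormFor ξ lam)
    (h1 : ∀ q ∈ slab, (q.2.2 = 0 ∨ q.2.2 = 1) → kappa lam F q = 1) :
    ∃ c > (0 : ℝ), ∃ δ₁ > (0 : ℝ), ∀ δ ∈ Ioo 0 δ₁, ∀ (V : ∀ p : M, TangentSpace (𝓡 3) p)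
      (γ : ℝ → M), IsMIntegralCurve γ V →
      (∀ t, γ t ∈ (F '' {q | q.2.2 ∈ Ioo δ (1 - δ)})ᶜ ∧ IsTransitionReeb lam F δ (γ t) (V (γ t))) →
      ∀ T > 0, γ T = γ 0 → c ≤ T := by
  have hopen : IsOpen (F '' slabInt) := hF.isOpen_image isOpen_Ioo subset_rfl
  refine exists_period_lower_bound (O := (F '' slabInt)ᶜ)
    (S := fun δ => (F '' {q | q.2.2 ∈ Ioo δ (1 - δ)})ᶜ) hopen.isClosed_compl.isCompact ?_ ?_
  · intro U hU hsub
    have hcov : Uᶜ ⊆ ⋃ n : ℕ, F '' {q : T3 | q.2.2 ∈ Ioo (1 / (n + 1 : ℝ)) (1 - 1 / (n + 1 : ℝ))} := by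
      intro r hr
      have h2 : r ∈ F '' slabInt := by
        by_contra h; exact hr (hsub h)
      obtain ⟨q, hq, rfl⟩ := h2
      obtain ⟨n, hn⟩ := exists_nat_one_div_lt (lt_min hq.1 (sub_pos.2 hq.2))
      refine mem_iUnion.2 ⟨n, q, ⟨hn.trans_le (min_le_left _ _), ?_⟩, rfl⟩
      have := hn.trans_le (min_le_right _ _)
      linarith
    have hmono : ∀ n m : ℕ, n ≤ m → (1 : ℝ) / (m + 1) ≤ 1 / (n + 1) := fun n m h =>
      Nat.one_div_le_one_div h
    obtain ⟨n, hn⟩ := hU.isClosed_compl.isCompact.elim_directed_cover _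
      (fun n => by
        refine hF.isOpen_image isOpen_Ioo fun t ht => ⟨?_, ?_⟩
        · exact (by positivity : (0 : ℝ) ≤ 1 / (n + 1 : ℝ)).trans_lt ht.1
        · have : (0 : ℝ) ≤ 1 / (n + 1 : ℝ) := by positivity
          linarith [ht.2]) hcov (directed_of_isDirected_le fun n m h => by
        refine image_mono fun q hq => ?_
        have := hmono n m h
        exact ⟨this.trans_lt hq.1, by linarith [hq.2]⟩)
    refine ⟨1 / (n + 1 : ℝ), by positivity, fun δ hδ => ?_⟩
    rw [compl_subset_comm]
    refine hn.trans (image_mono fun q hq => ⟨hδ.2.trans hq.1, ?_⟩)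
    have := hq.2
    have := hδ.2
    linarith
  · intro p hp
    by_cases hps : p ∈ F '' slab
    · obtain ⟨q₀, hq₀, rfl⟩ := hps
      refine hF.exists_local_bounds_boundary hlam h1 ?_
      by_contra hcon
      push Not at hcon
      exact hp ⟨q₀, ⟨lt_of_le_of_ne hq₀.1 hcon.1.symm, lt_of_le_of_ne hq₀.2 hcon.2⟩, rfl⟩
    · obtain ⟨U, hU, l, K, hK, δ₀, hδ₀, h⟩ := hF.exists_local_bounds_outside hlam hps
      exact ⟨U, hU, l, K, hK, δ₀, hδ₀, fun δ hδ r hr => h δ hδ r hr.1⟩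

end IsTorsionMap
end PeriodEstimate

/-! ### The adapted contact form -/

section Adapted

variable {M : Type*} [TopologicalSpace M] [ChartedSpace E3 M]
variable {ξ : ∀ p : M, Submodule ℝ (TangentSpace (𝓡 3) p)} {F : T3 → M}
variable {lam : ∀ p : M, TangentSpace (𝓡 3) p →L[ℝ] ℝ} {ε δ : ℝ}

theorem torsVec_congr {P P' : T3 → ℝ} {q : T3} (h : P =ᶠ[𝓝 q] P') : torsVec P q = torsVec P' q := by
  rw [torsVec, torsVec, h.eq_of_nhds, h.fderiv_eq]

/-- The contact form `lam` is, in the pure region `δ < θ < 1 - δ` of the thickened torus, the form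
`f dx + g dy` given by the profile curve with parameters `ε` and `δ`. The bound `slope` on the
variation of the weight guarantees that the Reeb field is horizontal enough outside of the tori
`θ = 1 / 4` and `θ = 3 / 4`. -/
structure IsAdapted (ξ : ∀ p : M, Submodule ℝ (TangentSpace (𝓡 3) p)) (F : T3 → M)
    (lam : ∀ p : M, TangentSpace (𝓡 3) p →L[ℝ] ℝ) (ε δ : ℝ) : Prop where
  torsion : IsTorsionMap ξ F
  contact : IsContactFormFor ξ lam
  eps_pos : 0 < ε
  eps_lt : ε < 1 / 3
  del_pos : 0 < δ
  del_lt : δ < 1 / 32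
  kappa_eq : ∀ q ∈ slab, q.2.2 ∈ Ioo δ (1 - δ) → kappa lam F q = prof ε δ q.2.2
  slope : ∀ θ ∈ Ioo (0 : ℝ) 1,
    |deriv (weight ε δ) θ * Real.sin (2 * Real.pi * θ) ^ 3 / (4 * Real.pi)| ≤ 1 / 2 ∧
    (deriv (weight ε δ) θ ≠ 0 → 1 / 2 < Real.cos (2 * Real.pi * θ))

/-- The flow line through `q` of the Reeb field of `f dx + g dy`. -/
def flowLine (ε δ : ℝ) (t : ℝ) (q : T3) : T3 :=
  (q.1 + t * velX ε δ q.2.2, q.2.1 + t * velY ε δ q.2.2, q.2.2)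

theorem hasDerivAt_flowLine (ε δ : ℝ) (t : ℝ) (q : T3) : HasDerivAt (fun t => flowLine ε δ t q)
    (velX ε δ q.2.2, velY ε δ q.2.2, 0) t := by
  have h : ∀ a b : ℝ, HasDerivAt (fun t => a + t * b) b t := fun a b => by
    simpa using ((hasDerivAt_id t).mul_const b).const_add a
  exact (h _ _).prodMk ((h _ _).prodMk (hasDerivAt_const t q.2.2))

namespace IsAdapted

variable (hA : IsAdapted ξ F lam ε δ)
include hA

theorem eps_le_one : ε ≤ 1 := by linarith [hA.eps_lt]

theorem mem_slabInt {q : T3} (hq : q.2.2 ∈ Ioo δ (1 - δ)) : q ∈ slabInt :=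
  ⟨by linarith [hq.1, hA.del_pos], by linarith [hq.2, hA.del_pos]⟩

theorem mem_slab {q : T3} (hq : q.2.2 ∈ Ioo δ (1 - δ)) : q ∈ slab :=
  slabInt_subset_slab (hA.mem_slabInt hq)

theorem kappa_eventuallyEq {q : T3} (hq : q.2.2 ∈ Ioo δ (1 - δ)) :
    kappa lam F =ᶠ[𝓝 q] fun q => prof ε δ q.2.2 := by
  filter_upwards [(isOpen_Ioo.preimage (continuous_snd.comp continuous_snd)).mem_nhds hq] with q' hq'
  exact hA.kappa_eq q' (hA.mem_slab hq') hq'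

variable [IsManifold (𝓡 3) ∞ M]

theorem reeb_eq {q : T3} (hq : q.2.2 ∈ Ioo δ (1 - δ)) :
    reeb lam (F q) = rawD F q (velX ε δ q.2.2, velY ε δ q.2.2, 0) := by
  rw [hA.torsion.reeb_eq_torsVec hA.contact (hA.mem_slabInt hq),
    torsVec_congr (hA.kappa_eventuallyEq hq), torsVec_prof hA.eps_pos hA.eps_le_one]

theorem isMIntegralCurve_flowLine {q : T3} (hq : q.2.2 ∈ Ioo δ (1 - δ)) :
    IsMIntegralCurve (F ∘ fun t => flowLine ε δ t q) (reeb lam) := by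
  intro t
  have hq' : (flowLine ε δ t q).2.2 ∈ Ioo δ (1 - δ) := hq
  have h1 := hasMFDerivAt_comp_curve (G := F) (α := fun t => flowLine ε δ t q)
    ((hA.torsion.contMDiffAt (hA.mem_slabInt hq')).mdifferentiableAt (by simp))
    (hasDerivAt_flowLine ε δ t q)
  have h2 := hA.reeb_eq hq'
  have h3 : (reeb lam ((F ∘ fun t => flowLine ε δ t q) t) : E3) =
      rawD F (flowLine ε δ t q) (velX ε δ q.2.2, velY ε δ q.2.2, 0) := h2
  exact cast (congrArg (fun V : E3 => HasMFDerivAt 𝓘(ℝ, ℝ) (𝓡 3) (F ∘ fun t => flowLine ε δ t q) t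
    ((1 : ℝ →L[ℝ] ℝ).smulRight V)) h3.symm) h1

variable [T2Space M]

theorem flow_eq {φ : ℝ → M → M} (hφ : IsFlowOf (reeb lam) φ) {q : T3} (hq : q.2.2 ∈ Ioo δ (1 - δ))
    (t : ℝ) : φ t (F q) = F (flowLine ε δ t q) := by
  have := isMIntegralCurve_eq (isSmoothField_reeb hA.contact.1) (hφ (F q)).2
    (hA.isMIntegralCurve_flowLine hq) (by simp [(hφ (F q)).1, flowLine])
  exact congrFun this t

/-- An orbit which meets the pure region lies in it. -/
theorem exists_of_flow_mem {φ : ℝ → M → M} (hφ : IsFlowOf (reeb lam) φ) {r : M} {t : ℝ} {q : T3}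
    (hq : q.2.2 ∈ Ioo δ (1 - δ)) (h : φ t r = F q) :
    ∃ q' : T3, q'.2.2 ∈ Ioo δ (1 - δ) ∧ r = F q' := by
  have h1 : IsMIntegralCurve ((fun s => φ s r) ∘ (· + t)) (reeb lam) := (hφ r).2.comp_add t
  have h2 := isMIntegralCurve_eq (isSmoothField_reeb hA.contact.1) h1
    (hA.isMIntegralCurve_flowLine hq) (by simp [h, flowLine])
  have h3 := congrFun h2 (-t)
  simp only [Function.comp_apply, neg_add_cancel, (hφ r).1] at h3
  exact ⟨flowLine ε δ (-t) q, hq, h3⟩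

/-- A closed orbit in the pure region either lies in one of the tori where `velX = 0` or winds around
the `x`-direction. In the second case its period is at least `2 / 3`, as `|velX| ≤ 3 / 2`. -/
theorem period_of_mem {φ : ℝ → M → M} (hφ : IsFlowOf (reeb lam) φ) {q : T3}
    (hq : q.2.2 ∈ Ioo δ (1 - δ)) {T : ℝ} (hT : 0 < T) (hper : φ T (F q) = F q) :
    (q.2.2 = 1 / 4 ∨ q.2.2 = 3 / 4) ∨ 2 * ε < T := by
  have hi := hA.mem_slabInt hq
  have hb := velX_bound hA.eps_pos hA.eps_le_one hi (hA.slope _ hi)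
  rw [hA.flow_eq hφ hq] at hper
  have hfl : flowLine ε δ T q ∈ slab := hA.mem_slab hq
  obtain ⟨m, n, h1, -, -⟩ := (hA.torsion.eq_iff q (hA.mem_slab hq) _ hfl).1 hper.symm
  simp only [flowLine, add_right_inj] at h1
  by_cases hm : m = 0
  · left
    rw [hm, Int.cast_zero, mul_eq_zero, or_iff_right hT.ne'] at h1
    exact hb.2 h1
  · right
    have h2 : (1 : ℝ) ≤ |(m : ℝ)| := by exact_mod_cast Int.one_le_abs hm
    rw [← h1, abs_mul, abs_of_pos hT] at h2
    have h3 : T * |velX ε δ q.2.2| ≤ T * (3 / 2) := by gcongr; exact hb.1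
    linarith [hA.eps_lt]

end IsAdapted

theorem contDiffOn_interp {κ : T3 → ℝ} (hκ : ContDiffOn ℝ ∞ κ slab) (δ : ℝ) :
    ContDiffOn ℝ ∞ (interp δ κ) slab := by
  have h : ContDiff ℝ ∞ fun q : T3 => cutoff δ q.2.2 := (contDiff_cutoff δ).comp (by fun_prop)
  exact contDiffOn_const.add ((contDiffOn_const.sub h.contDiffOn).mul (hκ.sub contDiffOn_const))

theorem interp_pos {κ : T3 → ℝ} {q : T3} (h : 0 < κ q) (δ : ℝ) : 0 < interp δ κ q := by
  have h0 := cutoff_nonneg δ q.2.2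
  have h1 := cutoff_le_one δ q.2.2
  have h2 : interp δ κ q = cutoff δ q.2.2 + (1 - cutoff δ q.2.2) * κ q := by rw [interp]; ring
  rw [h2]
  rcases h0.eq_or_lt with h3 | h3
  · rw [← h3]; simpa using h
  · have := mul_nonneg (sub_nonneg.2 h1) h.le
    linarith

/-- A contact manifold with Giroux torsion has an adapted contact form, all of whose closed Reeb
orbits have period greater than `2 ε`, except for those at `θ = 1/4` and `θ = 3/4`. -/
theorem IsTorsionMap.exists_adapted [IsManifold (𝓡 3) ∞ M] [T2Space M] [CompactSpace M]
    (hF : IsTorsionMap ξ F) (hξ : IsContactStructure ξ) :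
    ∃ ε δ : ℝ, ∃ lam : ∀ p : M, TangentSpace (𝓡 3) p →L[ℝ] ℝ, IsAdapted ξ F lam ε δ ∧
      ∀ φ, IsFlowOf (reeb lam) φ → ∀ r T, 0 < T → φ T r = r →
        r ∈ F '' {q | q.2.2 = 1 / 4 ∨ q.2.2 = 3 / 4} ∨ 2 * ε < T := by
  obtain ⟨lam₁, hlam₁, hpos, hbd⟩ := hF.exists_normalized_contactForm hξ
  obtain ⟨c, hc, δ₁, hδ₁, hper⟩ := hF.exists_uniform_period_bound hlam₁ hbd
  obtain ⟨ε, hε, hεc⟩ := exists_between (lt_min (by positivity : 0 < c / 2)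
    (by norm_num : (0 : ℝ) < 1 / 3))
  have hε1 : ε < 1 / 3 := hεc.trans_le (min_le_right _ _)
  have hε2 : ε < c / 2 := hεc.trans_le (min_le_left _ _)
  obtain ⟨δ₂, hδ₂, hslope⟩ := exists_small_slope hε (by linarith)
  obtain ⟨δ, hδ, hδm⟩ := exists_between (lt_min hδ₁ (lt_min hδ₂ (by norm_num : (0 : ℝ) < 1 / 32)))
  have hδ1 : δ < δ₁ := hδm.trans_le (min_le_left _ _)
  have hδ2 : δ < δ₂ := hδm.trans_le ((min_le_right _ _).trans (min_le_left _ _))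
  have hδ3 : δ < 1 / 32 := hδm.trans_le ((min_le_right _ _).trans (min_le_right _ _))
  set κ := kappa lam₁ F with hκ
  have hκs := hF.contDiffOn_kappa hlam₁.1.smooth
  set k : T3 → ℝ := fun q => interp δ κ q * prof ε δ q.2.2 / κ q with hk
  have hkpos : ∀ q ∈ slab, 0 < k q := fun q hq =>
    div_pos (mul_pos (interp_pos (hpos q hq) δ) (prof_pos hε (by linarith) δ _)) (hpos q hq)
  have hks : ContDiffOn ℝ ∞ k slabInt := by
    have h1 : ContDiff ℝ ∞ fun q : T3 => prof ε δ q.2.2 :=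
      (contDiff_prof hε (by linarith) δ).comp (by fun_prop)
    exact (((contDiffOn_interp hκs δ).mul h1.contDiffOn).div hκs
      fun q hq => (hpos q hq).ne').mono slabInt_subset_slab
  obtain ⟨h, hh, hhF, hh1⟩ := hF.exists_smooth_extension hks (a := 1) (η := δ / 2)
    (fun m n q hq => by
      have h1 := hF.kappa_deck (lam := lam₁) m n hq
      have h2 : (deck m n q).2.2 = q.2.2 := rfl
      simp only [hk, interp, h2, hκ, h1]) (by linarith)
    (fun q hq hθ => by
      rw [mem_Icc, not_and_or, not_le, not_le] at hθ
      have h1 : cutoff δ q.2.2 = 0 := cutoff_eq_zero hδ (by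
        rcases hθ with h | h
        · left; linarith
        · right; linarith)
      have h2 : prof ε δ q.2.2 = 1 := prof_eq_one hδ (by
        rcases hθ with h | h
        · left; linarith
        · right; linarith)
      simp only [hk, interp, h1, h2, sub_zero, one_mul, mul_one, add_sub_cancel]
      exact div_self (hpos q hq).ne')
  have hh0 : ∀ r, h r ≠ 0 := by
    intro r
    by_cases hr : r ∈ F '' {q | q.2.2 ∈ Icc (δ / 2) (1 - δ / 2)}
    · obtain ⟨q, hq, rfl⟩ := hr
      have hqs : q ∈ slab := ⟨by linarith [hq.1], by linarith [hq.2]⟩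
      rw [hhF q hqs]
      exact (hkpos q hqs).ne'
    · rw [hh1 r hr]; exact one_ne_zero
  have hkk : ∀ q ∈ slab, h (F q) * κ q = interp δ κ q * prof ε δ q.2.2 := by
    intro q hq
    rw [hhF q hq, hk]
    exact div_mul_cancel₀ _ (hpos q hq).ne'
  have hA : IsAdapted ξ F (scale h lam₁) ε δ := by
    refine ⟨hF, isContactFormFor_scale hlam₁ hh hh0, hε, hε1, hδ, hδ3, ?_, hslope δ ⟨hδ, hδ2⟩⟩
    intro q hq hθ
    rw [kappa_scale, hkk q hq, interp, cutoff_eq_one hδ (Ioo_subset_Icc_self hθ)]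
    ring
  refine ⟨ε, δ, _, hA, ?_⟩
  intro φ hφ r T hT hperT
  by_cases hex : ∃ t, φ t r ∈ F '' {q | q.2.2 ∈ Ioo δ (1 - δ)}
  · obtain ⟨t, q, hq, h1⟩ := hex
    obtain ⟨q', hq', rfl⟩ := hA.exists_of_flow_mem hφ hq h1.symm
    rcases hA.period_of_mem hφ hq' hT hperT with h2 | h2
    · exact Or.inl ⟨q', h2, rfl⟩
    · exact Or.inr h2
  · push Not at hex
    right
    have := hper δ ⟨hδ, hδ1⟩ (reeb (scale h lam₁)) (fun t => φ t r) (hφ r).2 (fun t =>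
      ⟨hex t, h, hh, hh0, hh1, ?_, rfl⟩) T hT (by simp only [hperT, (hφ r).1])
    · linarith
    · intro q hq hθ
      rw [hkk q hq, prof_eq_one hδ, mul_one]
      rw [mem_Icc, not_and_or, not_le, not_le] at hθ
      exact hθ.imp le_of_lt le_of_lt

end Adapted

/-! ### Tame endomorphisms of the contact planes -/

section Endomorphisms

variable {M : Type*} [TopologicalSpace M] [ChartedSpace E3 M]

/-- The field of endomorphisms `B`, in the chart around `p`. -/
def rawEndo (B : M → E3 →L[ℝ] E3) (p : M) (y : E3) : E3 →L[ℝ] E3 :=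
  (chD p ((extChartAt (𝓡 3) p).symm y)).comp
    ((B ((extChartAt (𝓡 3) p).symm y)).comp (rawD (extChartAt (𝓡 3) p).symm y))

/-- The field of endomorphisms `B` is smooth near `r`, in every chart. -/
def IsSmoothEndoAt (B : M → E3 →L[ℝ] E3) (r : M) : Prop :=
  ∀ p, r ∈ (extChartAt (𝓡 3) p).source → ContDiffAt ℝ ∞ (rawEndo B p) (extChartAt (𝓡 3) p r)

variable [IsManifold (𝓡 3) ∞ M]

/-- A field of endomorphisms is smooth if it is smooth in some local parametrization. -/
theorem isSmoothEndoAt_of_param {E' : Type*} [NormedAddCommGroup E'] [NormedSpace ℝ E']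
    (A : E3 ≃L[ℝ] E') {G : E' → M} {Ω : Set E'} (hΩ : IsOpen Ω)
    (hG : ContMDiffOn 𝓘(ℝ, E') (𝓡 3) ∞ G Ω) {q₀ : E'} (hq₀ : q₀ ∈ Ω)
    (hinj : Function.Injective (rawD G q₀)) {B : M → E3 →L[ℝ] E3} {β : E' → E' →L[ℝ] E'}
    (hβ : ContDiffAt ℝ ∞ β q₀) (hB : ∀ q ∈ Ω, ∀ v, B (G q) (rawD G q v) = rawD G q (β q v)) :
    IsSmoothEndoAt B (G q₀) := by
  intro p hs
  obtain ⟨e, he, heo, hes⟩ := exists_chart_of_immersion A hΩ hG hq₀ hinj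
  set c := extChartAt (𝓡 3) p with hc
  set x : E3 → E' := fun y => A (e (c.symm y)) with hx
  have hl : c.symm (c (G q₀)) = G q₀ := c.left_inv hs
  have h1 : e.symm (A.symm q₀) = G q₀ := by rw [(hes _ heo).2, A.apply_symm_apply]
  have hesrc : G q₀ ∈ e.source := by rw [← h1]; exact e.map_target heo
  have hx0 : x (c (G q₀)) = q₀ := by
    simp only [hx, hl]
    rw [← h1, e.right_inv heo, A.apply_symm_apply]
  have hyt : c (G q₀) ∈ c.target := c.map_source hs
  have hGat : ∀ q ∈ Ω, ContMDiffAt 𝓘(ℝ, E') (𝓡 3) ∞ G q := fun q hq =>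
    hG.contMDiffAt (hΩ.mem_nhds hq)
  have hev : ∀ᶠ y in 𝓝 (c (G q₀)), y ∈ c.target ∧ c.symm y ∈ e.source := by
    refine (show ∀ᶠ y in 𝓝 (c (G q₀)), y ∈ c.target from
      (isOpen_chart_target p).mem_nhds hyt).and ?_
    refine (contMDiffAt_chart_symm p hyt).continuousAt.eventually (e.open_source.mem_nhds ?_)
    rw [hl]; exact hesrc
  have hxs : ∀ y, y ∈ c.target → c.symm y ∈ e.source → ContDiffAt ℝ ∞ x y := by
    intro y hy hy'
    have h2 : ContMDiffAt (𝓡 3) (𝓡 3) ∞ e (c.symm y) := contMDiffAt_of_mem_maximalAtlas he hy'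
    have h3 : ContMDiffAt 𝓘(ℝ, E3) 𝓘(ℝ, E') ∞ x y :=
      (A.contDiff.contMDiff.contMDiffAt).comp y (h2.comp y (contMDiffAt_chart_symm p hy))
    exact h3.contDiffAt
  have hGx : ∀ y, c.symm y ∈ e.source → x y ∈ Ω ∧ G (x y) = c.symm y := by
    intro y hy
    have h2 := hes _ (e.map_source hy)
    rw [e.left_inv hy] at h2
    exact ⟨h2.1, h2.2.symm⟩
  have hx1 := hxs _ hyt (by rw [hl]; exact hesrc)
  have hβx : ContDiffAt ℝ ∞ (fun y => β (x y)) (c (G q₀)) := by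
    refine ContDiffAt.comp (c (G q₀)) ?_ hx1
    rw [hx0]; exact hβ
  have hcG : ContDiffAt ℝ ∞ (fun y => fderiv ℝ (c ∘ G) (x y)) (c (G q₀)) := by
    refine ContDiffAt.comp (c (G q₀)) ?_ hx1
    rw [hx0]
    exact (contDiffAt_chart_comp (hGat q₀ hq₀) hs).fderiv_right (by simp)
  have hdx : ContDiffAt ℝ ∞ (fderiv ℝ x) (c (G q₀)) := hx1.fderiv_right (by simp)
  refine (hcG.clm_comp (hβx.clm_comp hdx)).congr_of_eventuallyEq ?_
  filter_upwards [hev, hev.eventually_nhds] with y hy hy2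
  refine ContinuousLinearMap.ext fun v => ?_
  obtain ⟨hxΩ, hGxy⟩ := hGx y hy.2
  have hGm := (hGat _ hxΩ).mdifferentiableAt (by simp)
  have h2 : rawD c.symm y v = rawD G (x y) (fderiv ℝ x y v) := by
    have h3 : (c.symm : E3 → M) =ᶠ[𝓝 y] G ∘ x := by
      filter_upwards [hy2] with y' hy'
      exact (hGx y' hy'.2).2.symm
    have h4 := h3.mfderiv_eq (I := 𝓘(ℝ, E3)) (I' := 𝓡 3)
    have h5 := mfderiv_comp y hGm ((hxs y hy.1 hy.2).differentiableAt (by simp)).mdifferentiableAt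
    rw [mfderiv_eq_fderiv] at h5
    exact congrArg (fun L : E3 →L[ℝ] E3 => L v) (h4.trans h5)
  change chD p (c.symm y) (B (c.symm y) (rawD c.symm y v)) = _
  rw [h2, ← hGxy, hB _ hxΩ, chD_comp_rawD hGm (by rw [hGxy]; exact c.map_target hy.1)]
  rfl

omit [IsManifold (𝓡 3) ∞ M] in
theorem rawEndo_smul (f : M → ℝ) (B : M → E3 →L[ℝ] E3) (p : M) :
    rawEndo (fun r => f r • B r) p =
      fun y => f ((extChartAt (𝓡 3) p).symm y) • rawEndo B p y := by
  funext y
  simp [rawEndo, ContinuousLinearMap.smul_comp]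

theorem IsSmoothEndoAt.smul {f : M → ℝ} (hf : ContMDiff (𝓡 3) 𝓘(ℝ, ℝ) ∞ f)
    {B : M → E3 →L[ℝ] E3} {r : M} (hB : r ∈ tsupport f → IsSmoothEndoAt B r) :
    IsSmoothEndoAt (fun r => f r • B r) r := by
  intro p hp
  rw [rawEndo_smul]
  have hy := (extChartAt (𝓡 3) p).map_source hp
  by_cases hr : r ∈ tsupport f
  · exact (contDiffAt_comp_chart_symm hf p hy).smul (hB hr p hp)
  · have h1 : ∀ᶠ y in 𝓝 (extChartAt (𝓡 3) p r), (extChartAt (𝓡 3) p).symm y ∈ (tsupport f)ᶜ := by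
      refine (contMDiffAt_chart_symm p hy).continuousAt.eventually
        ((isClosed_tsupport f).isOpen_compl.mem_nhds ?_)
      rw [(extChartAt (𝓡 3) p).left_inv hp]
      exact hr
    refine (contDiffAt_const (c := 0)).congr_of_eventuallyEq ?_
    filter_upwards [h1] with y hy
    rw [image_eq_zero_of_notMem_tsupport hy]
    exact ContinuousLinearMap.ext fun v => zero_smul ℝ (rawEndo B p y v)

omit [IsManifold (𝓡 3) ∞ M] in
theorem IsSmoothEndoAt.add {B B' : M → E3 →L[ℝ] E3} {r : M} (hB : IsSmoothEndoAt B r)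
    (hB' : IsSmoothEndoAt B' r) : IsSmoothEndoAt (fun r => B r + B' r) r := by
  intro p hp
  have h : rawEndo (fun r => B r + B' r) p = fun y => rawEndo B p y + rawEndo B' p y := by
    funext y
    simp [rawEndo]
  rw [h]
  exact (hB p hp).add (hB' p hp)

omit [IsManifold (𝓡 3) ∞ M] in
theorem IsSmoothEndoAt.sum {ι : Type*} {s : Finset ι} {B : ι → M → E3 →L[ℝ] E3} {r : M}
    (hB : ∀ i ∈ s, IsSmoothEndoAt (B i) r) : IsSmoothEndoAt (fun r => ∑ i ∈ s, B i r) r := by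
  classical
  induction s using Finset.induction_on with
  | empty =>
    intro p hp
    have h : rawEndo (fun r : M => ∑ i ∈ (∅ : Finset ι), B i r) p = fun _ => 0 := by
      funext y
      simp [rawEndo]
    rw [h]
    exact contDiffAt_const
  | insert a s ha ih =>
    simp only [Finset.sum_insert ha]
    exact (hB a (Finset.mem_insert_self a s)).add
      (ih fun i hi => hB i (Finset.mem_insert_of_mem hi))

/-- The endomorphism `L` at `r` annihilates the Reeb direction, preserves the contact plane, and
`dlam (·, L ·)` is symmetric and positive definite on the contact plane. These conditions describe
a convex cone, which contains the compatible complex structures. -/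
structure IsTame (lam : ∀ p : M, TangentSpace (𝓡 3) p →L[ℝ] ℝ) (r : M) (L : E3 →L[ℝ] E3) :
    Prop where
  map_reeb : ∀ X : E3, IsReebAt lam r X → L X = 0
  apply : ∀ v, rawF lam r (L v) = 0
  symm : ∀ v w : E3, rawF lam r v = 0 → rawF lam r w = 0 → rawE lam r v (L w) = rawE lam r w (L v)
  pos : ∀ v : E3, rawF lam r v = 0 → v ≠ 0 → 0 < rawE lam r v (L v)

/-- The weak form of `IsTame`, with a semidefinite form. -/
structure IsWeaklyTame (lam : ∀ p : M, TangentSpace (𝓡 3) p →L[ℝ] ℝ) (r : M) (L : E3 →L[ℝ] E3) :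
    Prop where
  map_reeb : ∀ X : E3, IsReebAt lam r X → L X = 0
  apply : ∀ v, rawF lam r (L v) = 0
  symm : ∀ v w : E3, rawF lam r v = 0 → rawF lam r w = 0 → rawE lam r v (L w) = rawE lam r w (L v)
  nonneg : ∀ v : E3, rawF lam r v = 0 → 0 ≤ rawE lam r v (L v)

variable {lam : ∀ p : M, TangentSpace (𝓡 3) p →L[ℝ] ℝ} {r : M}

omit [IsManifold (𝓡 3) ∞ M]

theorem rawE_zero_right (v : E3) : rawE lam r v (0 : E3) = 0 := by
  have := rawE_smul_right lam r 0 v 0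
  simpa using this

theorem rawE_zero_left (v : E3) : rawE lam r (0 : E3) v = 0 := by
  have := rawE_smul_left lam r 0 0 v
  simpa using this

theorem IsTame.smul {L : E3 →L[ℝ] E3} (h : IsTame lam r L) {a : ℝ} (ha : 0 < a) :
    IsTame lam r (a • L) where
  map_reeb X hX := by rw [smul_apply, h.map_reeb X hX, smul_zero]
  apply v := by rw [smul_apply, map_smul, h.apply, smul_zero]
  symm v w hv hw := by
    rw [smul_apply, smul_apply, rawE_smul_right,
      rawE_smul_right, h.symm v w hv hw]
  pos v hv hv0 := by
    rw [smul_apply, rawE_smul_right]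
    exact mul_pos ha (h.pos v hv hv0)

theorem IsTame.weakly {L : E3 →L[ℝ] E3} (h : IsTame lam r L) : IsWeaklyTame lam r L where
  map_reeb := h.map_reeb
  apply := h.apply
  symm := h.symm
  nonneg v hv := by
    by_cases hv0 : v = 0
    · rw [hv0, rawE_zero_left]
    · exact (h.pos v hv hv0).le

theorem isWeaklyTame_zero : IsWeaklyTame lam r 0 where
  map_reeb _ _ := rfl
  apply v := by simp
  symm v w _ _ := by
    rw [zero_apply, zero_apply, rawE_zero_right,
      rawE_zero_right]
  nonneg v _ := by rw [zero_apply, rawE_zero_right]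

theorem IsTame.weakly_smul {L : E3 →L[ℝ] E3} {a : ℝ} (ha : 0 ≤ a) (h : a ≠ 0 → IsTame lam r L) :
    IsWeaklyTame lam r (a • L) := by
  rcases ha.eq_or_lt with h0 | h0
  · have h1 : a • L = 0 := by
      rw [← h0]
      exact ContinuousLinearMap.ext fun v => zero_smul ℝ (L v)
    rw [h1]
    exact isWeaklyTame_zero
  · exact ((h h0.ne').smul h0).weakly

theorem IsTame.add_weakly {L L' : E3 →L[ℝ] E3} (h : IsTame lam r L) (h' : IsWeaklyTame lam r L') :
    IsTame lam r (L + L') where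
  map_reeb X hX := by
    rw [add_apply, h.map_reeb X hX, h'.map_reeb X hX, add_zero]
  apply v := by rw [add_apply, map_add, h.apply, h'.apply, add_zero]
  symm v w hv hw := by
    rw [add_apply, add_apply, rawE_add_right,
      rawE_add_right, h.symm v w hv hw, h'.symm v w hv hw]
  pos v hv hv0 := by
    rw [add_apply, rawE_add_right]
    exact add_pos_of_pos_of_nonneg (h.pos v hv hv0) (h'.nonneg v hv)

theorem IsWeaklyTame.add {L L' : E3 →L[ℝ] E3} (h : IsWeaklyTame lam r L)
    (h' : IsWeaklyTame lam r L') : IsWeaklyTame lam r (L + L') where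
  map_reeb X hX := by
    rw [add_apply, h.map_reeb X hX, h'.map_reeb X hX, add_zero]
  apply v := by rw [add_apply, map_add, h.apply, h'.apply, add_zero]
  symm v w hv hw := by
    rw [add_apply, add_apply, rawE_add_right,
      rawE_add_right, h.symm v w hv hw, h'.symm v w hv hw]
  nonneg v hv := by
    rw [add_apply, rawE_add_right]
    exact add_nonneg (h.nonneg v hv) (h'.nonneg v hv)

theorem isWeaklyTame_sum {ι : Type*} {s : Finset ι} {L : ι → E3 →L[ℝ] E3}
    (h : ∀ i ∈ s, IsWeaklyTame lam r (L i)) : IsWeaklyTame lam r (∑ i ∈ s, L i) := by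
  classical
  induction s using Finset.induction_on with
  | empty => simpa using isWeaklyTame_zero
  | insert a s ha ih =>
    rw [Finset.sum_insert ha]
    exact (h a (Finset.mem_insert_self a s)).add
      (ih fun i hi => h i (Finset.mem_insert_of_mem hi))

theorem exists_rawF_eq_one (hlam : IsContactForm lam) (r : M) : ∃ X : E3, rawF lam r X = 1 := by
  by_contra hcon
  push Not at hcon
  have h0 : ∀ v, rawF lam r v = 0 := fun v => by
    by_contra hv
    exact hcon ((rawF lam r v)⁻¹ • v) (by rw [map_smul, smul_eq_mul, inv_mul_cancel₀ hv])
  apply hlam.contact r _ (EuclideanSpace.basisFun (Fin 3) ℝ).toBasis.linearIndependent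
  change rawF lam r _ * _ + rawF lam r _ * _ + rawF lam r _ * _ = 0
  rw [h0, h0, h0]; ring

theorem exists_ker_ne_zero (f : E3 →L[ℝ] ℝ) : ∃ e : E3, f e = 0 ∧ e ≠ 0 := by
  by_cases h : f (eb 0) = 0
  · refine ⟨eb 0, h, fun h0 => ?_⟩
    have := congrArg (fun v : E3 => v 0) h0
    simp [eb_apply] at this
  · refine ⟨f (eb 1) • eb 0 - f (eb 0) • eb 1, by
      rw [map_sub, map_smul, map_smul, smul_eq_mul, smul_eq_mul, mul_comm, sub_self], fun h0 => ?_⟩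
    have := congrArg (fun v : E3 => v 1) h0
    simp [eb_apply] at this
    exact h this

/-- Two independent vectors span the kernel of a nonzero functional. -/
theorem exists_span_ker {f : E3 →L[ℝ] ℝ} {X e₁ e₂ : E3} (hX : f X = 1) (h₁ : f e₁ = 0)
    (h₂ : f e₂ = 0) (hindep : ∀ x y : ℝ, x • e₁ + y • e₂ = 0 → x = 0 ∧ y = 0) {v : E3}
    (hv : f v = 0) : ∃ x y : ℝ, v = x • e₁ + y • e₂ := by
  have hli : LinearIndependent ℝ ![X, e₁, e₂] := by
    rw [Fintype.linearIndependent_iff]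
    intro g hg
    simp only [Fin.sum_univ_three, Matrix.cons_val_zero, Matrix.cons_val_one,
      Matrix.cons_val_two, Matrix.tail_cons, Matrix.head_cons] at hg
    have h0 : g 0 = 0 := by
      have := congrArg f hg
      rw [map_add, map_add, map_smul, map_smul, map_smul, hX, h₁, h₂, map_zero] at this
      simpa using this
    rw [h0, zero_smul, zero_add] at hg
    obtain ⟨h3, h4⟩ := hindep _ _ hg
    intro i
    fin_cases i
    · exact h0
    · exact h3
    · exact h4
  have hsp := hli.span_eq_top_of_card_eq_finrank' (by simp)
  have hvm : v ∈ Submodule.span ℝ (range ![X, e₁, e₂]) := by rw [hsp]; trivial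
  rw [Submodule.mem_span_range_iff_exists_fun] at hvm
  obtain ⟨c, hc⟩ := hvm
  simp only [Fin.sum_univ_three, Matrix.cons_val_zero, Matrix.cons_val_one,
      Matrix.cons_val_two, Matrix.tail_cons, Matrix.head_cons] at hc
  have h0 : c 0 = 0 := by
    have := congrArg f hc
    rw [map_add, map_add, map_smul, map_smul, map_smul, hX, h₁, h₂, hv] at this
    simpa using this
  rw [h0, zero_smul, zero_add] at hc
  exact ⟨c 1, c 2, hc.symm⟩

/-- On the contact plane, the square of a tame endomorphism is a negative multiple of the
identity. -/
theorem IsTame.exists_sq {L : E3 →L[ℝ] E3} (h : IsTame lam r L) (hlam : IsContactForm lam) :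
    ∃ d > (0 : ℝ), ∀ v : E3, rawF lam r v = 0 → L (L v) = -(d • v) := by
  obtain ⟨X, hX⟩ := exists_rawF_eq_one hlam r
  obtain ⟨e₁, he₁, he₁0⟩ := exists_ker_ne_zero (rawF lam r)
  set e₂ := L e₁ with he₂
  have hk₂ : rawF lam r e₂ = 0 := h.apply e₁
  have ha : 0 < rawE lam r e₁ e₂ := h.pos e₁ he₁ he₁0
  set a := rawE lam r e₁ e₂
  have hindep : ∀ x y : ℝ, x • e₁ + y • e₂ = 0 → x = 0 ∧ y = 0 := by
    intro x y hxy
    have h1 : rawE lam r e₁ (x • e₁ + y • e₂ : E3) = y * a := by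
      rw [rawE_add_right, rawE_smul_right, rawE_smul_right, rawE_self]; ring
    have h2 : rawE lam r (x • e₁ + y • e₂ : E3) e₂ = x * a := by
      rw [rawE_add_left, rawE_smul_left, rawE_smul_left, rawE_self]; ring
    rw [hxy, rawE_zero_right] at h1
    rw [hxy, rawE_zero_left] at h2
    exact ⟨by simpa [ha.ne'] using h2.symm, by simpa [ha.ne'] using h1.symm⟩
  have hspan : ∀ v : E3, rawF lam r v = 0 → ∃ x y : ℝ, v = x • e₁ + y • e₂ := fun v hv =>
    exists_span_ker hX he₁ hk₂ hindep hv
  obtain ⟨x, y, hxy⟩ := hspan (L e₂) (h.apply e₂)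
  have hy : y = 0 := by
    have h1 := h.symm e₁ e₂ he₁ hk₂
    rw [← he₂, rawE_self, hxy, rawE_add_right, rawE_smul_right, rawE_smul_right, rawE_self] at h1
    have h2 : y * a = 0 := by linarith
    exact (mul_eq_zero.1 h2).resolve_right ha.ne'
  have hx : x < 0 := by
    have he₂0 : e₂ ≠ 0 := by
      intro h0
      have : a = 0 := by change rawE lam r e₁ e₂ = 0; rw [h0, rawE_zero_right]
      exact ha.ne' this
    have h1 := h.pos e₂ hk₂ he₂0
    rw [hxy, hy, zero_smul, add_zero, rawE_smul_right, rawE_swap] at h1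
    have h2 : 0 < -x * a := by
      change 0 < x * -a at h1
      linarith
    nlinarith
  refine ⟨-x, by linarith, fun v hv => ?_⟩
  obtain ⟨s, t, rfl⟩ := hspan v hv
  rw [map_add, map_smul, map_smul, hxy, hy]
  simp only [map_add, map_smul, zero_smul, add_zero, ← he₂, hxy, hy]
  module

end Endomorphisms

/-! ### Compatible almost complex structures -/

section Compatible

variable {M : Type*} [TopologicalSpace M] [ChartedSpace E3 M] [IsManifold (𝓡 3) ∞ M]
variable {lam : ∀ p : M, TangentSpace (𝓡 3) p →L[ℝ] ℝ}

/-- The square of a tame endomorphism, in a chart. -/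
theorem rawEndo_sq (hlam : IsContactForm lam) {B : M → E3 →L[ℝ] E3} {p : M} {y : E3}
    (hy : y ∈ (extChartAt (𝓡 3) p).target)
    (ht : IsTame lam ((extChartAt (𝓡 3) p).symm y) (B ((extChartAt (𝓡 3) p).symm y))) {d : ℝ}
    (hd : ∀ v : E3, rawF lam ((extChartAt (𝓡 3) p).symm y) v = 0 →
      B ((extChartAt (𝓡 3) p).symm y) (B ((extChartAt (𝓡 3) p).symm y) v) = -(d • v)) (w : E3) :
    rawEndo B p y (rawEndo B p y w) =
      -(d • (w - formInChart lam p y w • reebVec (formInChart lam p) y)) := by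
  set c := extChartAt (𝓡 3) p with hc
  set r := c.symm y with hr
  have hrs : r ∈ c.source := c.map_target hy
  have hry : c r = y := c.right_inv hy
  have h1 : ∀ V : E3, rawD c.symm y (chD p r V) = V := by
    intro V
    have := rawD_symm_comp_chD p hrs V
    rwa [show extChartAt (𝓡 3) p r = y from hry] at this
  have h2 : ∀ v : E3, chD p r (rawD c.symm y v) = v := chD_comp_rawD_symm p hy
  have hX := isReebAt_chart hlam p hy
  set R := reebVec (formInChart lam p) y with hR
  have h3 : ∀ V : E3, B r (B r V) = -(d • (V - rawF lam r V • rawD c.symm y R)) := by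
    intro V
    have h4 : rawF lam r (V - rawF lam r V • rawD c.symm y R) = 0 := by
      have h5 : rawF lam r (rawD c.symm y R) = 1 := hX.2
      rw [map_sub, map_smul, h5]; simp
    have h5 := hd _ h4
    have h6 : B r (rawD c.symm y R) = 0 := ht.map_reeb _ hX
    rw [map_sub, map_smul, h6, smul_zero, sub_zero] at h5
    exact h5
  change chD p r (B r (rawD c.symm y (chD p r (B r (rawD c.symm y w))))) = _
  rw [h1, h3, map_neg, map_smul, map_sub, map_smul, h2, h2]
  rfl

/-- Rescaling a smooth field of tame endomorphisms gives a compatible complex structure. -/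
theorem exists_compatible (hlam : IsContactForm lam) {B : M → E3 →L[ℝ] E3}
    (hs : ∀ r, IsSmoothEndoAt B r) (ht : ∀ r, IsTame lam r (B r)) :
    ∃ j : ∀ p : M, TangentSpace (𝓡 3) p →L[ℝ] TangentSpace (𝓡 3) p,
      IsCompatible lam (reeb lam) j ∧
      ∀ r, (∀ v, rawF lam r v = 0 → B r (B r v) = -v) → ∀ v : E3, (j r v : E3) = B r v := by
  choose d hd hsq using fun r => (ht r).exists_sq hlam
  set B' : M → E3 →L[ℝ] E3 := fun r => (√(d r))⁻¹ • B r with hB'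
  have hg0 : ∀ r, 0 < (√(d r))⁻¹ := fun r => inv_pos.2 (Real.sqrt_pos.2 (hd r))
  have ht' : ∀ r, IsTame lam r (B' r) := fun r => (ht r).smul (hg0 r)
  have hsq' : ∀ r v, rawF lam r v = 0 → B' r (B' r v) = -v := by
    intro r v hv
    have h1 : B' r (B' r v) = ((√(d r))⁻¹ * (√(d r))⁻¹) • B r (B r v) := by
      simp only [hB', smul_apply, map_smul, smul_smul]
    rw [h1, hsq r v hv, ← mul_inv, Real.mul_self_sqrt (hd r).le, smul_neg, smul_smul,
      inv_mul_cancel₀ (hd r).ne', one_smul]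
  -- the scaling factor is smooth, as it is given by a trace
  have hds : ∀ p, ∀ y ∈ (extChartAt (𝓡 3) p).target,
      ContDiffAt ℝ ∞ (fun y => d ((extChartAt (𝓡 3) p).symm y)) y := by
    intro p y hy
    have hβ : ContDiffAt ℝ ∞ (rawEndo B p) y := by
      have := hs _ p ((extChartAt (𝓡 3) p).map_target hy)
      rwa [(extChartAt (𝓡 3) p).right_inv hy] at this
    have h1 : ∀ i : Fin 3, ContDiffAt ℝ ∞
        (fun y => (rawEndo B p y (rawEndo B p y (eb i))) i) y := by
      intro i
      have h2 : ContDiffAt ℝ ∞ (fun y => rawEndo B p y (rawEndo B p y (eb i))) y :=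
        hβ.clm_apply (hβ.clm_apply contDiffAt_const)
      exact (EuclideanSpace.proj i : E3 →L[ℝ] ℝ).contDiff.contDiffAt.comp y h2
    refine ((contDiffAt_const (c := (-1 / 2 : ℝ))).mul
      (((h1 0).add (h1 1)).add (h1 2))).congr_of_eventuallyEq ?_
    filter_upwards [(isOpen_chart_target p).mem_nhds hy] with y hy
    simp only [rawEndo_sq hlam hy (ht _) (hsq _)]
    have h3 := apply_reebVec (curl_formInChart_ne_zero hlam p hy)
    rw [clm_apply_eq (formInChart lam p y) (reebVec (formInChart lam p) y)] at h3
    simp only [smul_eq_mul] at h3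
    simp only [PiLp.neg_apply, PiLp.smul_apply, PiLp.sub_apply, smul_eq_mul, eb_apply, if_true]
    linear_combination (d ((extChartAt (𝓡 3) p).symm y) / 2) * h3
  refine ⟨fun r => B' r, ⟨?_, ?_, ?_, ?_, ?_, ?_⟩, ?_⟩
  · intro p y hy
    have hβ : ContDiffAt ℝ ∞ (rawEndo B p) y := by
      have := hs _ p ((extChartAt (𝓡 3) p).map_target hy)
      rwa [(extChartAt (𝓡 3) p).right_inv hy] at this
    have h1 : ContDiffAt ℝ ∞ (fun y => (√(d ((extChartAt (𝓡 3) p).symm y)))⁻¹) y :=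
      ((hds p y hy).sqrt (hd _).ne').inv (Real.sqrt_pos.2 (hd _)).ne'
    have h2 : ContDiffAt ℝ ∞ (rawEndo B' p) y := by
      rw [hB', rawEndo_smul (fun r => (√(d r))⁻¹) B p]
      exact h1.smul hβ
    exact h2.contDiffWithinAt
  · intro p
    exact (ht' p).map_reeb _ (isReebAt_reeb hlam p)
  · intro p v _
    exact (ht' p).apply v
  · intro p v hv
    exact hsq' p v hv
  · intro p v w hv hw
    have key : ∀ v w : E3, rawF lam p v = 0 → rawF lam p w = 0 →
        rawE lam p (B' p v) (B' p w) = rawE lam p v w := by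
      intro v w hv hw
      rw [(ht' p).symm _ _ ((ht' p).apply v) hw, hsq' p v hv, rawE_swap lam p v w]
      have := rawE_smul_right lam p (-1) w v
      rw [neg_one_smul] at this
      rw [this]; ring
    exact key v w hv hw
  · intro p v hv hv0
    exact (ht' p).pos v hv hv0
  · intro r hr v
    have h1 : d r = 1 := by
      obtain ⟨e, he, he0⟩ := exists_ker_ne_zero (rawF lam r)
      have h2 := (hsq r e he).symm.trans (hr e he)
      have h3 : (d r - 1) • e = 0 := by
        rw [sub_smul, one_smul, sub_eq_zero]
        exact neg_injective h2
      exact sub_eq_zero.1 ((smul_eq_zero.1 h3).resolve_right he0)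
    change (√(d r))⁻¹ • B r v = B r v
    rw [h1, Real.sqrt_one, inv_one, one_smul]

/-- A tame field of endomorphisms on the domain of the chart around `p`. -/
def chartEndo (lam : ∀ p : M, TangentSpace (𝓡 3) p →L[ℝ] ℝ) (p r : M) : E3 →L[ℝ] E3 :=
  (rawD (extChartAt (𝓡 3) p).symm (extChartAt (𝓡 3) p r)).comp
    ((crossEndo (formInChart lam p) (extChartAt (𝓡 3) p r)).comp (chD p r))

theorem chartEndo_symm (p : M) {y : E3} (hy : y ∈ (extChartAt (𝓡 3) p).target) (v : E3) :
    chartEndo lam p ((extChartAt (𝓡 3) p).symm y) (rawD (extChartAt (𝓡 3) p).symm y v) =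
      rawD (extChartAt (𝓡 3) p).symm y (crossEndo (formInChart lam p) y v) := by
  have h := chD_comp_rawD_symm p hy v
  have h2 : extChartAt (𝓡 3) p ((extChartAt (𝓡 3) p).symm y) = y := (extChartAt (𝓡 3) p).right_inv hy
  rw [chartEndo, ContinuousLinearMap.comp_apply, ContinuousLinearMap.comp_apply, h, h2]

theorem rawD_symm_bijective (p : M) {y : E3} (hy : y ∈ (extChartAt (𝓡 3) p).target) :
    Function.Bijective (rawD (extChartAt (𝓡 3) p).symm y) := by
  have h2 : extChartAt (𝓡 3) p ((extChartAt (𝓡 3) p).symm y) = y := (extChartAt (𝓡 3) p).right_inv hy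
  refine ⟨fun v w h => ?_, fun V => ⟨chD p ((extChartAt (𝓡 3) p).symm y) V, ?_⟩⟩
  · rw [← chD_comp_rawD_symm p hy v, h, chD_comp_rawD_symm p hy]
  · have := rawD_symm_comp_chD p ((extChartAt (𝓡 3) p).map_target hy) V
    rwa [h2] at this

theorem isSmoothEndoAt_chartEndo (hlam : IsContactForm lam) {p r : M}
    (hr : r ∈ (extChartAt (𝓡 3) p).source) : IsSmoothEndoAt (chartEndo lam p) r := by
  have hy := (extChartAt (𝓡 3) p).map_source hr
  have h := isSmoothEndoAt_of_param (ContinuousLinearEquiv.refl ℝ E3) (isOpen_chart_target p)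
    (fun y hy => (contMDiffAt_chart_symm p hy).contMDiffWithinAt) hy
    (rawD_symm_bijective p hy).1 (contDiffAt_crossEndo ((hlam.smooth p).contDiffAt
      ((isOpen_chart_target p).mem_nhds hy)) (curl_formInChart_ne_zero hlam p hy))
    (fun y hy v => chartEndo_symm (lam := lam) p hy v)
  rwa [(extChartAt (𝓡 3) p).left_inv hr] at h

theorem isTame_chartEndo (hlam : IsContactForm lam) {p r : M}
    (hr : r ∈ (extChartAt (𝓡 3) p).source) : IsTame lam r (chartEndo lam p r) := by
  have hy := (extChartAt (𝓡 3) p).map_source hr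
  have hl := (extChartAt (𝓡 3) p).left_inv hr
  set y := extChartAt (𝓡 3) p r with hyd
  set c := extChartAt (𝓡 3) p with hc
  have hbij := rawD_symm_bijective p hy
  have hne := curl_formInChart_ne_zero hlam p hy
  have hX := isReebAt_chart hlam p hy
  have hE := fun v w => dOne_pullForm hlam.smooth (contMDiffAt_chart_symm p hy) v w
  have hB := fun v => chartEndo_symm (lam := lam) p hy v
  rw [← hl]
  have hker : ∀ v, rawF lam (c.symm y) (rawD c.symm y v) = formInChart lam p y v := fun v => rfl
  refine ⟨?_, ?_, ?_, ?_⟩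
  · intro X hX'
    rw [hX'.unique hlam hX, hB, crossEndo_reebVec hne, map_zero]
  · intro v
    obtain ⟨v, rfl⟩ := hbij.2 v
    rw [hB, hker, apply_crossEndo]
  · intro v w hv hw
    obtain ⟨v, rfl⟩ := hbij.2 v
    obtain ⟨w, rfl⟩ := hbij.2 w
    rw [hB, hB, ← hE, ← hE]
    have h1 := dOne_crossEndo hne (v := v) (w := w) hv hw
    have h2 := dOne_crossEndo hne (v := w) (w := v) hw hv
    refine h1.trans (Eq.trans ?_ h2.symm)
    ring
  · intro v hv hv0
    obtain ⟨v, rfl⟩ := hbij.2 v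
    rw [hB, ← hE]
    have h1 := dOne_crossEndo hne (v := v) (w := v) hv hv
    refine lt_of_lt_of_eq ?_ h1.symm
    have hv1 : v ≠ 0 := by rintro rfl; exact hv0 (map_zero _)
    have h2 : 0 < ‖v‖ ^ 2 := by positivity
    rw [EuclideanSpace.norm_sq_eq, Fin.sum_univ_three] at h2
    simp only [Real.norm_eq_abs, sq_abs] at h2
    linarith

/-- Tame fields of endomorphisms are glued by partitions of unity. -/
theorem exists_tame [T2Space M] [CompactSpace M] (hlam : IsContactForm lam) {f₀ : M → ℝ}
    (hf₀ : ContMDiff (𝓡 3) 𝓘(ℝ, ℝ) ∞ f₀) (hf0 : ∀ r, 0 ≤ f₀ r) (hf1 : ∀ r, f₀ r ≤ 1)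
    {B₀ : M → E3 →L[ℝ] E3} (hs : ∀ r ∈ tsupport f₀, IsSmoothEndoAt B₀ r)
    (ht : ∀ r ∈ tsupport f₀, IsTame lam r (B₀ r)) :
    ∃ B : M → E3 →L[ℝ] E3, (∀ r, IsSmoothEndoAt B r) ∧ (∀ r, IsTame lam r (B r)) ∧
      ∀ r, f₀ r = 1 → B r = B₀ r := by
  classical
  have hb : ∀ p : M, ∃ f : SmoothBumpFunction (𝓡 3) p, True := fun p => by
    obtain ⟨f, -, -⟩ := (SmoothBumpFunction.nhds_basis_tsupport (I := 𝓡 3) p).mem_iff.1 univ_mem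
    exact ⟨f, trivial⟩
  choose f _ using hb
  obtain ⟨s, -, hcov⟩ := isCompact_univ.elim_nhds_subcover (fun p => {r | f p r = 1})
    (fun p _ => (f p).eventuallyEq_one)
  have hfs : ∀ p r, r ∈ tsupport (f p) → r ∈ (extChartAt (𝓡 3) p).source := fun p r hr => by
    rw [extChartAt_source]; exact (f p).tsupport_subset_chartAt_source hr
  set g : M → M → ℝ := fun p r => (1 - f₀ r) * f p r with hg
  have hgs : ∀ p, ContMDiff (𝓡 3) 𝓘(ℝ, ℝ) ∞ (g p) := fun p =>
    (contMDiff_const.sub hf₀).mul (f p).contMDiff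
  have hg0 : ∀ p r, 0 ≤ g p r := fun p r => mul_nonneg (sub_nonneg.2 (hf1 r)) (f p).nonneg
  have hgsupp : ∀ p r, g p r ≠ 0 → r ∈ (extChartAt (𝓡 3) p).source := fun p r h =>
    hfs p r (subset_tsupport _ (right_ne_zero_of_mul h))
  have hw : ∀ p r, IsWeaklyTame lam r (g p r • chartEndo lam p r) := fun p r =>
    IsTame.weakly_smul (hg0 p r) fun h => isTame_chartEndo hlam (hgsupp p r h)
  have hw0 : ∀ r, IsWeaklyTame lam r (f₀ r • B₀ r) := fun r =>
    IsTame.weakly_smul (hf0 r) fun h => ht r (subset_tsupport _ h)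
  refine ⟨fun r => f₀ r • B₀ r + ∑ p ∈ s, g p r • chartEndo lam p r, ?_, ?_, ?_⟩
  · intro r
    refine (IsSmoothEndoAt.smul hf₀ (hs r)).add (IsSmoothEndoAt.sum fun p _ => ?_)
    refine IsSmoothEndoAt.smul (hgs p) fun hr => isSmoothEndoAt_chartEndo hlam (hfs p r ?_)
    exact tsupport_mul_subset_right hr
  · intro r
    by_cases h0 : f₀ r = 0
    · obtain ⟨p, hp, hpr⟩ := mem_iUnion₂.1 (hcov (mem_univ r))
      have h1 : g p r = 1 := by
        have : f p r = 1 := hpr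
        simp [hg, h0, this]
      have h2 : IsTame lam r (g p r • chartEndo lam p r) :=
        (isTame_chartEndo hlam (hgsupp p r (by rw [h1]; exact one_ne_zero))).smul
          (by rw [h1]; exact one_pos)
      have h3 := h2.add_weakly ((hw0 r).add (isWeaklyTame_sum (s := s.erase p) fun p _ => hw p r))
      have h4 : f₀ r • B₀ r + ∑ p ∈ s, g p r • chartEndo lam p r = g p r • chartEndo lam p r +
          (f₀ r • B₀ r + ∑ i ∈ s.erase p, g i r • chartEndo lam i r) := by
        rw [← Finset.add_sum_erase s (fun p => g p r • chartEndo lam p r) hp]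
        abel
      change IsTame lam r (f₀ r • B₀ r + ∑ p ∈ s, g p r • chartEndo lam p r)
      rw [h4]
      exact h3
    · exact ((ht r (subset_tsupport _ h0)).smul (lt_of_le_of_ne (hf0 r) (Ne.symm h0))).add_weakly
        (isWeaklyTame_sum fun p _ => hw p r)
  · intro r hr
    refine ContinuousLinearMap.ext fun v => ?_
    simp [hg, hr, sum_apply]

end Compatible

/-! ### The almost complex structure on the torsion domain -/

section PureRegion

theorem mem_middle {δ θ : ℝ} (hδ : δ < 1 / 32) (hθ : θ ∈ Icc (1 / 8 : ℝ) (7 / 8)) :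
    θ ∈ Ioo (4 * δ) (1 - 4 * δ) := ⟨by linarith [hθ.1], by linarith [hθ.2]⟩

theorem mem_pure {δ θ : ℝ} (hδ0 : 0 < δ) (hδ : δ < 1 / 32) (hθ : θ ∈ Icc (1 / 8 : ℝ) (7 / 8)) :
    θ ∈ Ioo δ (1 - δ) := ⟨by linarith [hθ.1], by linarith [hθ.2]⟩

theorem deriv_weight_eq_zero {ε δ θ : ℝ} (hδ0 : 0 < δ) (hθ : θ ∈ Ioo (4 * δ) (1 - 4 * δ)) :
    deriv (weight ε δ) θ = 0 := by
  rw [deriv_weight, deriv_cutoff_eq_zero (by linarith) hθ, mul_zero]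

theorem velX_eq {ε δ θ : ℝ} (hδ0 : 0 < δ) (hθ : θ ∈ Ioo (4 * δ) (1 - 4 * δ)) :
    velX ε δ θ = Real.cos (2 * Real.pi * θ) * prof ε δ θ := by
  rw [velX, deriv_weight_eq_zero hδ0 hθ]; ring

theorem velY_eq {ε δ θ : ℝ} (hδ0 : 0 < δ) (hθ : θ ∈ Ioo (4 * δ) (1 - 4 * δ)) :
    velY ε δ θ = (ε ^ 2)⁻¹ * Real.sin (2 * Real.pi * θ) * prof ε δ θ := by
  rw [velY, deriv_weight_eq_zero hδ0 hθ, weight_eq hδ0 (Ioo_subset_Icc_self hθ)]; ring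

theorem prof_sq {ε : ℝ} (hε : 0 < ε) (hε1 : ε ≤ 1) {δ θ : ℝ} (hδ0 : 0 < δ)
    (hθ : θ ∈ Ioo (4 * δ) (1 - 4 * δ)) : prof ε δ θ ^ 2 *
      (Real.cos (2 * Real.pi * θ) ^ 2 + (ε ^ 2)⁻¹ * Real.sin (2 * Real.pi * θ) ^ 2) = 1 := by
  have hQ := one_pos.trans_le (one_le_quad hε hε1 δ θ)
  rw [← weight_eq hδ0 (Ioo_subset_Icc_self hθ), ← quad, prof, inv_pow, Real.sq_sqrt hQ.le,
    inv_mul_cancel₀ hQ.ne']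

/-- The almost complex structure in the pure region, in coordinates: on the contact plane, which is
spanned by `∂_θ` and `e = - sin (2πθ) ∂_x + cos (2πθ) ∂_y`, it maps `∂_θ` to `(ρ³ / ε) e`. -/
def pureEndo (ε δ : ℝ) (q : T3) : T3 →L[ℝ] T3 :=
  (prof ε δ q.2.2 ^ 3 / ε) • ((ContinuousLinearMap.snd ℝ ℝ ℝ).comp
    (ContinuousLinearMap.snd ℝ ℝ (ℝ × ℝ))).smulRight
      (-Real.sin (2 * Real.pi * q.2.2), Real.cos (2 * Real.pi * q.2.2), (0 : ℝ)) -
  (ε * (prof ε δ q.2.2)⁻¹) • (Real.cos (2 * Real.pi * q.2.2) •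
      ((ContinuousLinearMap.fst ℝ ℝ ℝ).comp (ContinuousLinearMap.snd ℝ ℝ (ℝ × ℝ))) -
    ((ε ^ 2)⁻¹ * Real.sin (2 * Real.pi * q.2.2)) • ContinuousLinearMap.fst ℝ ℝ (ℝ × ℝ)).smulRight
      ((0 : ℝ), (0 : ℝ), (1 : ℝ))

theorem pureEndo_apply (ε δ : ℝ) (q v : T3) : pureEndo ε δ q v =
    (-(prof ε δ q.2.2 ^ 3 / ε * v.2.2 * Real.sin (2 * Real.pi * q.2.2)),
      prof ε δ q.2.2 ^ 3 / ε * v.2.2 * Real.cos (2 * Real.pi * q.2.2),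
      -(ε * (prof ε δ q.2.2)⁻¹ * (Real.cos (2 * Real.pi * q.2.2) * v.2.1 -
        (ε ^ 2)⁻¹ * Real.sin (2 * Real.pi * q.2.2) * v.1))) := by
  ext <;> simp [pureEndo] <;> ring

theorem contDiff_pureEndo {ε : ℝ} (hε : 0 < ε) (hε1 : ε ≤ 1) (δ : ℝ) :
    ContDiff ℝ ∞ (pureEndo ε δ) := by
  have h : ContDiff ℝ ∞ fun q : T3 => prof ε δ q.2.2 := (contDiff_prof hε hε1 δ).comp (by fun_prop)
  have hi : ContDiff ℝ ∞ fun q : T3 => (prof ε δ q.2.2)⁻¹ := h.inv fun q =>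
    (prof_pos hε hε1 δ _).ne'
  have hc : ContDiff ℝ ∞ fun q : T3 => Real.cos (2 * Real.pi * q.2.2) := by fun_prop
  have hs : ContDiff ℝ ∞ fun q : T3 => Real.sin (2 * Real.pi * q.2.2) := by fun_prop
  refine ContDiff.sub ?_ ?_
  · exact ((h.pow 3).div_const ε).smul (contDiff_const.smulRight (by fun_prop))
  · exact (contDiff_const.mul hi).smul
      (((hc.smul contDiff_const).sub ((contDiff_const.mul hs).smul contDiff_const)).smulRight
        contDiff_const)

variable {M : Type*} [TopologicalSpace M] [ChartedSpace E3 M] [IsManifold (𝓡 3) ∞ M]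
variable {ξ : ∀ p : M, Submodule ℝ (TangentSpace (𝓡 3) p)} {F : T3 → M}
variable {lam : ∀ p : M, TangentSpace (𝓡 3) p →L[ℝ] ℝ} {ε δ : ℝ}

namespace IsAdapted

variable (hA : IsAdapted ξ F lam ε δ)
include hA

omit [IsManifold (𝓡 3) ∞ M] in
theorem rawF_rawD {q : T3} (hq : q.2.2 ∈ Ioo δ (1 - δ)) (v : T3) :
    rawF lam (F q) (rawD F q v) = prof ε δ q.2.2 * alpha q v := by
  rw [← rawW_eq_rawD (hA.mem_slabInt hq), hA.torsion.rawF_rawW hA.contact (hA.mem_slab hq),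
    hA.kappa_eq q (hA.mem_slab hq) hq]

omit [IsManifold (𝓡 3) ∞ M] in
theorem alpha_eq_zero_iff {q : T3} (hq : q.2.2 ∈ Ioo δ (1 - δ)) (v : T3) :
    rawF lam (F q) (rawD F q v) = 0 ↔ alpha q v = 0 := by
  rw [hA.rawF_rawD hq, mul_eq_zero, or_iff_right (prof_pos hA.eps_pos hA.eps_le_one _ _).ne']

theorem rawE_rawD {q : T3} (hq : q.2.2 ∈ Ioo δ (1 - δ)) {v w : T3} (hv : alpha q v = 0)
    (hw : alpha q w = 0) : rawE lam (F q) (rawD F q v) (rawD F q w) =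
      prof ε δ q.2.2 * (2 * Real.pi) * (v.2.2 * (-Real.sin (2 * Real.pi * q.2.2) * w.1 +
        Real.cos (2 * Real.pi * q.2.2) * w.2.1) - w.2.2 * (-Real.sin (2 * Real.pi * q.2.2) * v.1 +
        Real.cos (2 * Real.pi * q.2.2) * v.2.1)) := by
  have hi := hA.mem_slabInt hq
  have hP : DifferentiableAt ℝ (fun q : T3 => prof ε δ q.2.2) q :=
    ((contDiff_prof hA.eps_pos hA.eps_le_one δ).comp (by fun_prop) :
      ContDiff ℝ ∞ fun q : T3 => prof ε δ q.2.2).differentiable (by simp) q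
  have he : pullForm lam F =ᶠ[𝓝 q] fun q => prof ε δ q.2.2 • alpha q := by
    filter_upwards [isOpen_slabInt.mem_nhds hi, hA.kappa_eventuallyEq hq] with q' h1 h2
    rw [hA.torsion.pullForm_eq hA.contact h1, h2]
  rw [← dOne_pullForm hA.contact.1.smooth (hA.torsion.contMDiffAt hi), dOne, he.fderiv_eq, ← dOne,
    dOne_smul_alpha hP, hv, hw]
  ring

omit [IsManifold (𝓡 3) ∞ M] in
/-- The almost complex structure of the pure region is invariant under deck transformations. -/
theorem exists_pureField : ∃ B₀ : M → E3 →L[ℝ] E3, ∀ q ∈ slabInt, ∀ v,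
    B₀ (F q) (rawD F q v) = rawD F q (pureEndo ε δ q v) := by
  classical
  set P : M → (E3 →L[ℝ] E3) → Prop := fun r L =>
    ∃ q ∈ slabInt, F q = r ∧ ∀ v, L (rawD F q v) = rawD F q (pureEndo ε δ q v) with hP
  have hex : ∀ q ∈ slabInt, ∃ L, P (F q) L := by
    intro q hq
    set D : T3 ≃ₗ[ℝ] E3 := LinearEquiv.ofBijective (rawD F q : T3 →ₗ[ℝ] E3)
      ⟨hA.torsion.rawD_injective hq, hA.torsion.rawD_surjective hq⟩ with hD
    have hDv : ∀ v, D.symm (rawD F q v) = v := fun v => D.symm_apply_apply v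
    refine ⟨(rawD F q).comp ((pureEndo ε δ q).comp
      (LinearMap.toContinuousLinearMap (D.symm : E3 →ₗ[ℝ] T3))), q, hq, rfl, fun v => ?_⟩
    change rawD F q (pureEndo ε δ q (D.symm (rawD F q v))) = _
    rw [hDv]
  refine ⟨fun r => if h : ∃ L, P r L then h.choose else 0, fun q hq v => ?_⟩
  have h := hex q hq
  simp only [dif_pos h]
  obtain ⟨q', hq', he, hL⟩ := h.choose_spec
  obtain ⟨m, n, hmn⟩ := hA.torsion.exists_deck (slabInt_subset_slab hq) (slabInt_subset_slab hq')
    he.symm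
  rw [hmn, hA.torsion.rawD_deck m n hq] at hL
  exact hL v

/-- The almost complex structure of the pure region is tame. -/
theorem isTame_pureField [T2Space M] {B₀ : M → E3 →L[ℝ] E3}
    (hB : ∀ q ∈ slabInt, ∀ v, B₀ (F q) (rawD F q v) = rawD F q (pureEndo ε δ q v)) {q : T3}
    (hq : q.2.2 ∈ Icc (1 / 8 : ℝ) (7 / 8)) : IsTame lam (F q) (B₀ (F q)) := by
  have hp := mem_pure hA.del_pos hA.del_lt hq
  have hm := mem_middle hA.del_lt hq
  have hi := hA.mem_slabInt hp
  have hε := hA.eps_pos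
  have hρ := prof_pos hA.eps_pos hA.eps_le_one δ q.2.2
  have hsq := prof_sq hA.eps_pos hA.eps_le_one hA.del_pos hm
  have hcs := Real.cos_sq_add_sin_sq (2 * Real.pi * q.2.2)
  have hpi := Real.pi_pos
  have hsurj := hA.torsion.rawD_surjective hi
  have hα : ∀ v, alpha q (pureEndo ε δ q v) = 0 := by
    intro v
    rw [alpha_apply, pureEndo_apply]
    ring
  -- the angular coordinate of a vector in the contact plane
  have hcoef : ∀ v : T3, alpha q v = 0 → ∃ b, v = (-Real.sin (2 * Real.pi * q.2.2) * b,
      Real.cos (2 * Real.pi * q.2.2) * b, v.2.2) := by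
    intro v hv
    rw [alpha_apply] at hv
    refine ⟨-Real.sin (2 * Real.pi * q.2.2) * v.1 + Real.cos (2 * Real.pi * q.2.2) * v.2.1, ?_⟩
    ext
    · simp only
      linear_combination (-v.1) * hcs + Real.cos (2 * Real.pi * q.2.2) * hv
    · simp only
      linear_combination (-v.2.1) * hcs + Real.sin (2 * Real.pi * q.2.2) * hv
    · rfl
  have hform : ∀ v w : T3, alpha q v = 0 → alpha q w = 0 → ∀ b b' : ℝ,
      v = (-Real.sin (2 * Real.pi * q.2.2) * b, Real.cos (2 * Real.pi * q.2.2) * b, v.2.2) →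
      w = (-Real.sin (2 * Real.pi * q.2.2) * b', Real.cos (2 * Real.pi * q.2.2) * b', w.2.2) →
      rawE lam (F q) (rawD F q v) (rawD F q (pureEndo ε δ q w)) =
        2 * Real.pi * (prof ε δ q.2.2 ^ 4 / ε * (v.2.2 * w.2.2) +
          ε / prof ε δ q.2.2 ^ 2 * (b * b')) := by
    intro v w hv hw b b' hvb hwb
    rw [hA.rawE_rawD hp hv (hα w), pureEndo_apply, hvb, hwb]
    simp only
    set s := Real.sin (2 * Real.pi * q.2.2)
    set c := Real.cos (2 * Real.pi * q.2.2)
    set ρ := prof ε δ q.2.2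
    field_simp at hsq ⊢
    linear_combination (ρ ^ 6 * v.2.2 * w.2.2 + b * b' * ρ ^ 2 * (c ^ 2 * ε ^ 2 + s ^ 2)) * hcs +
      b * b' * hsq
  refine ⟨?_, ?_, ?_, ?_⟩
  · intro X hX
    have h1 : X = rawD F q (velX ε δ q.2.2, velY ε δ q.2.2, 0) := by
      rw [← hA.reeb_eq hp]
      exact hX.unique hA.contact.1 (isReebAt_reeb hA.contact.1 (F q))
    rw [h1, hB q hi, pureEndo_apply, velX_eq hA.del_pos hm, velY_eq hA.del_pos hm]
    simp only
    rw [show ((-(prof ε δ q.2.2 ^ 3 / ε * 0 * Real.sin (2 * Real.pi * q.2.2)),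
      prof ε δ q.2.2 ^ 3 / ε * 0 * Real.cos (2 * Real.pi * q.2.2),
      -(ε * (prof ε δ q.2.2)⁻¹ * (Real.cos (2 * Real.pi * q.2.2) *
        ((ε ^ 2)⁻¹ * Real.sin (2 * Real.pi * q.2.2) * prof ε δ q.2.2) -
        (ε ^ 2)⁻¹ * Real.sin (2 * Real.pi * q.2.2) *
          (Real.cos (2 * Real.pi * q.2.2) * prof ε δ q.2.2)))) : T3) = 0 from by
        ext
        · simp
        · simp
        · simp only [Prod.snd_zero]; ring]
    exact map_zero _
  · intro V
    obtain ⟨v, rfl⟩ := hsurj V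
    rw [hB q hi, hA.rawF_rawD hp, hα, mul_zero]
  · intro V W hV hW
    obtain ⟨v, rfl⟩ := hsurj V
    obtain ⟨w, rfl⟩ := hsurj W
    rw [hA.alpha_eq_zero_iff hp] at hV hW
    obtain ⟨b, hb⟩ := hcoef v hV
    obtain ⟨b', hb'⟩ := hcoef w hW
    rw [hB q hi, hB q hi, hform v w hV hW b b' hb hb', hform w v hW hV b' b hb' hb]
    ring
  · intro V hV hV0
    obtain ⟨v, rfl⟩ := hsurj V
    rw [hA.alpha_eq_zero_iff hp] at hV
    obtain ⟨b, hb⟩ := hcoef v hV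
    rw [hB q hi, hform v v hV hV b b hb hb]
    have hne : v.2.2 ≠ 0 ∨ b ≠ 0 := by
      by_contra hcon
      push Not at hcon
      apply hV0
      rw [hb, hcon.1, hcon.2]
      simp only [mul_zero]
      exact map_zero _
    have h1 : 0 < prof ε δ q.2.2 ^ 4 / ε := by positivity
    have h2 : 0 < ε / prof ε δ q.2.2 ^ 2 := by positivity
    refine mul_pos (by positivity) ?_
    rcases hne with h | h
    · have h3 := mul_pos h1 (mul_self_pos.2 h)
      have h4 := mul_nonneg h2.le (mul_self_nonneg b)
      linarith
    · have h3 := mul_nonneg h1.le (mul_self_nonneg v.2.2)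
      have h4 := mul_pos h2 (mul_self_pos.2 h)
      linarith

/-- There is a compatible complex structure with prescribed restriction to the middle part of the
torsion domain. -/
theorem exists_compatible [T2Space M] [CompactSpace M] :
    ∃ j : ∀ p : M, TangentSpace (𝓡 3) p →L[ℝ] TangentSpace (𝓡 3) p,
      IsCompatible lam (reeb lam) j ∧ ∀ q : T3, q.2.2 ∈ Icc (1 / 4 : ℝ) (3 / 4) → ∀ v : T3,
        (j (F q) (rawD F q v) : E3) = rawD F q (pureEndo ε δ q v) := by
  obtain ⟨B₀, hB₀⟩ := hA.exists_pureField
  obtain ⟨f₀, hf₀, hfF, hf1⟩ := hA.torsion.exists_smooth_extension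
    (k := fun q : T3 => cutoff (1 / 4) q.2.2) (a := 0) (η := 1 / 8)
    (((contDiff_cutoff _).comp (by fun_prop)).contDiffOn) (fun m n q _ => rfl) (by norm_num)
    (fun q _ hθ => cutoff_eq_zero (by norm_num) (by
      rw [mem_Icc, not_and_or, not_le, not_le] at hθ
      rcases hθ with h | h
      · left; linarith
      · right; linarith))
  set K : Set M := F '' {q | q.2.2 ∈ Icc (1 / 8 : ℝ) (1 - 1 / 8)} with hK
  have hKc : IsClosed K := (hA.torsion.isCompact_image isCompact_Icc
    (fun t ht => ⟨by linarith [ht.1], by linarith [ht.2]⟩)).isClosed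
  have hsupp : tsupport f₀ ⊆ K := closure_minimal (fun r hr => by
    by_contra h; exact hr (hf1 r h)) hKc
  have hrange : ∀ r, 0 ≤ f₀ r ∧ f₀ r ≤ 1 := by
    intro r
    by_cases hr : r ∈ K
    · obtain ⟨q, hq, rfl⟩ := hr
      rw [hfF q ⟨by linarith [hq.1], by linarith [hq.2]⟩]
      exact ⟨cutoff_nonneg _ _, cutoff_le_one _ _⟩
    · rw [hf1 r hr]; simp
  have hmid : ∀ r ∈ tsupport f₀, ∃ q : T3, q.2.2 ∈ Icc (1 / 8 : ℝ) (7 / 8) ∧ F q = r := by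
    intro r hr
    obtain ⟨q, hq, h⟩ := hsupp hr
    exact ⟨q, ⟨hq.1, by linarith [hq.2]⟩, h⟩
  obtain ⟨B, hBs, hBt, hB1⟩ := exists_tame hA.contact.1 hf₀ (fun r => (hrange r).1)
    (fun r => (hrange r).2) (B₀ := B₀) (fun r hr => by
      obtain ⟨q, hq, rfl⟩ := hmid r hr
      have hi := hA.mem_slabInt (mem_pure hA.del_pos hA.del_lt hq)
      exact isSmoothEndoAt_of_param toT3 isOpen_slabInt hA.torsion.contMDiffOn_slabInt hi
        (hA.torsion.rawD_injective hi)
        (contDiff_pureEndo hA.eps_pos hA.eps_le_one δ).contDiffAt hB₀) (fun r hr => by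
      obtain ⟨q, hq, rfl⟩ := hmid r hr
      exact hA.isTame_pureField hB₀ hq)
  obtain ⟨j, hj, hjB⟩ := ContactThree.exists_compatible hA.contact.1 hBs hBt
  refine ⟨j, hj, fun q hq v => ?_⟩
  have hq8 : q.2.2 ∈ Icc (1 / 8 : ℝ) (7 / 8) := ⟨by linarith [hq.1], by linarith [hq.2]⟩
  have hp := mem_pure hA.del_pos hA.del_lt hq8
  have hi := hA.mem_slabInt hp
  have h1 : f₀ (F q) = 1 := by
    rw [hfF q (hA.mem_slab hp)]
    exact cutoff_eq_one (by norm_num) ⟨hq.1, by linarith [hq.2]⟩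
  have h2 := hB1 _ h1
  rw [hjB (F q) ?_ (rawD F q v), h2, hB₀ q hi]
  intro V hV
  obtain ⟨w, rfl⟩ := hA.torsion.rawD_surjective hi V
  rw [hA.alpha_eq_zero_iff hp, alpha_apply] at hV
  rw [h2, hB₀ q hi, hB₀ q hi, ← map_neg]
  congr 1
  have hε := hA.eps_pos.ne'
  have hρ := (prof_pos hA.eps_pos hA.eps_le_one δ q.2.2).ne'
  have hsq := prof_sq hA.eps_pos hA.eps_le_one hA.del_pos (mem_middle hA.del_lt hq8)
  have hcs := Real.cos_sq_add_sin_sq (2 * Real.pi * q.2.2)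
  rw [pureEndo_apply, pureEndo_apply]
  set s := Real.sin (2 * Real.pi * q.2.2)
  set c := Real.cos (2 * Real.pi * q.2.2)
  set ρ := prof ε δ q.2.2
  have h3 : ε * ρ⁻¹ * (ρ ^ 3 / ε) = ρ ^ 2 := by field_simp
  set i := (ε ^ 2)⁻¹
  ext
  · simp only [Prod.fst_neg]
    linear_combination ρ ^ 2 * c * hV - w.1 * hsq + (c * w.2.1 - i * s * w.1) * s * h3
  · simp only [Prod.snd_neg, Prod.fst_neg]
    linear_combination (-w.2.1) * hsq + ρ ^ 2 * i * s * hV - (c * w.2.1 - i * s * w.1) * c * h3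
  · simp only [Prod.snd_neg]
    linear_combination (-w.2.2) * hsq - w.2.2 * (c ^ 2 + i * s ^ 2) * h3

end IsAdapted
end PureRegion

/-! ### The Morse-Bott tori -/

section CriticalTori

/-- The two values of `θ` at which `dg` vanishes, so that the Reeb field is vertical. -/
def crit (i : Fin 2) : ℝ := if i = 0 then 1 / 4 else 3 / 4

/-- The direction of the Reeb field at the critical tori: `sin (2πθ)`. -/
def sgn (i : Fin 2) : ℝ := if i = 0 then 1 else -1

theorem crit_mem (i : Fin 2) : crit i ∈ Icc (1 / 4 : ℝ) (3 / 4) := by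
  fin_cases i <;> norm_num [crit]

theorem crit_mem' (i : Fin 2) : crit i ∈ Icc (1 / 8 : ℝ) (7 / 8) :=
  ⟨by linarith [(crit_mem i).1], by linarith [(crit_mem i).2]⟩

theorem cos_crit (i : Fin 2) : Real.cos (2 * Real.pi * crit i) = 0 := by
  refine (cos_eq_zero_iff_of_mem ⟨?_, ?_⟩).2 ?_
  · linarith [(crit_mem i).1]
  · linarith [(crit_mem i).2]
  · fin_cases i <;> simp [crit]

theorem sin_crit (i : Fin 2) : Real.sin (2 * Real.pi * crit i) = sgn i := by
  fin_cases i
  · simp only [crit, sgn]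
    norm_num
    rw [show 2 * Real.pi * (1 / 4) = Real.pi / 2 by ring, Real.sin_pi_div_two]
  · simp only [crit, sgn]
    norm_num
    rw [show 2 * Real.pi * (3 / 4) = Real.pi / 2 + Real.pi by ring, Real.sin_add_pi,
      Real.sin_pi_div_two]

theorem sgn_mul_self (i : Fin 2) : sgn i * sgn i = 1 := by
  fin_cases i <;> simp [sgn]

theorem crit_injective : Function.Injective crit := by
  intro i k h
  fin_cases i <;> fin_cases k
  · rfl
  · norm_num [crit] at h
  · norm_num [crit] at h
  · rfl

variable {M : Type*} [TopologicalSpace M] [ChartedSpace E3 M] [IsManifold (𝓡 3) ∞ M]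
variable {ξ : ∀ p : M, Submodule ℝ (TangentSpace (𝓡 3) p)} {F : T3 → M}
variable {lam : ∀ p : M, TangentSpace (𝓡 3) p →L[ℝ] ℝ} {ε δ : ℝ}

theorem hasFDerivAt_shift (a q : T3) :
    HasFDerivAt (fun q : T3 => q + a) (ContinuousLinearMap.id ℝ T3) q :=
  (hasFDerivAt_id q).add_const a

/-- The inverse of `F` in affine coordinates is a chart. -/
theorem IsTorsionMap.exists_shifted_chart (hF : IsTorsionMap ξ F) (A : E3 ≃L[ℝ] T3) (a : T3) {q₀ : T3} (hq₀ : q₀ ∈ slabInt)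
    {W : Set T3} (hW : W ∈ 𝓝 q₀) :
    ∃ e ∈ IsManifold.maximalAtlas (𝓡 3) ∞ M, F q₀ ∈ e.source ∧
      (∀ r ∈ e.source, ∃ q ∈ W ∩ slabInt, F q = r ∧ e r = A.symm (q - a) ∧
        ∀ᶠ q' in 𝓝 q, F q' ∈ e.source ∧ e (F q') = A.symm (q' - a)) ∧
      e (F q₀) = A.symm (q₀ - a) := by
  obtain ⟨W', hW'W, hW'o, hq₀W'⟩ := mem_nhds_iff.1 hW
  set G : T3 → M := fun q => F (q + a) with hG
  set Ω : Set T3 := (fun q => q + a) ⁻¹' (W' ∩ slabInt) with hΩ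
  have hsc : Continuous fun q : T3 => q + a := by fun_prop
  have hsd : ContDiff ℝ ∞ fun q : T3 => q + a := by fun_prop
  have hΩo : IsOpen Ω := (hW'o.inter isOpen_slabInt).preimage hsc
  have hGs : ContMDiffOn 𝓘(ℝ, T3) (𝓡 3) ∞ G Ω := fun q hq =>
    ((hF.contMDiffAt hq.2).comp q hsd.contMDiff.contMDiffAt).contMDiffWithinAt
  have hq : q₀ - a + a = q₀ := sub_add_cancel _ _
  have hq₀Ω : q₀ - a ∈ Ω := by
    change q₀ - a + a ∈ W' ∩ slabInt
    rw [hq]; exact ⟨hq₀W', hq₀⟩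
  have hinj : Function.Injective (rawD G (q₀ - a)) := by
    have h1 : MDifferentiableAt 𝓘(ℝ, T3) (𝓡 3) F (q₀ - a + a) := by
      rw [hq]; exact (hF.contMDiffAt hq₀).mdifferentiableAt (by simp)
    have h2 := mfderiv_comp (q₀ - a) h1 (hasFDerivAt_shift a (q₀ - a)).differentiableAt.mdifferentiableAt
    rw [mfderiv_eq_fderiv, (hasFDerivAt_shift a (q₀ - a)).fderiv] at h2
    have h3 : rawD G (q₀ - a) = rawD F (q₀ - a + a) := h2
    rw [h3, hq]
    exact hF.rawD_injective hq₀
  obtain ⟨e, he, h1, h2⟩ := exists_chart_of_immersion A hΩo hGs hq₀Ω hinj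
  have hev : ∀ q : T3, A.symm (q - a) ∈ e.target → F q ∈ e.source ∧ e (F q) = A.symm (q - a) := by
    intro q hqt
    have h3 : e.symm (A.symm (q - a)) = F q := by
      rw [(h2 _ hqt).2, A.apply_symm_apply]
      change F (q - a + a) = F q
      rw [sub_add_cancel]
    rw [← h3]
    exact ⟨e.map_target hqt, e.right_inv hqt⟩
  refine ⟨e, he, (hev q₀ h1).1, fun r hr => ?_, (hev q₀ h1).2⟩
  have h3 := h2 (e r) (e.map_source hr)
  rw [e.left_inv hr] at h3
  have h4 : e r = A.symm (A (e r) + a - a) := by rw [add_sub_cancel_right, A.symm_apply_apply]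
  refine ⟨A (e r) + a, ⟨hW'W h3.1.1, h3.1.2⟩, h3.2.symm, h4, ?_⟩
  have hc : Continuous fun q : T3 => A.symm (q - a) := A.symm.continuous.comp (by fun_prop)
  have h5 : ∀ᶠ q' in 𝓝 (A (e r) + a), A.symm (q' - a) ∈ e.target :=
    hc.continuousAt.eventually (e.open_target.mem_nhds (by
      change A.symm (A (e r) + a - a) ∈ e.target
      rw [← h4]; exact e.map_source hr))
  exact h5.mono hev

omit [IsManifold (𝓡 3) ∞ M] in
/-- In an affine chart, the differential of `F` is constant. -/
theorem IsTorsionMap.chartD_rawD (hF : IsTorsionMap ξ F) {A : E3 ≃L[ℝ] T3} {a q : T3} (hq : q ∈ slabInt)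
    {e : OpenPartialHomeomorph M E3} (he : e ∈ IsManifold.maximalAtlas (𝓡 3) ∞ M)
    (hev : ∀ᶠ q' in 𝓝 q, F q' ∈ e.source ∧ e (F q') = A.symm (q' - a)) (v : T3) :
    chartD e (F q) (rawD F q v) = A.symm v := by
  have h1 : MDifferentiableAt (𝓡 3) 𝓘(ℝ, E3) e (F q) :=
    (contMDiffAt_of_mem_maximalAtlas he hev.self_of_nhds.1).mdifferentiableAt (by simp)
  have h2 := mfderiv_comp q h1 ((hF.contMDiffAt hq).mdifferentiableAt (by simp))
  have h3 : e ∘ F =ᶠ[𝓝 q] fun q' => A.symm (q' - a) := hev.mono fun q' h => h.2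
  have h4 : HasFDerivAt (fun q' => A.symm (q' - a)) (A.symm : T3 →L[ℝ] E3) q :=
    (A.symm : T3 →L[ℝ] E3).hasFDerivAt.comp (f := fun q' : T3 => q' - a)
      (f' := ContinuousLinearMap.id ℝ T3) q ((hasFDerivAt_id q).sub_const a)
  rw [mfderiv_eq_fderiv, h3.fderiv_eq, h4.fderiv] at h2
  exact (congrArg (fun L : T3 →L[ℝ] E3 => L v) h2).symm

namespace IsAdapted

variable (hA : IsAdapted ξ F lam ε δ)
include hA

omit [IsManifold (𝓡 3) ∞ M] in
theorem prof_crit (i : Fin 2) : prof ε δ (crit i) = ε := by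
  have h := prof_sq hA.eps_pos hA.eps_le_one hA.del_pos (mem_middle hA.del_lt (crit_mem' i))
  have hp := prof_pos hA.eps_pos hA.eps_le_one δ (crit i)
  have hε := hA.eps_pos
  rw [cos_crit, sin_crit, pow_two (sgn i), sgn_mul_self] at h
  have h1 : prof ε δ (crit i) ^ 2 = ε ^ 2 := by
    field_simp at h
    linarith
  exact (pow_left_inj₀ hp.le hε.le two_ne_zero).1 h1

omit [IsManifold (𝓡 3) ∞ M] in
theorem velX_crit (i : Fin 2) : velX ε δ (crit i) = 0 := by
  rw [velX_eq hA.del_pos (mem_middle hA.del_lt (crit_mem' i)), cos_crit, zero_mul]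

omit [IsManifold (𝓡 3) ∞ M] in
theorem velY_crit (i : Fin 2) : velY ε δ (crit i) = sgn i / ε := by
  rw [velY_eq hA.del_pos (mem_middle hA.del_lt (crit_mem' i)), sin_crit, hA.prof_crit]
  have := hA.eps_pos.ne'
  field_simp

omit [IsManifold (𝓡 3) ∞ M] in
theorem flowLine_crit (i : Fin 2) (t : ℝ) {q : T3} (hq : q.2.2 = crit i) :
    flowLine ε δ t q = (q.1, q.2.1 + t * (sgn i / ε), q.2.2) := by
  rw [flowLine, hq, hA.velX_crit, hA.velY_crit, mul_zero, add_zero]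

omit [IsManifold (𝓡 3) ∞ M] in
/-- The horizontal velocity has nonzero derivative at the critical tori: they are Morse-Bott. -/
theorem exists_hasDerivAt_velX (i : Fin 2) :
    ∃ d ≠ (0 : ℝ), HasDerivAt (velX ε δ) d (crit i) := by
  have hm := mem_middle hA.del_lt (crit_mem' i)
  have h0 : HasDerivAt (fun θ : ℝ => 2 * Real.pi * θ) (2 * Real.pi) (crit i) := by
    simpa using (hasDerivAt_id (crit i)).const_mul (2 * Real.pi)
  have h1 := h0.cos.mul (hasDerivAt_prof hA.eps_pos hA.eps_le_one δ (crit i))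
  have h2 : velX ε δ =ᶠ[𝓝 (crit i)] fun θ => Real.cos (2 * Real.pi * θ) * prof ε δ θ := by
    filter_upwards [isOpen_Ioo.mem_nhds hm] with θ hθ
    exact velX_eq hA.del_pos hθ
  refine ⟨_, ?_, h1.congr_of_eventuallyEq h2⟩
  rw [cos_crit, sin_crit, hA.prof_crit]
  have h3 := sgn_mul_self i
  have h4 : sgn i ≠ 0 := by intro h; rw [h] at h3; norm_num at h3
  have := hA.eps_pos.ne'
  have := Real.pi_pos.ne'
  simp
  exact ⟨h4, by assumption⟩

omit [IsManifold (𝓡 3) ∞ M] in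
theorem differentiableAt_velY (i : Fin 2) : DifferentiableAt ℝ (velY ε δ) (crit i) := by
  have hm := mem_middle hA.del_lt (crit_mem' i)
  have h1 : DifferentiableAt ℝ (fun θ => (ε ^ 2)⁻¹ * Real.sin (2 * Real.pi * θ) * prof ε δ θ)
      (crit i) := by
    have := (hasDerivAt_prof hA.eps_pos hA.eps_le_one δ (crit i)).differentiableAt
    fun_prop
  refine h1.congr_of_eventuallyEq ?_
  filter_upwards [isOpen_Ioo.mem_nhds hm] with θ hθ
  exact velY_eq hA.del_pos hθ

variable [T2Space M]

/-- The linearized Reeb flow, in the coordinates of the thickened torus. -/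
theorem linFlow_rawD {φ : ℝ → M → M} (hφ : IsFlowOf (reeb lam) φ) {q : T3}
    (hq : q.2.2 ∈ Ioo δ (1 - δ)) (t : ℝ) {L : T3 →L[ℝ] T3} (hL : HasFDerivAt (flowLine ε δ t) L q)
    (v : T3) : (linFlow φ t (F q) (rawD F q v) : E3) = rawD F (flowLine ε δ t q) (L v) := by
  have hi := hA.mem_slabInt hq
  have hq' : (flowLine ε δ t q).2.2 ∈ Ioo δ (1 - δ) := hq
  obtain ⟨e, he, hs, hes, he0⟩ := hA.torsion.exists_shifted_chart toT3 0 hi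
    (W := {q | q.2.2 ∈ Ioo δ (1 - δ)})
    ((isOpen_Ioo.preimage (continuous_snd.comp continuous_snd)).mem_nhds hq)
  have hFl : MDifferentiableAt 𝓘(ℝ, T3) (𝓡 3) F (flowLine ε δ t q) :=
    (hA.torsion.contMDiffAt (hA.mem_slabInt hq')).mdifferentiableAt (by simp)
  have hFq : MDifferentiableAt 𝓘(ℝ, T3) (𝓡 3) F q :=
    (hA.torsion.contMDiffAt hi).mdifferentiableAt (by simp)
  -- the flow is differentiable, as `F` has a local inverse
  have h1 : φ t =ᶠ[𝓝 (F q)] (F ∘ flowLine ε δ t) ∘ fun r => toT3 (e r) := by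
    filter_upwards [e.open_source.mem_nhds hs] with r hr
    obtain ⟨q', hq', hr', her, -⟩ := hes r hr
    simp only [Function.comp_apply]
    rw [her, sub_zero, toT3.apply_symm_apply, ← hr', hA.flow_eq hφ hq'.1]
  have hx : toT3 (e (F q)) = q := by rw [he0, sub_zero, toT3.apply_symm_apply]
  have h2 : MDifferentiableAt 𝓘(ℝ, T3) (𝓡 3) (F ∘ flowLine ε δ t) q :=
    hFl.comp q hL.differentiableAt.mdifferentiableAt
  have h3 : MDifferentiableAt (𝓡 3) 𝓘(ℝ, T3) (fun r => toT3 (e r)) (F q) := by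
    have h4 : MDifferentiableAt (𝓡 3) 𝓘(ℝ, E3) e (F q) :=
      (contMDiffAt_of_mem_maximalAtlas he hs).mdifferentiableAt (by simp)
    exact (toT3.differentiableAt.mdifferentiableAt).comp (F q) h4
  have h5 : MDifferentiableAt (𝓡 3) (𝓡 3) (φ t) (F q) := by
    refine MDifferentiableAt.congr_of_eventuallyEq ?_ h1
    refine MDifferentiableAt.comp (F q) ?_ h3
    rw [hx]; exact h2
  have h6 : φ t ∘ F =ᶠ[𝓝 q] F ∘ flowLine ε δ t := by
    filter_upwards [(isOpen_Ioo.preimage (continuous_snd.comp continuous_snd)).mem_nhds hq] with q' h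
    exact hA.flow_eq hφ h t
  have h7 := h6.mfderiv_eq (I := 𝓘(ℝ, T3)) (I' := 𝓡 3)
  have h8 := mfderiv_comp q hFl hL.differentiableAt.mdifferentiableAt
  rw [mfderiv_eq_fderiv, hL.fderiv] at h8
  have h9 := mfderiv_comp q h5 hFq
  exact congrArg (fun L : T3 →L[ℝ] E3 => L v) (h9.symm.trans (h7.trans h8))

/-- At the critical tori, the vectors fixed by the linearized flow are the tangent vectors. -/
theorem isFixedVector_iff {φ : ℝ → M → M} (hφ : IsFlowOf (reeb lam) φ) (i : Fin 2) {q : T3}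
    (hq : q.2.2 = crit i) (v : T3) : IsFixedVector φ ε (F q) (rawD F q v) ↔ v.2.2 = 0 := by
  obtain ⟨d, hd0, hd⟩ := hA.exists_hasDerivAt_velX i
  obtain ⟨d', hd'⟩ : ∃ d', HasDerivAt (velY ε δ) d' (crit i) :=
    ⟨_, (hA.differentiableAt_velY i).hasDerivAt⟩
  have hp : q.2.2 ∈ Ioo δ (1 - δ) := by
    rw [hq]; exact mem_pure hA.del_pos hA.del_lt (crit_mem' i)
  have hi := hA.mem_slabInt hp
  rw [← hq] at hd hd'
  set π₁ := ContinuousLinearMap.fst ℝ ℝ (ℝ × ℝ)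
  set π₂ := (ContinuousLinearMap.fst ℝ ℝ ℝ).comp (ContinuousLinearMap.snd ℝ ℝ (ℝ × ℝ))
  set π₃ := (ContinuousLinearMap.snd ℝ ℝ ℝ).comp (ContinuousLinearMap.snd ℝ ℝ (ℝ × ℝ))
  have h3 : HasFDerivAt (fun q : T3 => q.2.2) π₃ q := π₃.hasFDerivAt
  have hL : HasFDerivAt (flowLine ε δ ε) ((π₁ + ε • d • π₃).prod ((π₂ + ε • d' • π₃).prod π₃)) q :=
    (π₁.hasFDerivAt.add ((HasDerivAt.comp_hasFDerivAt (h₂ := velX ε δ) q hd h3).const_mul ε)).prodMk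
      ((π₂.hasFDerivAt.add ((HasDerivAt.comp_hasFDerivAt (h₂ := velY ε δ) q hd' h3).const_mul
        ε)).prodMk h3)
  have hε := hA.eps_pos.ne'
  obtain ⟨n, hn⟩ : ∃ n : ℤ, (n : ℝ) = sgn i := by
    fin_cases i
    · exact ⟨1, by simp [sgn]⟩
    · exact ⟨-1, by simp [sgn]⟩
  have hdk : flowLine ε δ ε q = deck 0 n q := by
    rw [hA.flowLine_crit i ε hq, mul_div_cancel₀ _ hε, deck, hn]
    simp
  have hlin := hA.linFlow_rawD hφ hp ε hL v
  rw [hdk, hA.torsion.rawD_deck 0 n hi] at hlin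
  have h4 : (linFlow φ ε (F q) (rawD F q v) : E3) = rawD F q v ↔ v.2.2 = 0 := by
    rw [hlin]
    refine (hA.torsion.rawD_injective hi).eq_iff.trans ?_
    constructor
    · intro h
      have h5 := congrArg Prod.fst h
      simp [π₁, π₃] at h5
      exact (h5.resolve_left hε).resolve_left hd0
    · intro h
      ext <;> simp [π₁, π₂, π₃, h]
  exact h4

/-- The critical tori are Morse-Bott submanifolds. -/
theorem isMorseBott {φ : ℝ → M → M} (hφ : IsFlowOf (reeb lam) φ) (i : Fin 2) :
    IsMorseBott φ ε 2 (F '' {q | q.2.2 = crit i}) := by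
  have hpure : ∀ q : T3, q.2.2 = crit i → q.2.2 ∈ Ioo δ (1 - δ) := fun q hq => by
    rw [hq]; exact mem_pure hA.del_pos hA.del_lt (crit_mem' i)
  have hε := hA.eps_pos
  refine ⟨by norm_num, ?_, ?_, ?_, ?_⟩
  · exact hA.torsion.isCompact_image (K := {crit i}) isCompact_singleton (by
      intro t ht
      rw [mem_singleton_iff.1 ht]
      exact ⟨by linarith [(crit_mem i).1], by linarith [(crit_mem i).2]⟩)
  · have h1 : IsConnected {q : T3 | q.2.2 = crit i} := by
      have : {q : T3 | q.2.2 = crit i} = univ ×ˢ univ ×ˢ {crit i} := by ext q; simp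
      rw [this]
      exact isConnected_univ.prod (isConnected_univ.prod isConnected_singleton)
    exact h1.image _ (hA.torsion.smooth.continuousOn.mono fun q hq => hA.mem_slab (hpure q hq))
  · rintro _ ⟨q, hq, rfl⟩
    refine ⟨⟨hε, ?_⟩, fun t => ?_⟩
    · rw [hA.flow_eq hφ (hpure q hq), hA.flowLine_crit i ε hq, mul_div_cancel₀ _ hε.ne']
      refine ((hA.torsion.eq_iff q (hA.mem_slab (hpure q hq))
        (q.1, q.2.1 + sgn i, q.2.2) (hA.mem_slab (hpure q hq))).2 ?_).symm
      fin_cases i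
      · exact ⟨0, 1, by simp, by simp [sgn], rfl⟩
      · exact ⟨0, -1, by simp, by simp [sgn], rfl⟩
    · rw [hA.flow_eq hφ (hpure q hq)]
      exact ⟨flowLine ε δ t q, hq, rfl⟩
  · rintro _ ⟨q, hq, rfl⟩
    have hi := hA.mem_slabInt (hpure q hq)
    obtain ⟨e, he, hs, hes, -⟩ := hA.torsion.exists_shifted_chart toT3 (0, 0, crit i) hi univ_mem
    have h2 : ∀ q' : T3, toT3.symm (q' - (0, 0, crit i)) 2 = q'.2.2 - crit i := fun q' => rfl
    refine ⟨e, he, hs, ?_, ?_⟩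
    · intro r hr
      obtain ⟨q', hq', rfl, her, -⟩ := hes r hr
      have h3 : F q' ∈ F '' {q | q.2.2 = crit i} ↔ q'.2.2 = crit i := by
        constructor
        · rintro ⟨q'', hq'', h⟩
          rw [hA.torsion.theta_eq (slabInt_subset_slab hq'.2) (hA.mem_slab (hpure q'' hq'')) h.symm]
          exact hq''
        · exact fun h => ⟨q', h, rfl⟩
      rw [h3, her]
      constructor
      · intro h k hk
        have : k = 2 := by omega
        rw [this, h2, h, sub_self]
      · intro h
        have := h 2 (by norm_num)
        rw [h2] at this
        linarith
    · intro V
      obtain ⟨q', hq', hr', her, hev⟩ := hes _ hs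
      have hθ : q'.2.2 = q.2.2 :=
        hA.torsion.theta_eq (slabInt_subset_slab hq'.2) (slabInt_subset_slab hi) hr'
      have key : ∀ V : E3, IsFixedVector φ ε (F q') V ↔
          ∀ k : Fin 3, 2 ≤ (k : ℕ) → chartD e (F q') V k = 0 := by
        intro V
        obtain ⟨v, rfl⟩ := hA.torsion.rawD_surjective hq'.2 V
        rw [hA.isFixedVector_iff hφ i (hθ.trans hq), hA.torsion.chartD_rawD hq'.2 he hev]
        constructor
        · intro h k hk
          have : k = 2 := by omega
          rw [this]; exact h
        · intro h
          exact h 2 (by norm_num)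
      rw [← hr']
      exact key V

/-- The orbits in the critical tori are degenerate. -/
theorem not_isNondegenerate {φ : ℝ → M → M} (hφ : IsFlowOf (reeb lam) φ) (i : Fin 2) {q : T3}
    (hq : q.2.2 = crit i) : ¬ IsNondegenerate lam φ (F q) ε := by
  intro h
  have hp : q.2.2 ∈ Ioo δ (1 - δ) := by
    rw [hq]; exact mem_pure hA.del_pos hA.del_lt (crit_mem' i)
  have h1 : rawF lam (F q) (rawD F q (1, 0, 0)) = 0 := by
    rw [hA.alpha_eq_zero_iff hp, alpha_apply, hq, cos_crit]
    simp
  have h2 : (rawD F q (1, 0, 0) : E3) = 0 :=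
    h _ h1 ((hA.isFixedVector_iff hφ i hq (1, 0, 0)).2 rfl)
  have h3 := hA.torsion.rawD_injective (hA.mem_slabInt hp) (h2.trans (map_zero _).symm)
  have := congrArg Prod.fst h3
  simp at this

end IsAdapted
end CriticalTori

/-! ### The orbits in the Morse-Bott tori -/

section CriticalOrbits

variable {M : Type*} [TopologicalSpace M] [ChartedSpace E3 M] [IsManifold (𝓡 3) ∞ M]
variable {ξ : ∀ p : M, Submodule ℝ (TangentSpace (𝓡 3) p)} {F : T3 → M}
variable {lam : ∀ p : M, TangentSpace (𝓡 3) p →L[ℝ] ℝ} {ε δ : ℝ}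

omit [IsManifold (𝓡 3) ∞ M] in
/-- Each level of `θ` is a torus. -/
theorem IsTorsionMap.nonempty_homeomorph_torus [T2Space M] (hF : IsTorsionMap ξ F) {c : ℝ}
    (hc : c ∈ Icc (0 : ℝ) 1) : Nonempty (↥(F '' {q | q.2.2 = c}) ≃ₜ Circle × Circle) := by
  have hmem : ∀ x y : ℝ, ((x, y, c) : T3) ∈ slab := fun x y => hc
  set f : ℝ × ℝ → ↥(F '' {q : T3 | q.2.2 = c}) := fun w => ⟨F (w.1, w.2, c), _, rfl, rfl⟩ with hf
  have hfc : Continuous f := by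
    refine Continuous.subtype_mk ?_ _
    exact hF.smooth.continuousOn.comp_continuous (by fun_prop) fun w => hmem _ _
  set π : ℝ × ℝ → AddCircle (1 : ℝ) × AddCircle (1 : ℝ) := Prod.map (↑) (↑) with hπ
  have hπq : IsOpenQuotientMap π :=
    QuotientAddGroup.isOpenQuotientMap_mk.prodMap QuotientAddGroup.isOpenQuotientMap_mk
  have hcirc : ∀ x x' : ℝ, (x' : AddCircle (1 : ℝ)) = x ↔ ∃ m : ℤ, x' = x + m := by
    intro x x'
    rw [← sub_eq_zero, ← AddCircle.coe_sub, AddCircle.coe_eq_zero_iff]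
    refine exists_congr fun m => ?_
    rw [zsmul_one, eq_sub_iff_add_eq, add_comm]
    exact eq_comm
  have hkey : ∀ w w' : ℝ × ℝ, π w = π w' ↔ f w = f w' := by
    intro w w'
    rw [Subtype.ext_iff, hF.eq_iff _ (hmem w.1 w.2) _ (hmem w'.1 w'.2), hπ, Prod.ext_iff]
    simp only [Prod.map_fst, Prod.map_snd, and_true]
    rw [eq_comm, hcirc, eq_comm, hcirc]
    constructor
    · rintro ⟨⟨m, hm⟩, ⟨n, hn⟩⟩
      exact ⟨m, n, hm, hn⟩
    · rintro ⟨m, n, hm, hn⟩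
      exact ⟨⟨m, hm⟩, ⟨n, hn⟩⟩
  set g : C(ℝ × ℝ, ↥(F '' {q : T3 | q.2.2 = c})) := ⟨f, hfc⟩
  have hfib : Function.FactorsThrough g π := fun w w' h => (hkey w w').1 h
  set G := hπq.isQuotientMap.lift (f := ⟨π, hπq.continuous⟩) g hfib with hG
  have hGπ : ∀ w, G (π w) = f w := fun w =>
    congrArg (fun k : C(ℝ × ℝ, ↥(F '' {q : T3 | q.2.2 = c})) => k w)
      (hπq.isQuotientMap.lift_comp (f := ⟨π, hπq.continuous⟩) g hfib)
  have hGb : Function.Bijective G := by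
    constructor
    · intro a b hab
      obtain ⟨w, rfl⟩ := hπq.surjective a
      obtain ⟨w', rfl⟩ := hπq.surjective b
      rw [hGπ, hGπ] at hab
      exact (hkey w w').2 hab
    · rintro ⟨_, ⟨x, y, θ⟩, hθ, rfl⟩
      simp only [mem_ofPred_eq] at hθ
      subst hθ
      exact ⟨π (x, y), hGπ (x, y)⟩
  have : Fact ((0 : ℝ) < 1) := ⟨one_pos⟩
  exact ⟨((Continuous.homeoOfEquivCompactToT2 (f := Equiv.ofBijective G hGb)
    G.continuous).symm).trans
    ((AddCircle.homeomorphCircle one_ne_zero).prodCongr (AddCircle.homeomorphCircle one_ne_zero))⟩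

namespace IsAdapted

variable (hA : IsAdapted ξ F lam ε δ) {φ : ℝ → M → M}
include hA

omit [IsManifold (𝓡 3) ∞ M] in
theorem crit_mem_Ioo (i : Fin 2) : crit i ∈ Ioo δ (1 - δ) :=
  mem_pure hA.del_pos hA.del_lt (crit_mem' i)

variable [T2Space M]

theorem flow_crit (hφ : IsFlowOf (reeb lam) φ) (i : Fin 2) (x y t : ℝ) :
    φ t (F (x, y, crit i)) = F (x, y + t * (sgn i / ε), crit i) := by
  have h := hA.flow_eq hφ (q := (x, y, crit i)) (hA.crit_mem_Ioo i) t
  rwa [hA.flowLine_crit i t rfl] at h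

omit [IsManifold (𝓡 3) ∞ M] [T2Space M] in
theorem crit_mem_slab (i : Fin 2) (x y : ℝ) : ((x, y, crit i) : T3) ∈ slab :=
  hA.mem_slab (hA.crit_mem_Ioo i)

theorem flow_crit_eq_self_iff (hφ : IsFlowOf (reeb lam) φ) (i : Fin 2) (x y t : ℝ) :
    φ t (F (x, y, crit i)) = F (x, y, crit i) ↔ ∃ n : ℤ, t / ε = n := by
  rw [hA.flow_crit hφ, eq_comm, hA.torsion.eq_iff _ (hA.crit_mem_slab i _ _) _ (hA.crit_mem_slab i _ _)]
  constructor
  · rintro ⟨m, n, -, h, -⟩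
    have h1 : t / ε * sgn i = n := by
      have : y + t * (sgn i / ε) = y + n := h
      rw [div_mul_eq_mul_div, ← mul_div_assoc] at *
      linarith
    fin_cases i
    · exact ⟨n, by simpa [sgn] using h1⟩
    · refine ⟨-n, ?_⟩
      have h2 : -(t / ε) = n := by simpa [sgn] using h1
      push_cast
      linarith
  · rintro ⟨n, h⟩
    have h1 : t * (sgn i / ε) = n * sgn i := by rw [← h]; ring
    fin_cases i
    · exact ⟨0, n, by simp, by simp only; rw [h1]; simp [sgn], rfl⟩
    · exact ⟨0, -n, by simp, by simp only; rw [h1]; simp [sgn], rfl⟩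

theorem orbitSet_crit (hφ : IsFlowOf (reeb lam) φ) (i : Fin 2) :
    orbitSet φ (F (0, 0, crit i)) = F '' {q | q.1 = 0 ∧ q.2.2 = crit i} := by
  have hε := hA.eps_pos.ne'
  have hs : sgn i ≠ 0 := by
    intro h; have := sgn_mul_self i; rw [h] at this; norm_num at this
  ext r
  constructor
  · rintro ⟨t, rfl⟩
    simp only [hA.flow_crit hφ]
    exact ⟨_, ⟨rfl, rfl⟩, rfl⟩
  · rintro ⟨⟨x, y, θ⟩, ⟨hx, hθ⟩, rfl⟩
    simp only at hx hθ
    subst hx hθ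
    refine ⟨y * ε / sgn i, ?_⟩
    simp only [hA.flow_crit hφ]
    congr 3
    field_simp
    ring

theorem isPeriodicOrbit_crit (hφ : IsFlowOf (reeb lam) φ) (i : Fin 2) :
    IsPeriodicOrbit φ (F (0, 0, crit i)) ε ∧ IsSimplyCovered φ (F (0, 0, crit i)) ε := by
  have hε := hA.eps_pos
  refine ⟨⟨hε, ?_⟩, fun t h0 h1 h => ?_⟩
  · exact (hA.flow_crit_eq_self_iff hφ i 0 0 ε).2 ⟨1, by simp [hε.ne']⟩
  · obtain ⟨n, hn⟩ := (hA.flow_crit_eq_self_iff hφ i 0 0 t).1 h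
    have h2 : (0 : ℝ) < n := by rw [← hn]; positivity
    have h3 : (n : ℝ) < 1 := by rw [← hn, div_lt_one hε]; exact h1
    norm_cast at h2 h3
    omega

/-- A closed orbit in a critical torus belongs to the Morse-Bott family of that torus. -/
theorem flow_eq_self_of_mem (hφ : IsFlowOf (reeb lam) φ) (i : Fin 2) {t : ℝ} {r : M}
    (hr : r ∈ F '' {q | q.2.2 = crit i}) (h : φ t r = r) :
    ∀ r' ∈ F '' {q | q.2.2 = crit i}, φ t r' = r' := by
  obtain ⟨⟨x, y, θ⟩, hθ, rfl⟩ := hr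
  simp only [mem_ofPred_eq] at hθ
  subst hθ
  rintro _ ⟨⟨x', y', θ'⟩, hθ', rfl⟩
  simp only [mem_ofPred_eq] at hθ'
  subst hθ'
  exact (hA.flow_crit_eq_self_iff hφ i x' y' t).2 ((hA.flow_crit_eq_self_iff hφ i x y t).1 h)

omit [IsManifold (𝓡 3) ∞ M] [T2Space M] in
theorem disjoint_levels {s s' : Set T3} (hs : s ⊆ slab) (hs' : s' ⊆ slab)
    (h : ∀ q ∈ s, ∀ q' ∈ s', q.2.2 ≠ q'.2.2) : Disjoint (F '' s) (F '' s') := by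
  rw [Set.disjoint_left]
  rintro _ ⟨q, hq, rfl⟩ ⟨q', hq', he⟩
  exact h q hq q' hq' (hA.torsion.theta_eq (hs hq) (hs' hq') he.symm)

end IsAdapted
end CriticalOrbits

/-! ### The holomorphic strip -/

section Strip

/-- The height `θ` of the curve, as a function of the real part of the logarithm of the complex
coordinate: it decreases from `3/4` to `1/4`. -/
def ang (ε σ : ℝ) : ℝ := 1 / 2 - Real.arctan (ε * Real.sinh σ) / (2 * Real.pi)

/-- The derivative of `ang`. -/
def angD (ε σ : ℝ) : ℝ :=
  -(ε * Real.cosh σ / (1 + (ε * Real.sinh σ) ^ 2) / (2 * Real.pi))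

/-- The `ℝ`-component of the curve in the symplectization. -/
def hgt (ε σ : ℝ) : ℝ := ε * Real.log (Real.cosh σ) / (2 * Real.pi)

/-- The `M`-component of the curve, in the coordinates of the thickened torus and in the
logarithmic coordinate of the punctured sphere. -/
def strip (ε : ℝ) (w : ℂ) : T3 := (0, w.im / (2 * Real.pi), ang ε w.re)

/-- The differential of `strip`. -/
def stripD (ε σ : ℝ) : ℂ →L[ℝ] T3 :=
  (0 : ℂ →L[ℝ] ℝ).prod (((2 * Real.pi)⁻¹ • Complex.imCLM).prod (angD ε σ • Complex.reCLM))

theorem stripD_apply (ε σ : ℝ) (v : ℂ) :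
    stripD ε σ v = (0, v.im / (2 * Real.pi), angD ε σ * v.re) := by
  simp [stripD, div_eq_inv_mul]

theorem hasDerivAt_ang (ε σ : ℝ) : HasDerivAt (ang ε) (angD ε σ) σ := by
  have h := (((Real.hasDerivAt_sinh σ).const_mul ε).arctan.div_const (2 * Real.pi)).const_sub (1 / 2)
  refine h.congr_deriv ?_
  rw [angD]; ring

theorem angD_neg {ε : ℝ} (hε : 0 < ε) (σ : ℝ) : angD ε σ < 0 := by
  have := Real.cosh_pos σ
  rw [angD, neg_lt_zero]
  positivity

theorem contDiff_ang (ε : ℝ) : ContDiff ℝ ∞ (ang ε) := by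
  unfold ang
  exact contDiff_const.sub ((Real.contDiff_arctan.comp
    (contDiff_const.mul Real.contDiff_sinh)).div_const _)

theorem ang_mem (ε σ : ℝ) : ang ε σ ∈ Ioo (1 / 4 : ℝ) (3 / 4) := by
  have h1 := Real.arctan_lt_pi_div_two (ε * Real.sinh σ)
  have h2 := Real.neg_pi_div_two_lt_arctan (ε * Real.sinh σ)
  have hp := Real.pi_pos
  have h3 : Real.arctan (ε * Real.sinh σ) / (2 * Real.pi) < 1 / 4 := by
    rw [div_lt_iff₀ (by positivity)]; linarith
  have h4 : -(1 / 4) < Real.arctan (ε * Real.sinh σ) / (2 * Real.pi) := by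
    rw [lt_div_iff₀ (by positivity)]; linarith
  rw [ang]
  constructor <;> linarith

theorem two_pi_mul_ang (ε σ : ℝ) :
    2 * Real.pi * ang ε σ = Real.pi - Real.arctan (ε * Real.sinh σ) := by
  have := Real.pi_pos.ne'
  rw [ang]; field_simp

theorem cos_ang (ε σ : ℝ) :
    Real.cos (2 * Real.pi * ang ε σ) = -(√(1 + (ε * Real.sinh σ) ^ 2))⁻¹ := by
  rw [two_pi_mul_ang, Real.cos_pi_sub, Real.cos_arctan, one_div]

theorem sin_ang (ε σ : ℝ) :
    Real.sin (2 * Real.pi * ang ε σ) = ε * Real.sinh σ * (√(1 + (ε * Real.sinh σ) ^ 2))⁻¹ := by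
  rw [two_pi_mul_ang, Real.sin_pi_sub, Real.sin_arctan, div_eq_mul_inv]

theorem tendsto_sinh_atTop : Tendsto Real.sinh atTop atTop := by
  refine tendsto_atTop_mono' _ ?_ tendsto_id
  filter_upwards [eventually_ge_atTop 0] with x hx
  exact Real.self_le_sinh_iff.2 hx

theorem tendsto_ang_atTop {ε : ℝ} (hε : 0 < ε) : Tendsto (ang ε) atTop (𝓝 (1 / 4)) := by
  have h1 : Tendsto (fun σ => Real.arctan (ε * Real.sinh σ)) atTop (𝓝 (Real.pi / 2)) :=
    (Real.tendsto_arctan_atTop.mono_right nhdsWithin_le_nhds).comp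
      (tendsto_sinh_atTop.const_mul_atTop hε)
  have h2 := (h1.div_const (2 * Real.pi)).const_sub (1 / 2)
  have h3 : 1 / 2 - Real.pi / 2 / (2 * Real.pi) = 1 / 4 := by
    have := Real.pi_pos.ne'
    field_simp; norm_num
  rw [h3] at h2
  exact h2

theorem ang_neg (ε σ : ℝ) : ang ε (-σ) = 1 - ang ε σ := by
  rw [ang, ang, Real.sinh_neg, mul_neg, Real.arctan_neg]; ring

theorem tendsto_ang_atBot {ε : ℝ} (hε : 0 < ε) : Tendsto (ang ε) atBot (𝓝 (3 / 4)) := by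
  have h := ((tendsto_ang_atTop hε).comp tendsto_neg_atBot_atTop).const_sub 1
  rw [show (1 : ℝ) - 1 / 4 = 3 / 4 by norm_num] at h
  refine h.congr fun x => ?_
  simp [ang_neg]

/-- The inverse function of `ang`. -/
def angInv (ε θ : ℝ) : ℝ := Real.arsinh (Real.tan (Real.pi - 2 * Real.pi * θ) / ε)

theorem angInv_ang {ε : ℝ} (hε : 0 < ε) (σ : ℝ) : angInv ε (ang ε σ) = σ := by
  rw [angInv, two_pi_mul_ang, sub_sub_cancel, Real.tan_arctan, mul_div_cancel_left₀ _ hε.ne',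
    Real.arsinh_sinh]

theorem ang_angInv {ε θ : ℝ} (hε : 0 < ε) (hθ : θ ∈ Ioo (1 / 4 : ℝ) (3 / 4)) :
    ang ε (angInv ε θ) = θ := by
  have hp := Real.pi_pos
  rw [ang, angInv, Real.sinh_arsinh, mul_div_cancel₀ _ hε.ne', Real.arctan_tan]
  · field_simp; ring
  · nlinarith [hθ.2]
  · nlinarith [hθ.1]

theorem continuousAt_angInv {ε θ : ℝ} (hθ : θ ∈ Ioo (1 / 4 : ℝ) (3 / 4)) :
    ContinuousAt (angInv ε) θ := by
  have hp := Real.pi_pos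
  have hc : 0 < Real.cos (Real.pi - 2 * Real.pi * θ) :=
    Real.cos_pos_of_mem_Ioo ⟨by nlinarith [hθ.2], by nlinarith [hθ.1]⟩
  have h1 : ContinuousAt (fun θ => Real.tan (Real.pi - 2 * Real.pi * θ)) θ :=
    ContinuousAt.comp (f := fun θ : ℝ => Real.pi - 2 * Real.pi * θ)
      (Real.continuousAt_tan.2 hc.ne') (by fun_prop)
  exact Real.continuous_arsinh.continuousAt.comp (h1.div_const ε)

theorem hasDerivAt_hgt (ε σ : ℝ) : HasDerivAt (hgt ε) (ε * Real.tanh σ / (2 * Real.pi)) σ := by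
  have h := (((Real.hasDerivAt_cosh σ).log (Real.cosh_pos σ).ne').const_mul ε).div_const (2 * Real.pi)
  rw [Real.tanh_eq_sinh_div_cosh]
  exact h

theorem contDiff_hgt (ε : ℝ) : ContDiff ℝ ∞ (hgt ε) := by
  unfold hgt
  exact (contDiff_const.mul (Real.contDiff_cosh.log fun σ => (Real.cosh_pos σ).ne')).div_const _

theorem hgt_neg (ε σ : ℝ) : hgt ε (-σ) = hgt ε σ := by rw [hgt, hgt, Real.cosh_neg]

theorem tendsto_hgt_atTop {ε : ℝ} (hε : 0 < ε) : Tendsto (hgt ε) atTop atTop := by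
  have h1 : Tendsto Real.cosh atTop atTop :=
    tendsto_atTop_mono (fun x => (Real.sinh_lt_cosh x).le) tendsto_sinh_atTop
  exact ((Real.tendsto_log_atTop.comp h1).const_mul_atTop hε).atTop_div_const (by positivity)

theorem tendsto_hgt_atBot {ε : ℝ} (hε : 0 < ε) : Tendsto (hgt ε) atBot atTop :=
  ((tendsto_hgt_atTop hε).comp tendsto_neg_atBot_atTop).congr fun σ => hgt_neg ε σ

theorem hasFDerivAt_strip (ε : ℝ) (w : ℂ) : HasFDerivAt (strip ε) (stripD ε w.re) w := by
  refine (hasFDerivAt_const (0 : ℝ) w).prodMk (HasFDerivAt.prodMk ?_ ?_)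
  · have h : (fun w : ℂ => w.im / (2 * Real.pi)) = ((2 * Real.pi)⁻¹ • Complex.imCLM : ℂ →L[ℝ] ℝ) := by
      funext w; simp [div_eq_inv_mul]
    rw [h]
    exact ContinuousLinearMap.hasFDerivAt _
  · exact HasDerivAt.comp_hasFDerivAt (h₂ := ang ε) (f := fun w : ℂ => w.re) w
      (hasDerivAt_ang ε w.re) Complex.reCLM.hasFDerivAt

theorem contDiff_strip (ε : ℝ) : ContDiff ℝ ∞ (strip ε) := by
  refine contDiff_const.prodMk (ContDiff.prodMk ?_ ?_)
  · exact Complex.imCLM.contDiff.div_const _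
  · exact (contDiff_ang ε).comp Complex.reCLM.contDiff

theorem stripD_injective {ε : ℝ} (hε : 0 < ε) (σ : ℝ) : Function.Injective (stripD ε σ) := by
  intro v w h
  rw [stripD_apply, stripD_apply, Prod.mk.injEq, Prod.mk.injEq] at h
  have h1 := h.2.1
  have h2 := h.2.2
  refine Complex.ext ?_ ?_
  · exact mul_left_cancel₀ (angD_neg hε σ).ne h2
  · have := Real.pi_pos.ne'
    field_simp at h1
    exact h1

end Strip

section StripEquation

variable {ε δ : ℝ}

theorem prof_ang (hε : 0 < ε) (hε1 : ε ≤ 1) (hδ0 : 0 < δ) (hδ : δ < 1 / 32) (σ : ℝ) :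
    prof ε δ (ang ε σ) = √(1 + (ε * Real.sinh σ) ^ 2) / Real.cosh σ := by
  have hm := ang_mem ε σ
  have h := prof_sq hε hε1 hδ0 (mem_middle hδ (θ := ang ε σ)
    ⟨by linarith [hm.1], by linarith [hm.2]⟩)
  have hp := prof_pos hε hε1 δ (ang ε σ)
  have hc := Real.cosh_pos σ
  have hq : (0 : ℝ) < 1 + (ε * Real.sinh σ) ^ 2 := by positivity
  have hs := Real.sqrt_pos.2 hq
  have hsq := Real.sq_sqrt hq.le
  have hch := Real.cosh_sq σ
  rw [cos_ang, sin_ang] at h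
  set S := √(1 + (ε * Real.sinh σ) ^ 2) with hS
  set P := prof ε δ (ang ε σ) with hP
  have h2 : P ^ 2 = (S / Real.cosh σ) ^ 2 := by
    rw [div_pow, eq_div_iff (by positivity), hch]
    field_simp at h
    linarith
  exact (pow_left_inj₀ hp.le (by positivity) two_ne_zero).1 h2

/-- The contact form on the tangent vectors of the strip. This is the `∂_a`-component of the equation
`dU(i v) = J dU(v)`. -/
theorem prof_mul_alpha_stripD (hε : 0 < ε) (hε1 : ε ≤ 1) (hδ0 : 0 < δ) (hδ : δ < 1 / 32) (w v : ℂ) :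
    prof ε δ (strip ε w).2.2 * alpha (strip ε w) (stripD ε w.re v) =
      ε * Real.tanh w.re / (2 * Real.pi) * v.im := by
  have hc := Real.cosh_pos w.re
  have hq : (0 : ℝ) < 1 + (ε * Real.sinh w.re) ^ 2 := by positivity
  have hs := (Real.sqrt_pos.2 hq).ne'
  rw [alpha_apply, stripD_apply]
  simp only [strip]
  rw [prof_ang hε hε1 hδ0 hδ, sin_ang, Real.tanh_eq_sinh_div_cosh]
  field_simp
  ring

/-- The component of the equation `dU(i v) = J dU(v)` that is tangent to `M`. -/
theorem stripD_I_mul (hε : 0 < ε) (hε1 : ε ≤ 1) (hδ0 : 0 < δ) (hδ : δ < 1 / 32) (w v : ℂ) :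
    stripD ε w.re (Complex.I * v) =
      (ε * Real.tanh w.re / (2 * Real.pi) * v.re) •
        ((velX ε δ (strip ε w).2.2, velY ε δ (strip ε w).2.2, 0) : T3) +
      pureEndo ε δ (strip ε w) (stripD ε w.re v) := by
  have hc := Real.cosh_pos w.re
  have hq : (0 : ℝ) < 1 + (ε * Real.sinh w.re) ^ 2 := by positivity
  have hs := (Real.sqrt_pos.2 hq).ne'
  have hsq := Real.sq_sqrt hq.le
  have hm := ang_mem ε w.re
  have hmid := mem_middle hδ (δ := δ) (θ := ang ε w.re) ⟨by linarith [hm.1], by linarith [hm.2]⟩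
  have hch := Real.cosh_sq w.re
  rw [pureEndo_apply, stripD_apply, stripD_apply]
  simp only [strip]
  rw [velX_eq hδ0 hmid, velY_eq hδ0 hmid, prof_ang hε hε1 hδ0 hδ, sin_ang, cos_ang,
    Real.tanh_eq_sinh_div_cosh, angD]
  generalize √(1 + (ε * Real.sinh w.re) ^ 2) = S at *
  rw [← hsq]
  have hpi := Real.pi_pos.ne'
  have hε' := hε.ne'
  have hc' := hc.ne'
  ext
  · simp
    field_simp
    ring
  · simp
    field_simp
    rw [hch]
  · simp
    field_simp

end StripEquation

/-! ### The holomorphic cylinder -/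

section LocalLogarithm

/-- The two punctures of the curve: it is a cylinder. -/
def punctures : Fin 2 → OnePoint ℂ := ![OnePoint.infty, ((0 : ℂ) : OnePoint ℂ)]

theorem punctures_injective : Function.Injective punctures := by
  intro i k h
  fin_cases i <;> fin_cases k
  · rfl
  · exact absurd h (OnePoint.infty_ne_coe _)
  · exact absurd h (OnePoint.coe_ne_infty _)
  · rfl

theorem range_punctures : range punctures = {OnePoint.infty, ((0 : ℂ) : OnePoint ℂ)} := by
  rw [punctures, Matrix.range_cons, Matrix.range_cons, Matrix.range_empty, union_empty]
  rfl

theorem sphereCoord_true {ζ : ℂ} (h : ζ ≠ 0) : sphereCoord true ζ = ((ζ⁻¹ : ℂ) : OnePoint ℂ) := by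
  simp [sphereCoord, h]

theorem sphereCoord_false (ζ : ℂ) : sphereCoord false ζ = (ζ : OnePoint ℂ) := by
  simp [sphereCoord]

theorem coe_notMem_punctures {ζ : ℂ} : (ζ : OnePoint ℂ) ∉ range punctures ↔ ζ ≠ 0 := by
  rw [range_punctures]
  simp

theorem sphereCoord_notMem {b : Bool} {ζ : ℂ} : sphereCoord b ζ ∉ range punctures ↔ ζ ≠ 0 := by
  cases b
  · rw [sphereCoord_false, coe_notMem_punctures]
  · by_cases h : ζ = 0
    · simp [h, sphereCoord, range_punctures]
    · rw [sphereCoord_true h, coe_notMem_punctures]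
      simp [h]

/-- A point that is not a puncture is an exponential. -/
theorem exists_eq_exp {z : OnePoint ℂ} (hz : z ∉ range punctures) :
    ∃ w : ℂ, z = ((Complex.exp w : ℂ) : OnePoint ℂ) := by
  induction z using OnePoint.rec with
  | infty => exact absurd (by rw [range_punctures]; simp) hz
  | coe ζ => exact ⟨Complex.log ζ, by rw [Complex.exp_log (coe_notMem_punctures.1 hz)]⟩

theorem exp_notMem_punctures (w : ℂ) : ((Complex.exp w : ℂ) : OnePoint ℂ) ∉ range punctures :=
  coe_notMem_punctures.2 (Complex.exp_ne_zero w)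

/-- Near a point other than the punctures, the logarithm is a holomorphic coordinate. -/
theorem exists_local_log (b : Bool) {ζ₀ : ℂ} (h : ζ₀ ≠ 0) :
    ∃ (L : ℂ → ℂ) (a : ℂ), ‖a‖ = ‖ζ₀‖⁻¹ ∧ HasDerivAt L a ζ₀ ∧ ContDiffAt ℝ ∞ L ζ₀ ∧
      ∀ᶠ ζ in 𝓝 ζ₀, sphereCoord b ζ = ((Complex.exp (L ζ) : ℂ) : OnePoint ℂ) := by
  set L₀ : ℂ → ℂ := fun ζ => Complex.log (ζ / ζ₀) + Complex.log ζ₀ with hL₀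
  have h1 : ζ₀ / ζ₀ ∈ Complex.slitPlane := by rw [div_self h]; exact Complex.one_mem_slitPlane
  have h2 : HasDerivAt L₀ ζ₀⁻¹ ζ₀ := by
    have := (((hasDerivAt_id ζ₀).div_const ζ₀).clog h1).add_const (Complex.log ζ₀)
    refine this.congr_deriv ?_
    simp only [id_eq, div_self h]
    rw [div_one, one_div]
  have h3 : ContDiffAt ℝ ∞ L₀ ζ₀ := by
    have h4 : ContDiffAt ℂ ∞ L₀ ζ₀ :=
      ((Complex.contDiffAt_log h1).comp (f := fun ζ => ζ / ζ₀) ζ₀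
        (contDiffAt_id.div_const ζ₀)).add contDiffAt_const
    exact h4.restrict_scalars ℝ
  have h5 : ∀ ζ ≠ 0, Complex.exp (L₀ ζ) = ζ := fun ζ hζ => by
    simp only [hL₀]
    rw [Complex.exp_add, Complex.exp_log (div_ne_zero hζ h), Complex.exp_log h,
      div_mul_cancel₀ _ h]
  have hev : ∀ᶠ ζ in 𝓝 ζ₀, ζ ≠ 0 := isOpen_ne.mem_nhds h
  cases b
  · refine ⟨L₀, ζ₀⁻¹, norm_inv _, h2, h3, hev.mono fun ζ hζ => ?_⟩
    rw [sphereCoord_false, h5 ζ hζ]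
  · refine ⟨fun ζ => -L₀ ζ, -ζ₀⁻¹, by rw [norm_neg, norm_inv], h2.neg, h3.neg,
      hev.mono fun ζ hζ => ?_⟩
    rw [sphereCoord_true hζ, Complex.exp_neg, h5 ζ hζ]

end LocalLogarithm

section Curve

variable {M : Type*} [TopologicalSpace M] [ChartedSpace E3 M]
variable {ξ : ∀ p : M, Submodule ℝ (TangentSpace (𝓡 3) p)} {F : T3 → M}
variable {lam : ∀ p : M, TangentSpace (𝓡 3) p →L[ℝ] ℝ} {ε δ : ℝ}

/-- The `M`-component of the curve, as a map from the Riemann sphere. Its values at the punctures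
are irrelevant. -/
def curveM (F : T3 → M) (ε : ℝ) (z : OnePoint ℂ) : M :=
  z.elim (F (0, 0, 1 / 4)) fun ζ => F (strip ε (Complex.log ζ))

/-- The `ℝ`-component of the curve, as a function on the Riemann sphere. Its values at the
punctures are irrelevant. -/
def curveR (ε : ℝ) (z : OnePoint ℂ) : ℝ := z.elim 0 fun ζ => hgt ε (Complex.log ζ).re

theorem strip_mem_Ioo (ε : ℝ) (w : ℂ) : (strip ε w).2.2 ∈ Ioo (1 / 4 : ℝ) (3 / 4) := ang_mem ε w.re

theorem strip_mem_slabInt (ε : ℝ) (w : ℂ) : strip ε w ∈ slabInt :=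
  ⟨by linarith [(strip_mem_Ioo ε w).1], by linarith [(strip_mem_Ioo ε w).2]⟩

theorem strip_mem_slab (ε : ℝ) (w : ℂ) : strip ε w ∈ slab :=
  slabInt_subset_slab (strip_mem_slabInt ε w)

theorem curveR_exp (ε : ℝ) (w : ℂ) : curveR ε ((Complex.exp w : ℂ) : OnePoint ℂ) = hgt ε w.re := by
  rw [curveR, OnePoint.elim_some, Complex.log_re, Complex.norm_exp, Real.log_exp]

theorem IsTorsionMap.curveM_exp (hF : IsTorsionMap ξ F) (ε : ℝ) (w : ℂ) :
    curveM F ε ((Complex.exp w : ℂ) : OnePoint ℂ) = F (strip ε w) := by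
  rw [curveM, OnePoint.elim_some]
  obtain ⟨n, hn⟩ := Complex.log_exp_exists w
  have h1 : strip ε (Complex.log (Complex.exp w)) = deck 0 n (strip ε w) := by
    have := Real.pi_pos.ne'
    rw [hn]
    simp only [strip, deck]
    ext
    · simp
    · simp
      field_simp
    · simp
  rw [h1, hF.deck_eq 0 n (strip_mem_slab ε w)]

/-- The curve in a logarithmic coordinate. -/
theorem IsTorsionMap.exists_curveD [IsManifold (𝓡 3) ∞ M] (hF : IsTorsionMap ξ F) (ε : ℝ) (b : Bool) {ζ : ℂ} (hζ : ζ ≠ 0) :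
    ∃ w a : ℂ, sphereCoord b ζ = ((Complex.exp w : ℂ) : OnePoint ℂ) ∧ ‖a‖ = ‖ζ‖⁻¹ ∧
      ContDiffAt ℝ ∞ (fun ζ => curveR ε (sphereCoord b ζ)) ζ ∧
      ContMDiffAt 𝓘(ℝ, ℂ) (𝓡 3) ∞ (fun ζ => curveM F ε (sphereCoord b ζ)) ζ ∧
      (∀ v, (curveD (curveR ε) (curveM F ε) b ζ v).1 =
        ε * Real.tanh w.re / (2 * Real.pi) * (a * v).re) ∧
      ∀ v, ((curveD (curveR ε) (curveM F ε) b ζ v).2 : E3) =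
        rawD F (strip ε w) (stripD ε w.re (a * v)) := by
  obtain ⟨L, a, ha, hL, hLs, hev⟩ := exists_local_log b hζ
  have hR : (fun ζ => curveR ε (sphereCoord b ζ)) =ᶠ[𝓝 ζ] fun ζ => hgt ε (L ζ).re :=
    hev.mono fun ζ h => by
      simp only
      rw [h, curveR_exp]
  have hM : (fun ζ => curveM F ε (sphereCoord b ζ)) =ᶠ[𝓝 ζ] fun ζ => F (strip ε (L ζ)) :=
    hev.mono fun ζ h => by
      simp only
      rw [h, hF.curveM_exp]
  set D : ℂ →L[ℝ] ℂ := (ContinuousLinearMap.toSpanSingleton ℂ a).restrictScalars ℝ with hD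
  have hDv : ∀ v, D v = a * v := fun v => by simp [hD, mul_comm]
  have hLf : HasFDerivAt L D ζ := hL.hasFDerivAt.restrictScalars ℝ
  have hsL : ContDiffAt ℝ ∞ (fun ζ => strip ε (L ζ)) ζ := (contDiff_strip ε).contDiffAt.comp ζ hLs
  have hs := strip_mem_slabInt ε (L ζ)
  refine ⟨L ζ, a, hev.self_of_nhds, ha, ?_, ?_, fun v => ?_, fun v => ?_⟩
  · refine ContDiffAt.congr_of_eventuallyEq ?_ hR
    exact ((contDiff_hgt ε).comp Complex.reCLM.contDiff).contDiffAt.comp ζ hLs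
  · refine ContMDiffAt.congr_of_eventuallyEq ?_ hM
    exact (hF.contMDiffAt hs).comp ζ hsL.contMDiffAt
  · have h1 : HasFDerivAt (fun ζ => hgt ε (L ζ).re)
        ((ε * Real.tanh (L ζ).re / (2 * Real.pi)) • Complex.reCLM.comp D) ζ :=
      HasDerivAt.comp_hasFDerivAt (h₂ := hgt ε) (f := fun ζ : ℂ => (L ζ).re) ζ
        (hasDerivAt_hgt ε _) (Complex.reCLM.hasFDerivAt.comp ζ hLf)
    change fderiv ℝ (fun ζ => curveR ε (sphereCoord b ζ)) ζ v = _
    rw [hR.fderiv_eq, h1.fderiv]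
    simp [hDv]
  · have h1 : HasFDerivAt (fun ζ => strip ε (L ζ)) ((stripD ε (L ζ).re).comp D) ζ :=
      (hasFDerivAt_strip ε (L ζ)).comp ζ hLf
    have h2 := mfderiv_comp (f := fun ζ => strip ε (L ζ)) ζ
      ((hF.contMDiffAt hs).mdifferentiableAt (by simp)) h1.differentiableAt.mdifferentiableAt
    rw [mfderiv_eq_fderiv, h1.fderiv] at h2
    have h3 := hM.mfderiv_eq (I := 𝓘(ℝ, ℂ)) (I' := 𝓡 3)
    have h4 := congrArg (fun T : ℂ →L[ℝ] E3 => T v) (h3.trans h2)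
    refine h4.trans ?_
    rw [← hDv]
    rfl

namespace IsAdapted

variable [IsManifold (𝓡 3) ∞ M] (hA : IsAdapted ξ F lam ε δ)
include hA

omit [IsManifold (𝓡 3) ∞ M] in
theorem strip_mem_pure (w : ℂ) : (strip ε w).2.2 ∈ Ioo δ (1 - δ) := by
  have h := strip_mem_Ioo ε w
  exact mem_pure hA.del_pos hA.del_lt ⟨by linarith [h.1], by linarith [h.2]⟩

theorem isJHolomorphic {j : ∀ p : M, TangentSpace (𝓡 3) p →L[ℝ] TangentSpace (𝓡 3) p}
    (hj : ∀ q : T3, q.2.2 ∈ Icc (1 / 4 : ℝ) (3 / 4) → ∀ v : T3,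
      (j (F q) (rawD F q v) : E3) = rawD F q (pureEndo ε δ q v)) :
    IsJHolomorphic lam (reeb lam) j (range punctures) (curveR ε) (curveM F ε) := by
  intro b ζ hζ
  obtain ⟨w, a, hw, -, h1, h2, h3, h4⟩ :=
    hA.torsion.exists_curveD ε b (sphereCoord_notMem.1 hζ)
  refine ⟨h1, h2, fun v => ?_⟩
  have hp := hA.strip_mem_pure w
  have key : ∀ (p : M) (V V' : ℝ × E3), p = F (strip ε w) →
      V.1 = ε * Real.tanh w.re / (2 * Real.pi) * (a * v).re →
      V'.1 = ε * Real.tanh w.re / (2 * Real.pi) * (a * (Complex.I * v)).re →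
      V.2 = rawD F (strip ε w) (stripD ε w.re (a * v)) →
      V'.2 = rawD F (strip ε w) (stripD ε w.re (a * (Complex.I * v))) →
      V' = sympJ lam (reeb lam) j p V := by
    rintro p ⟨r, V⟩ ⟨r', V'⟩ rfl h h' hV hV'
    simp only at h h' hV hV'
    have hI : a * (Complex.I * v) = Complex.I * (a * v) := by ring
    rw [hI] at h' hV'
    refine Prod.ext ?_ ?_
    · have h5 := hA.rawF_rawD hp (stripD ε w.re (a * v))
      rw [prof_mul_alpha_stripD hA.eps_pos hA.eps_le_one hA.del_pos hA.del_lt, ← hV] at h5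
      change r' = -rawF lam (F (strip ε w)) V
      rw [h5, h', Complex.I_mul_re]
      ring
    · have h6 := congrArg (rawD F (strip ε w))
        (stripD_I_mul hA.eps_pos hA.eps_le_one hA.del_pos hA.del_lt w (a * v))
      rw [map_add, map_smul, ← hA.reeb_eq hp, ← hj _ (Ioo_subset_Icc_self (strip_mem_Ioo ε w)),
        ← h, ← hV, ← hV'] at h6
      exact h6
  exact key _ _ _ ((congrArg (curveM F ε) hw).trans (hA.torsion.curveM_exp ε w)) (h3 v)
    (h3 (Complex.I * v)) (h4 v) (h4 (Complex.I * v))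

end IsAdapted
end Curve

/-! ### Embeddedness, properness and asymptotics -/

section Cylinder

variable {M : Type*} [TopologicalSpace M] [ChartedSpace E3 M]
variable {ξ : ∀ p : M, Submodule ℝ (TangentSpace (𝓡 3) p)} {F : T3 → M}
variable {lam : ∀ p : M, TangentSpace (𝓡 3) p →L[ℝ] ℝ} {ε δ : ℝ}

theorem cylEnd_punctures (i : Fin 2) (s t : ℝ) : cylEnd (punctures i) s t =
    ((Complex.exp ((sgn i : ℂ) * (2 * Real.pi * (s + t * Complex.I))) : ℂ) : OnePoint ℂ) := by
  fin_cases i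
  · simp [cylEnd, punctures, sgn]
  · simp [cylEnd, punctures, sgn]

theorem tendsto_ang_sgn {ε : ℝ} (hε : 0 < ε) (i : Fin 2) :
    Tendsto (fun s => ang ε (sgn i * (2 * Real.pi * s))) atTop (𝓝 (crit i)) := by
  have h : Tendsto (fun s : ℝ => 2 * Real.pi * s) atTop atTop :=
    tendsto_id.const_mul_atTop (by positivity)
  fin_cases i
  · simpa [sgn, crit, Function.comp_def] using (tendsto_ang_atTop hε).comp h
  · simpa [sgn, crit, Function.comp_def] using
      (tendsto_ang_atBot hε).comp (tendsto_neg_atTop_atBot.comp h)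

theorem tendsto_hgt_sgn {ε : ℝ} (hε : 0 < ε) (i : Fin 2) :
    Tendsto (fun s => hgt ε (sgn i * (2 * Real.pi * s))) atTop atTop := by
  have h : Tendsto (fun s : ℝ => 2 * Real.pi * s) atTop atTop :=
    tendsto_id.const_mul_atTop (by positivity)
  fin_cases i
  · simpa [sgn, Function.comp_def] using (tendsto_hgt_atTop hε).comp h
  · simpa [sgn, Function.comp_def] using
      (tendsto_hgt_atBot hε).comp (tendsto_neg_atTop_atBot.comp h)

theorem strip_sgn (ε : ℝ) (i : Fin 2) (s t : ℝ) :
    strip ε ((sgn i : ℂ) * (2 * Real.pi * (s + t * Complex.I))) =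
      (0, sgn i * t, ang ε (sgn i * (2 * Real.pi * s))) := by
  have := Real.pi_pos.ne'
  have h1 : ((sgn i : ℂ) * (2 * Real.pi * (s + t * Complex.I))) =
      (⟨sgn i * (2 * Real.pi * s), sgn i * (2 * Real.pi * t)⟩ : ℂ) := by
    apply Complex.ext <;> simp
  rw [h1, strip]
  ext
  · rfl
  · simp only
    field_simp
  · rfl

/-- A point that is not a puncture has a logarithm with imaginary part in `[-π, π]`. -/
theorem exists_eq_exp_im {z : OnePoint ℂ} (hz : z ∉ range punctures) :
    ∃ w : ℂ, z = ((Complex.exp w : ℂ) : OnePoint ℂ) ∧ w.im ∈ Icc (-Real.pi) Real.pi := by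
  induction z using OnePoint.rec with
  | infty => exact absurd (by rw [range_punctures]; simp) hz
  | coe ζ =>
    exact ⟨Complex.log ζ, by rw [Complex.exp_log (coe_notMem_punctures.1 hz)],
      (Complex.neg_pi_lt_log_im ζ).le, Complex.log_im_le_pi ζ⟩

theorem exists_bound_of_hgt_le {ε : ℝ} (hε : 0 < ε) (C : ℝ) :
    ∃ B, ∀ σ, hgt ε σ ≤ C → σ ∈ Icc (-B) B := by
  obtain ⟨B, hB⟩ := eventually_atTop.1 ((tendsto_hgt_atTop hε).eventually (eventually_gt_atTop C))
  refine ⟨B, fun σ hσ => abs_le.1 ?_⟩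
  by_contra! h
  have h1 := hB |σ| h.le
  have h2 : hgt ε |σ| = hgt ε σ := by
    rcases abs_choice σ with h | h
    · rw [h]
    · rw [h, hgt_neg]
  linarith

theorem continuousAt_curveR (ε : ℝ) {z : OnePoint ℂ} (hz : z ∉ range punctures) :
    ContinuousAt (curveR ε) z := by
  induction z using OnePoint.rec with
  | infty => exact absurd (by rw [range_punctures]; simp) hz
  | coe ζ =>
    rw [OnePoint.continuousAt_coe]
    have h0 := coe_notMem_punctures.1 hz
    have h1 : ContinuousAt (fun ζ : ℂ => hgt ε (Real.log ‖ζ‖)) ζ :=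
      (contDiff_hgt ε).continuous.continuousAt.comp
        (ContinuousAt.log continuous_norm.continuousAt (norm_ne_zero_iff.2 h0))
    refine h1.congr (Eventually.of_forall fun ζ => ?_)
    simp [curveR, Complex.log_re]

theorem IsTorsionMap.continuousAt_curveM [IsManifold (𝓡 3) ∞ M] (hF : IsTorsionMap ξ F) (ε : ℝ) {z : OnePoint ℂ}
    (hz : z ∉ range punctures) : ContinuousAt (curveM F ε) z := by
  induction z using OnePoint.rec with
  | infty => exact absurd (by rw [range_punctures]; simp) hz
  | coe ζ =>
    rw [OnePoint.continuousAt_coe]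
    obtain ⟨w, a, -, -, -, h, -⟩ := hF.exists_curveD ε false (coe_notMem_punctures.1 hz)
    simp only [sphereCoord_false] at h
    exact h.continuousAt

/-- The curve is proper. -/
theorem IsTorsionMap.isProperMap_curve [IsManifold (𝓡 3) ∞ M] [T2Space M] [CompactSpace M]
    (hF : IsTorsionMap ξ F) (hε : 0 < ε) :
    IsProperMap fun z : ↥(range punctures)ᶜ => (curveR ε z, curveM F ε z) := by
  have hc : Continuous fun z : ↥(range punctures)ᶜ => (curveR ε z, curveM F ε z) :=
    continuous_iff_continuousAt.2 fun z =>
      ((continuousAt_curveR ε z.2).comp continuousAt_subtype_val).prodMk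
        ((hF.continuousAt_curveM ε z.2).comp continuousAt_subtype_val)
  rw [isProperMap_iff_isCompact_preimage]
  refine ⟨hc, fun K hK => ?_⟩
  obtain ⟨C, hC⟩ := (hK.image continuous_fst).bddAbove
  obtain ⟨B, hB⟩ := exists_bound_of_hgt_le hε C
  set E : ℂ → ↥(range punctures)ᶜ := fun w => ⟨_, exp_notMem_punctures w⟩ with hE
  have hEc : Continuous E := by
    refine Continuous.subtype_mk ?_ _
    exact OnePoint.continuous_coe.comp Complex.continuous_exp
  have h1 : IsCompact (E '' (Icc (-B) B ×ℂ Icc (-Real.pi) Real.pi)) :=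
    (isCompact_Icc.reProdIm isCompact_Icc).image hEc
  refine h1.of_isClosed_subset (hK.isClosed.preimage hc) ?_
  rintro ⟨z, hz⟩ hzK
  obtain ⟨w, rfl, hw⟩ := exists_eq_exp_im hz
  refine ⟨w, ⟨hB _ ?_, hw⟩, rfl⟩
  rw [← curveR_exp]
  exact hC ⟨_, hzK, rfl⟩

/-- The curve is embedded. -/
theorem IsTorsionMap.isEmbeddedOn_curveM [IsManifold (𝓡 3) ∞ M] [T2Space M]
    (hF : IsTorsionMap ξ F) (hε : 0 < ε) : IsEmbeddedOn (range punctures) (curveM F ε) := by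
  refine ⟨Topology.IsInducing.isEmbedding ?_, ?_⟩
  · refine Topology.isInducing_iff_nhds.2 fun z₀ => le_antisymm ?_ ?_
    · exact ((hF.continuousAt_curveM ε z₀.2).comp continuousAt_subtype_val).tendsto.le_comap
    · obtain ⟨z₀, hz₀⟩ := z₀
      obtain ⟨w₀, rfl⟩ := exists_eq_exp hz₀
      -- on the image of the curve, the inverse is `q ↦ exp (angInv θ + 2πiy)`
      set H : T3 → OnePoint ℂ := fun q =>
        ((Complex.exp (angInv ε q.2.2 + (2 * Real.pi * q.2.1 : ℝ) * Complex.I) : ℂ) : OnePoint ℂ)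
        with hH
      have hHs : ∀ (w : ℂ) (m n : ℤ), H (deck m n (strip ε w)) =
          ((Complex.exp w : ℂ) : OnePoint ℂ) := by
        intro w m n
        simp only [hH, deck, strip]
        rw [angInv_ang hε]
        have hpi : (Real.pi : ℂ) ≠ 0 := by exact_mod_cast Real.pi_pos.ne'
        have : ((w.re : ℂ) + (2 * Real.pi * (w.im / (2 * Real.pi) + n) : ℝ) * Complex.I) =
            w + n * (2 * Real.pi * Complex.I) := by
          conv_rhs => rw [← Complex.re_add_im w]
          push_cast
          field_simp
          ring
        rw [this, Complex.exp_periodic.int_mul n w]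
      have hHc : ContinuousAt H (strip ε w₀) := by
        have h1 : ContinuousAt (fun q : T3 => angInv ε q.2.2) (strip ε w₀) :=
          ContinuousAt.comp (f := fun q : T3 => q.2.2)
            (continuousAt_angInv (strip_mem_Ioo ε w₀)) (by fun_prop)
        refine OnePoint.continuous_coe.continuousAt.comp (Complex.continuous_exp.continuousAt.comp ?_)
        refine (Complex.continuous_ofReal.continuousAt.comp h1).add ?_
        fun_prop
      intro S hS
      obtain ⟨V, hV, hVS⟩ := mem_nhds_subtype _ _ _ |>.1 hS
      have hW : H ⁻¹' V ∈ 𝓝 (strip ε w₀) := by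
        refine hHc.preimage_mem_nhds ?_
        have h2 := hHs w₀ 0 0
        have h3 : deck 0 0 (strip ε w₀) = strip ε w₀ := by ext <;> simp [deck]
        rw [h3] at h2
        rw [h2]
        exact hV
      obtain ⟨U, hU, hUW⟩ := hF.exists_nhds_deck (strip_mem_slab ε w₀) hW
      refine mem_comap.2 ⟨U, ?_, ?_⟩
      · simp only
        rw [hF.curveM_exp]
        exact hU
      · rintro ⟨z, hz⟩ hzU
        obtain ⟨w, rfl⟩ := exists_eq_exp hz
        refine hVS ?_
        have h4 : F (strip ε w) ∈ U := by
          rw [← hF.curveM_exp]; exact hzU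
        obtain ⟨m, n, h5⟩ := hUW _ (strip_mem_slab ε w) h4
        have h6 : H (deck m n (strip ε w)) ∈ V := h5
        rw [hHs] at h6
        exact h6
  · intro b ζ hζ
    have h0 := sphereCoord_notMem.1 hζ
    obtain ⟨w, a, -, ha, -, -, -, h⟩ := hF.exists_curveD ε b h0
    have ha0 : a ≠ 0 := by
      rw [← norm_ne_zero_iff, ha]
      exact inv_ne_zero (norm_ne_zero_iff.2 h0)
    refine fun (v v' : ℂ) hv => ?_
    have h1 : (rawD F (strip ε w) (stripD ε w.re (a * v)) : E3) =
        rawD F (strip ε w) (stripD ε w.re (a * v')) := (h v).symm.trans (Eq.trans hv (h v'))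
    have h2 : a * v = a * v' :=
      (stripD_injective hε _ (hF.rawD_injective (strip_mem_slabInt ε w) h1))
    exact mul_left_cancel₀ (M₀ := ℂ) ha0 h2

/-- The curve is asymptotic to a Reeb orbit in each of the critical tori. -/
theorem IsAdapted.isAsymptotic [IsManifold (𝓡 3) ∞ M] [T2Space M] (hA : IsAdapted ξ F lam ε δ)
    {φ : ℝ → M → M} (hφ : IsFlowOf (reeb lam) φ) (i : Fin 2) :
    IsAsymptotic φ (curveR ε) (curveM F ε) (punctures i) (F (0, 0, crit i)) ε := by
  have hε := hA.eps_pos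
  intro t₀
  refine ⟨?_, ?_⟩
  · simp only [cylEnd_punctures, curveR_exp]
    have h : Tendsto (fun q : ℝ × ℝ => hgt ε (sgn i * (2 * Real.pi * q.1))) (atTop ×ˢ 𝓝 t₀) atTop :=
      (tendsto_hgt_sgn hε i).comp tendsto_fst
    refine h.congr fun q => ?_
    congr 1
    simp
  · simp only [cylEnd_punctures, hA.torsion.curveM_exp, strip_sgn]
    rw [hA.flow_crit hφ]
    have h1 : ContinuousAt F (0, 0 + ε * t₀ * (sgn i / ε), crit i) :=
      hA.torsion.smooth.continuousOn.continuousAt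
        (slab_mem_nhds (hA.mem_slabInt (hA.crit_mem_Ioo i)))
    refine h1.tendsto.comp ?_
    have h2 : 0 + ε * t₀ * (sgn i / ε) = sgn i * t₀ := by
      field_simp; ring
    rw [h2]
    refine tendsto_const_nhds.prodMk_nhds (Tendsto.prodMk_nhds ?_ ?_)
    · exact (tendsto_snd.const_mul (sgn i))
    · exact (tendsto_ang_sgn hε i).comp tendsto_fst

end Cylinder

/-! ### The energy -/

section Energy

/-- In the coordinate `log ζ` the measure `‖ζ‖⁻² dζ` is the area of the cylinder. So the integral of
a derivative `h' (log ‖ζ‖) ≥ 0` against it is `2π` times the total increase of `h`. -/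
theorem lintegral_radial_le {h h' : ℝ → ℝ} {B : ℝ} (hd : ∀ σ, HasDerivAt h (h' σ) σ)
    (hc : Continuous h') (h0 : ∀ σ, 0 ≤ h' σ) (hB : ∀ σ, h σ ∈ Icc (-B) B) :
    ∫⁻ ζ : ℂ, ENNReal.ofReal (‖ζ‖⁻¹ ^ 2 * h' (Real.log ‖ζ‖)) ≤
      ENNReal.ofReal (B - -B) * ENNReal.ofReal (Real.pi - -Real.pi) := by
  rw [← Complex.lintegral_comp_polarCoord_symm]
  have h1 : ∀ p ∈ polarCoord.target, ENNReal.ofReal p.1 •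
      ENNReal.ofReal (‖Complex.polarCoord.symm p‖⁻¹ ^ 2 *
        h' (Real.log ‖Complex.polarCoord.symm p‖)) =
      ENNReal.ofReal (h' (Real.log p.1) * p.1⁻¹) * (fun _ => 1) p.2 := by
    rintro p ⟨hp, -⟩
    have hp : 0 < p.1 := hp
    rw [Complex.norm_polarCoord_symm, abs_of_pos hp, smul_eq_mul, mul_one,
      ← ENNReal.ofReal_mul hp.le]
    congr 1
    field_simp
  rw [setLIntegral_congr_fun polarCoord.open_target.measurableSet h1, polarCoord_target,
    Measure.volume_eq_prod, ← Measure.prod_restrict,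
    lintegral_prod_mul (f := fun r => ENNReal.ofReal (h' (Real.log r) * r⁻¹)) (g := fun _ => 1) (by
      refine ENNReal.measurable_ofReal.comp_aemeasurable ?_
      exact ((hc.measurable.comp Real.measurable_log).mul measurable_inv).aemeasurable)
      aemeasurable_const]
  have h2 : ∀ r ∈ Ioi (0 : ℝ), HasDerivAt (fun r => h (Real.log r)) (h' (Real.log r) * r⁻¹) r :=
    fun r hr => (hd _).comp r (Real.hasDerivAt_log (ne_of_gt hr))
  have h3 : MonotoneOn (fun r => h (Real.log r)) (Ioi 0) :=
    (monotone_of_hasDerivAt_nonneg hd h0).comp_monotoneOn Real.strictMonoOn_log.monotoneOn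
  rw [lintegral_deriv_eq_volume_image_of_monotoneOn measurableSet_Ioi
    (fun r hr => (h2 r hr).hasDerivWithinAt) h3]
  simp only [lintegral_const, Measure.restrict_apply MeasurableSet.univ, univ_inter, one_mul,
    Real.volume_Ioo]
  gcongr
  rw [← Real.volume_Icc]
  refine measure_mono ?_
  rintro _ ⟨r, -, rfl⟩
  exact hB _

/-- The derivative of `tanh`. -/
theorem hasDerivAt_tanh (σ : ℝ) : HasDerivAt Real.tanh ((Real.cosh σ ^ 2)⁻¹) σ := by
  have hc := (Real.cosh_pos σ).ne'
  have h := (Real.hasDerivAt_sinh σ).div (Real.hasDerivAt_cosh σ) hc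
  have h1 : Real.tanh = Real.sinh / Real.cosh := funext Real.tanh_eq_sinh_div_cosh
  rw [h1]
  refine h.congr_deriv ?_
  have := Real.cosh_sq σ
  field_simp
  linarith

/-- The radial density of the form `d(ψ lam)` on the curve. -/
def density (ε : ℝ) (ψ : ℝ → ℝ) (σ : ℝ) : ℝ :=
  deriv ψ (hgt ε σ) * (ε * Real.tanh σ / (2 * Real.pi)) ^ 2 +
    ψ (hgt ε σ) * (ε * (Real.cosh σ ^ 2)⁻¹ / (2 * Real.pi))

theorem hasDerivAt_density {ψ : ℝ → ℝ} (hψ : ContDiff ℝ ∞ ψ) (ε σ : ℝ) :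
    HasDerivAt (fun σ => ψ (hgt ε σ) * (ε * Real.tanh σ / (2 * Real.pi))) (density ε ψ σ) σ := by
  have h1 : HasDerivAt (fun σ => ψ (hgt ε σ))
      (deriv ψ (hgt ε σ) * (ε * Real.tanh σ / (2 * Real.pi))) σ :=
    ((hψ.differentiable (by simp)) _).hasDerivAt.comp σ (hasDerivAt_hgt ε σ)
  refine (h1.mul (((hasDerivAt_tanh σ).const_mul ε).div_const (2 * Real.pi))).congr_deriv ?_
  rw [density]; ring

theorem continuous_density {ψ : ℝ → ℝ} (hψ : ContDiff ℝ ∞ ψ) (ε : ℝ) :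
    Continuous (density ε ψ) := by
  have h1 : Continuous Real.tanh :=
    continuous_iff_continuousAt.2 fun σ => (hasDerivAt_tanh σ).continuousAt
  have h2 : Continuous (deriv ψ) := hψ.continuous_deriv (by simp)
  have h3 := (contDiff_hgt ε).continuous
  have h4 : Continuous fun σ => (Real.cosh σ ^ 2)⁻¹ :=
    (Real.continuous_cosh.pow 2).inv₀ fun σ => (pow_pos (Real.cosh_pos σ) 2).ne'
  have h5 := hψ.continuous
  unfold density
  fun_prop

variable {M : Type*} [TopologicalSpace M] [ChartedSpace E3 M] [IsManifold (𝓡 3) ∞ M]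
variable {ξ : ∀ p : M, Submodule ℝ (TangentSpace (𝓡 3) p)} {F : T3 → M}
variable {lam : ∀ p : M, TangentSpace (𝓡 3) p →L[ℝ] ℝ} {ε δ : ℝ}

namespace IsAdapted

variable (hA : IsAdapted ξ F lam ε δ)
include hA

/-- The form `dlam` on the tangent planes of the projected curve. -/
theorem rawE_stripD (w v v' : ℂ) :
    rawE lam (F (strip ε w)) (rawD F (strip ε w) (stripD ε w.re v))
      (rawD F (strip ε w) (stripD ε w.re v')) =
      ε * (Real.cosh w.re ^ 2)⁻¹ / (2 * Real.pi) * (v.re * v'.im - v'.re * v.im) := by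
  have hG : ContMDiffAt 𝓘(ℝ, ℂ) (𝓡 3) ∞ (F ∘ strip ε) w :=
    (hA.torsion.contMDiffAt (strip_mem_slabInt ε w)).comp w
      (contDiff_strip ε).contDiffAt.contMDiffAt
  have hD : ∀ w, rawD (F ∘ strip ε) w = (rawD F (strip ε w)).comp (stripD ε w.re) := by
    intro w
    have h2 := mfderiv_comp w
      ((hA.torsion.contMDiffAt (strip_mem_slabInt ε w)).mdifferentiableAt (by simp))
      (hasFDerivAt_strip ε w).differentiableAt.mdifferentiableAt
    rw [mfderiv_eq_fderiv, (hasFDerivAt_strip ε w).fderiv] at h2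
    exact h2
  have h1 := dOne_pullForm hA.contact.1.smooth hG v v'
  rw [hD] at h1
  have h2 : pullForm lam (F ∘ strip ε) =
      fun w : ℂ => (ε * Real.tanh w.re / (2 * Real.pi)) • Complex.imCLM := by
    funext w
    refine ContinuousLinearMap.ext fun v => ?_
    rw [pullForm, hD]
    have h3 := hA.rawF_rawD (hA.strip_mem_pure w) (stripD ε w.re v)
    rw [prof_mul_alpha_stripD hA.eps_pos hA.eps_le_one hA.del_pos hA.del_lt] at h3
    exact h3
  have h4 : HasFDerivAt (fun w : ℂ => ε * Real.tanh w.re / (2 * Real.pi))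
      ((ε * (Real.cosh w.re ^ 2)⁻¹ / (2 * Real.pi)) • Complex.reCLM) w :=
    HasDerivAt.comp_hasFDerivAt (h₂ := fun σ => ε * Real.tanh σ / (2 * Real.pi))
      (f := fun w : ℂ => w.re) w
      (((hasDerivAt_tanh w.re).const_mul ε).div_const (2 * Real.pi)) Complex.reCLM.hasFDerivAt
  rw [h2, dOne, (h4.smul_const Complex.imCLM).fderiv] at h1
  refine h1.symm.trans ?_
  simp
  ring

theorem sympForm_curveD (ψ : ℝ → ℝ) {ζ : ℂ} (hζ : ζ ≠ 0) :
    sympForm lam ψ (curveR ε (sphereCoord false ζ)) (curveM F ε (sphereCoord false ζ))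
        (curveD (curveR ε) (curveM F ε) false ζ 1)
        (curveD (curveR ε) (curveM F ε) false ζ Complex.I) =
      ‖ζ‖⁻¹ ^ 2 * density ε ψ (Real.log ‖ζ‖) := by
  obtain ⟨w, a, hw, ha, -, -, h3, h4⟩ := hA.torsion.exists_curveD ε false hζ
  have hre : Real.log ‖ζ‖ = w.re := by
    rw [sphereCoord_false, OnePoint.coe_eq_coe] at hw
    rw [hw, Complex.norm_exp, Real.log_exp]
  have hp := hA.strip_mem_pure w
  have hna : a.re * a.re + a.im * a.im = ‖ζ‖⁻¹ ^ 2 := by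
    rw [← ha, ← Complex.normSq_eq_norm_sq, Complex.normSq_apply]
  have key : ∀ (p : M) (V W : ℝ × E3), p = F (strip ε w) →
      V.1 = ε * Real.tanh w.re / (2 * Real.pi) * (a * 1).re →
      W.1 = ε * Real.tanh w.re / (2 * Real.pi) * (a * Complex.I).re →
      V.2 = rawD F (strip ε w) (stripD ε w.re (a * 1)) →
      W.2 = rawD F (strip ε w) (stripD ε w.re (a * Complex.I)) →
      sympForm lam ψ (hgt ε w.re) p V W = ‖ζ‖⁻¹ ^ 2 * density ε ψ w.re := by
    rintro p ⟨r, V⟩ ⟨r', W⟩ rfl h h' hV hW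
    simp only at h h' hV hW
    have e1 := hA.rawF_rawD hp (stripD ε w.re (a * 1))
    have e2 := hA.rawF_rawD hp (stripD ε w.re (a * Complex.I))
    rw [prof_mul_alpha_stripD hA.eps_pos hA.eps_le_one hA.del_pos hA.del_lt, ← hV] at e1
    rw [prof_mul_alpha_stripD hA.eps_pos hA.eps_le_one hA.del_pos hA.del_lt, ← hW] at e2
    have e3 := hA.rawE_stripD w (a * 1) (a * Complex.I)
    rw [← hV, ← hW] at e3
    change deriv ψ (hgt ε w.re) * (r * rawF lam _ W - r' * rawF lam _ V) +
      ψ (hgt ε w.re) * rawE lam _ V W = _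
    rw [e1, e2, e3, h, h', density, ← hna]
    simp
    ring
  have hR : curveR ε (sphereCoord false ζ) = hgt ε w.re := by rw [hw, curveR_exp]
  rw [hR, hre]
  exact key _ _ _ ((congrArg (curveM F ε) hw).trans (hA.torsion.curveM_exp ε w)) (h3 1)
    (h3 Complex.I) (h4 1) (h4 Complex.I)

/-- The curve has finite energy. -/
theorem energy_lt_top : energy lam (range punctures) (curveR ε) (curveM F ε) < ⊤ := by
  have hε := hA.eps_pos
  set B := ε / (2 * Real.pi) with hB
  have hB0 : 0 < B := by positivity
  refine lt_of_le_of_lt (b := ENNReal.ofReal (B - -B) * ENNReal.ofReal (Real.pi - -Real.pi)) ?_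
    (ENNReal.mul_lt_top ENNReal.ofReal_lt_top ENNReal.ofReal_lt_top)
  refine iSup₂_le fun ψ hψ => ?_
  have hset : {ζ : ℂ | (ζ : OnePoint ℂ) ∉ range punctures} = {0}ᶜ := by
    ext ζ
    simp only [mem_ofPred_eq, coe_notMem_punctures, mem_compl_iff, mem_singleton_iff, ne_eq]
  rw [hset, setLIntegral_congr_fun (measurableSet_singleton _).compl
    (g := fun ζ : ℂ => ENNReal.ofReal (‖ζ‖⁻¹ ^ 2 * density ε ψ (Real.log ‖ζ‖)))
    (fun ζ hζ => congrArg ENNReal.ofReal (hA.sympForm_curveD ψ hζ))]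
  refine (setLIntegral_le_lintegral _ _).trans
    (lintegral_radial_le (hasDerivAt_density hψ.1 ε) (continuous_density hψ.1 ε) ?_ ?_)
  · intro σ
    have h1 := (hψ.2 (hgt ε σ)).1
    have h2 := (hψ.2 (hgt ε σ)).2.2
    have h3 := Real.cosh_pos σ
    rw [density]
    positivity
  · intro σ
    obtain ⟨h1, h2, -⟩ := hψ.2 (hgt ε σ)
    rw [mem_Icc, ← abs_le, abs_mul, abs_div, abs_mul, abs_of_pos h1, abs_of_pos hε,
      abs_of_pos (by positivity : 0 < 2 * Real.pi)]
    calc ψ (hgt ε σ) * (ε * |Real.tanh σ| / (2 * Real.pi)) ≤ 1 * (ε * 1 / (2 * Real.pi)) := by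
          have := (Real.abs_tanh_lt_one σ).le
          gcongr
      _ = B := by rw [hB]; ring

theorem isFiniteEnergyCurve [T2Space M] [CompactSpace M]
    {j : ∀ p : M, TangentSpace (𝓡 3) p →L[ℝ] TangentSpace (𝓡 3) p}
    (hj : ∀ q : T3, q.2.2 ∈ Icc (1 / 4 : ℝ) (3 / 4) → ∀ v : T3,
      (j (F q) (rawD F q v) : E3) = rawD F q (pureEndo ε δ q v)) :
    IsFiniteEnergyCurve lam (reeb lam) j (range punctures) (curveR ε) (curveM F ε) :=
  ⟨hA.isJHolomorphic hj, hA.torsion.isProperMap_curve hA.eps_pos, hA.energy_lt_top⟩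

end IsAdapted
end Energy

/-! ### The closure of the projected curve -/

section Closure

/-- Linear coordinates adapted to the curve: for `κ = ±1`, the vector `(x, y, θ)` has the
coordinates `(- κ θ, κ y, x)`. The signs are such that at the end of the annulus where the Reeb field
is `κ ∂_y / ε`, the first coordinate points out of the annulus and the second along the Reeb field. -/
def flagEquiv (κ : ℝ) (hκ : κ * κ = 1) : E3 ≃L[ℝ] T3 :=
  LinearEquiv.toContinuousLinearEquiv
    { toFun := fun y => (y 2, κ * y 1, -(κ * y 0))
      map_add' := fun y y' => by ext <;> simp <;> ring
      map_smul' := fun c y => by ext <;> simp <;> ring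
      invFun := fun q => !₂[-(κ * q.2.2), κ * q.2.1, q.1]
      left_inv := fun y => by
        ext k
        fin_cases k <;> simp [← mul_assoc, hκ]
      right_inv := fun q => by
        ext <;> simp [← mul_assoc, hκ] }

variable {M : Type*} [TopologicalSpace M] [ChartedSpace E3 M]
variable {ξ : ∀ p : M, Submodule ℝ (TangentSpace (𝓡 3) p)} {F : T3 → M}
variable {lam : ∀ p : M, TangentSpace (𝓡 3) p →L[ℝ] ℝ} {ε δ : ℝ}

theorem IsTorsionMap.image_curveM (hF : IsTorsionMap ξ F) (hε : 0 < ε) :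
    curveM F ε '' (range punctures)ᶜ = F '' {q | q.1 = 0 ∧ q.2.2 ∈ Ioo (1 / 4 : ℝ) (3 / 4)} := by
  ext r
  constructor
  · rintro ⟨z, hz, rfl⟩
    obtain ⟨w, rfl⟩ := exists_eq_exp hz
    exact ⟨strip ε w, ⟨rfl, strip_mem_Ioo ε w⟩, (hF.curveM_exp ε w).symm⟩
  · rintro ⟨⟨x, y, θ⟩, ⟨hx, hθ⟩, rfl⟩
    simp only at hx hθ
    subst hx
    refine ⟨_, exp_notMem_punctures ⟨angInv ε θ, 2 * Real.pi * y⟩, ?_⟩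
    rw [hF.curveM_exp, strip, ang_angInv hε hθ]
    have := Real.pi_pos.ne'
    congr 3
    field_simp

/-- The closed annulus `{x = 0, 1/4 ≤ θ ≤ 3/4}` is closed in `M`. -/
theorem IsTorsionMap.isClosed_annulus [T2Space M] (hF : IsTorsionMap ξ F) :
    IsClosed (F '' {q | q.1 = 0 ∧ q.2.2 ∈ Icc (1 / 4 : ℝ) (3 / 4)}) := by
  have hs : ∀ q : T3, q.2.2 ∈ Icc (1 / 4 : ℝ) (3 / 4) → q ∈ slab := fun q hq =>
    ⟨by linarith [hq.1], by linarith [hq.2]⟩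
  have h1 : IsCompact (F '' ({0} ×ˢ Icc (0 : ℝ) 1 ×ˢ Icc (1 / 4 : ℝ) (3 / 4))) :=
    (isCompact_singleton.prod (isCompact_Icc.prod isCompact_Icc)).image_of_continuousOn
      (hF.smooth.continuousOn.mono fun q hq => hs q hq.2.2)
  convert h1.isClosed using 1
  refine subset_antisymm ?_ (image_mono fun q hq => ⟨hq.1, hq.2.2⟩)
  rintro _ ⟨q, ⟨hx, hθ⟩, rfl⟩
  refine ⟨deck 0 (-⌊q.2.1⌋) q, ⟨?_, ?_, hθ⟩, hF.deck_eq _ _ (hs q hθ)⟩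
  · simp [deck, hx]
  · simp only [deck, mem_Icc, Int.cast_neg]
    exact ⟨by linarith [Int.floor_le q.2.1], by linarith [Int.lt_floor_add_one q.2.1]⟩

theorem IsTorsionMap.closure_image_curveM [T2Space M] (hF : IsTorsionMap ξ F) (hε : 0 < ε) :
    closure (curveM F ε '' (range punctures)ᶜ) =
      F '' {q | q.1 = 0 ∧ q.2.2 ∈ Icc (1 / 4 : ℝ) (3 / 4)} := by
  rw [hF.image_curveM hε]
  refine subset_antisymm (closure_minimal (image_mono fun q hq =>
    ⟨hq.1, Ioo_subset_Icc_self hq.2⟩) hF.isClosed_annulus) ?_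
  have h1 : closure {q : T3 | q.1 = 0 ∧ q.2.2 ∈ Ioo (1 / 4 : ℝ) (3 / 4)} =
      {q | q.1 = 0 ∧ q.2.2 ∈ Icc (1 / 4 : ℝ) (3 / 4)} := by
    have h2 : {q : T3 | q.1 = 0 ∧ q.2.2 ∈ Ioo (1 / 4 : ℝ) (3 / 4)} =
        {0} ×ˢ univ ×ˢ Ioo (1 / 4 : ℝ) (3 / 4) := by ext q; simp
    rw [h2, closure_prod_eq, closure_prod_eq, closure_singleton, closure_univ,
      closure_Ioo (by norm_num)]
    ext q; simp
  rw [← h1]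
  refine ContinuousOn.image_closure (hF.smooth.continuousOn.mono ?_)
  rw [h1]
  exact fun q hq => ⟨by linarith [hq.2.1], by linarith [hq.2.2]⟩

/-- For a representative with `|x| < 1 / 2`, membership in the image of a part of the annulus `x = 0` can
be read off from its coordinates. -/
theorem IsTorsionMap.mem_image_iff (hF : IsTorsionMap ξ F) {s : Set ℝ} (hs : s ⊆ Icc 0 1) {q : T3}
    (hq : q ∈ slab) (hx : |q.1| < 1 / 2) :
    F q ∈ F '' {q | q.1 = 0 ∧ q.2.2 ∈ s} ↔ q.1 = 0 ∧ q.2.2 ∈ s := by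
  constructor
  · rintro ⟨q', ⟨h1, h2⟩, he⟩
    obtain ⟨m, n, h3⟩ := hF.exists_deck (hs h2 : q' ∈ slab) hq he
    rw [h3] at hx ⊢
    simp only [deck, h1, zero_add] at hx ⊢
    refine ⟨?_, h2⟩
    have h4 : |(m : ℝ)| < 1 := by linarith
    have h5 : |m| < 1 := by exact_mod_cast h4
    rw [Int.abs_lt_one_iff.1 h5, Int.cast_zero]
  · exact fun h => ⟨q, h, rfl⟩

namespace IsAdapted

variable [IsManifold (𝓡 3) ∞ M] (hA : IsAdapted ξ F lam ε δ) {φ : ℝ → M → M}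
include hA

theorem iUnion_orbitSet [T2Space M] (hφ : IsFlowOf (reeb lam) φ) :
    (⋃ i, orbitSet φ (F (0, 0, crit i))) = F '' {q | q.1 = 0 ∧ q.2.2 ∈ range crit} := by
  ext r
  simp only [hA.orbitSet_crit hφ, mem_iUnion]
  constructor
  · rintro ⟨i, q, ⟨h1, h2⟩, rfl⟩
    exact ⟨q, ⟨h1, i, h2.symm⟩, rfl⟩
  · rintro ⟨q, ⟨h1, i, h2⟩, rfl⟩
    exact ⟨i, q, ⟨h1, h2.symm⟩, rfl⟩

/-- The closure of the projected curve is a surface, bounded by the asymptotic orbits. -/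
theorem closureHasOrientedBoundary [T2Space M] (hφ : IsFlowOf (reeb lam) φ) :
    ClosureHasOrientedBoundary (reeb lam) (range punctures) (curveM F ε)
      (⋃ i, orbitSet φ (F (0, 0, crit i))) := by
  have hF := hA.torsion
  have hε := hA.eps_pos
  have hIcc : Icc (1 / 4 : ℝ) (3 / 4) ⊆ Icc 0 1 := Icc_subset_Icc (by norm_num) (by norm_num)
  have hcrit : range crit ⊆ Icc (1 / 4 : ℝ) (3 / 4) := by
    rintro _ ⟨i, rfl⟩; exact crit_mem i
  have hcrit' : ∀ θ ∈ range crit, θ = 1 / 4 ∨ θ = 3 / 4 := by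
    rintro _ ⟨i, rfl⟩
    fin_cases i
    · exact Or.inl rfl
    · exact Or.inr rfl
  have h0 : (1 / 4 : ℝ) ∈ range crit := ⟨0, rfl⟩
  have h1 : (3 / 4 : ℝ) ∈ range crit := ⟨1, rfl⟩
  rw [ClosureHasOrientedBoundary, hF.closure_image_curveM hε, hA.iUnion_orbitSet hφ,
    hF.image_curveM hε]
  refine ⟨?_, ?_, ?_⟩
  · rw [← image_union]
    congr 1
    ext q
    simp only [mem_ofPred_eq, mem_union, ← and_or_left]
    refine and_congr_right fun _ => ⟨fun h => ?_, ?_⟩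
    · rcases h.1.eq_or_lt with h2 | h2
      · exact Or.inr (h2 ▸ h0)
      · rcases h.2.eq_or_lt with h3 | h3
        · exact Or.inr (h3 ▸ h1)
        · exact Or.inl ⟨h2, h3⟩
    · rintro (h | h)
      · exact Ioo_subset_Icc_self h
      · exact hcrit h
  · refine hA.disjoint_levels (fun q hq => hIcc (Ioo_subset_Icc_self hq.2))
      (fun q hq => hIcc (hcrit hq.2)) ?_
    rintro q ⟨-, hq⟩ q' ⟨-, hq'⟩ he
    rw [he] at hq
    rcases hcrit' _ hq' with h | h
    · exact absurd hq.1 (by rw [h]; exact lt_irrefl _)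
    · exact absurd hq.2 (by rw [h]; exact lt_irrefl _)
  · rintro _ ⟨q₀, ⟨hx₀, i, hi⟩, rfl⟩
    have hp₀ : q₀.2.2 ∈ Ioo δ (1 - δ) := hi ▸ hA.crit_mem_Ioo i
    have hs₀ := hA.mem_slabInt hp₀
    have hκ := sgn_mul_self i
    set A := flagEquiv (sgn i) hκ with hAdef
    set a : T3 := (0, 0, crit i) with ha
    have hW : {q : T3 | |q.1| < 1 / 2 ∧ |q.2.2 - crit i| < 1 / 8} ∈ 𝓝 q₀ := by
      refine IsOpen.mem_nhds ?_ ?_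
      · exact (isOpen_lt (f := fun q : T3 => |q.1|) (by fun_prop) continuous_const).inter
          (isOpen_lt (f := fun q : T3 => |q.2.2 - crit i|) (by fun_prop) continuous_const)
      · simp [hx₀, ← hi]
    obtain ⟨e, he, hes, hloc, -⟩ := hF.exists_shifted_chart A a hs₀ hW
    have e0 : ∀ q : T3, A.symm (q - a) 0 = -(sgn i * (q.2.2 - crit i)) := fun q => rfl
    have e2 : ∀ q : T3, A.symm (q - a) 2 = q.1 - 0 := fun q => rfl
    refine ⟨e, hes, ⟨he, ?_⟩, ?_, ?_⟩
    · intro r hr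
      obtain ⟨q, ⟨⟨hq1, hq2⟩, hqs⟩, rfl, her, -⟩ := hloc r hr
      have hqs' := slabInt_subset_slab hqs
      rw [hF.mem_image_iff hIcc hqs' hq1, hF.mem_image_iff (hcrit.trans hIcc) hqs' hq1, her, e0, e2,
        sub_zero]
      rw [abs_lt] at hq2
      constructor
      · rw [and_comm]
        refine and_congr_left fun _ => ?_
        fin_cases i
        · simp only [crit, sgn] at hq2 ⊢
          norm_num at hq2 ⊢
          intro; linarith
        · simp only [crit, sgn] at hq2 ⊢
          norm_num at hq2 ⊢
          intro; linarith
      · rw [and_comm]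
        refine and_congr_left fun _ => ⟨fun h => ?_, fun h => ⟨i, ?_⟩⟩
        · have h2 : q.2.2 = crit i := by
            have h3 := hcrit' _ h
            fin_cases i
            · simp only [crit] at hq2 ⊢
              norm_num at hq2 ⊢
              rcases h3 with h | h
              · linarith
              · linarith
            · simp only [crit] at hq2 ⊢
              norm_num at hq2 ⊢
              rcases h3 with h | h
              · linarith
              · linarith
          rw [h2]; simp
        · have h2 : sgn i * (sgn i * (q.2.2 - crit i)) = 0 := by
            rw [neg_eq_zero.1 h, mul_zero]
          rw [← mul_assoc, hκ, one_mul] at h2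
          linarith
    · intro b ζ hζ hζe D
      have hζ0 := sphereCoord_notMem.1 hζ
      obtain ⟨w, c, hw, hc, -, hM, -, hD⟩ := hF.exists_curveD ε b hζ0
      obtain ⟨q, ⟨-, hqs⟩, hFq, her, hev⟩ := hloc _ hζe
      have hpw : curveM F ε (sphereCoord b ζ) = F (strip ε w) :=
        (congrArg (curveM F ε) hw).trans (hF.curveM_exp ε w)
      obtain ⟨m, n, hdk⟩ := hF.exists_deck (strip_mem_slab ε w) (slabInt_subset_slab hqs)
        (hpw.symm.trans hFq.symm)
      have hraw : rawD F q = rawD F (strip ε w) := by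
        rw [hdk, hF.rawD_deck m n (strip_mem_slabInt ε w)]
      have hDv : ∀ v : ℂ, D v = A.symm (stripD ε w.re (c * v)) := by
        intro v
        have h2 : MDifferentiableAt (𝓡 3) 𝓘(ℝ, E3) e (curveM F ε (sphereCoord b ζ)) :=
          (contMDiffAt_of_mem_maximalAtlas he hζe).mdifferentiableAt (by simp)
        have h3 := mfderiv_comp (f := fun ζ => curveM F ε (sphereCoord b ζ)) ζ h2
          (hM.mdifferentiableAt (by simp))
        rw [mfderiv_eq_fderiv] at h3
        have h4 := congrArg (fun T : ℂ →L[ℝ] E3 => T v) h3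
        refine h4.trans ?_
        have key : ∀ (p : M) (V : E3), p = F q → V = rawD F q (stripD ε w.re (c * v)) →
            chartD e p V = A.symm (stripD ε w.re (c * v)) := by
          rintro p V rfl rfl
          exact hF.chartD_rawD hqs he hev _
        exact key _ _ hFq.symm (by rw [hraw]; exact hD v)
      have hc0 : 0 < c.re * c.re + c.im * c.im := by
        rw [← Complex.normSq_apply, Complex.normSq_pos, ← norm_ne_zero_iff, hc]
        exact inv_ne_zero (norm_ne_zero_iff.2 hζ0)
      have hang := angD_neg hε w.re
      have hcoord : ∀ v : ℂ, D v 0 = -(sgn i * (angD ε w.re * (c * v).re)) ∧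
          D v 1 = sgn i * ((c * v).im / (2 * Real.pi)) := by
        intro v
        rw [hDv, stripD_apply]
        exact ⟨rfl, rfl⟩
      rw [(hcoord 1).1, (hcoord 1).2, (hcoord Complex.I).1, (hcoord Complex.I).2]
      have h5 : -(sgn i * (angD ε w.re * (c * 1).re)) * (sgn i * ((c * Complex.I).im / (2 * Real.pi))) -
          sgn i * ((c * 1).im / (2 * Real.pi)) * -(sgn i * (angD ε w.re * (c * Complex.I).re)) =
          (sgn i * sgn i) * (-angD ε w.re) * (c.re * c.re + c.im * c.im) / (2 * Real.pi) := by
        simp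
        ring
      rw [h5, hκ, one_mul]
      have : 0 < -angD ε w.re := neg_pos.2 hang
      positivity
    · obtain ⟨q, ⟨-, hqs⟩, hFq, -, hev⟩ := hloc _ hes
      have hθ : q.2.2 = crit i :=
        (hF.theta_eq (slabInt_subset_slab hqs) (slabInt_subset_slab hs₀) hFq).trans hi.symm
      have h2 : reeb lam (F q) = rawD F q (0, sgn i / ε, 0) := by
        rw [hA.reeb_eq (hθ ▸ hA.crit_mem_Ioo i), hθ, hA.velX_crit, hA.velY_crit]
      have h3 : chartD e (F q) (reeb lam (F q)) = A.symm (0, sgn i / ε, 0) := by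
        have h4 := hF.chartD_rawD hqs he hev (0, sgn i / ε, 0)
        rw [← h2] at h4
        exact h4
      rw [← hFq, h3]
      change 0 < sgn i * (sgn i / ε)
      rw [← mul_div_assoc, hκ]
      positivity

end IsAdapted
end Closure

end ContactThree

end

theorem proposition3p1 {M : Type*} [TopologicalSpace M] [T2Space M] [CompactSpace M]
    [ChartedSpace ContactThree.E3 M] [IsManifold (𝓡 3) ∞ M]
    (ξ : ∀ p : M, Submodule ℝ (TangentSpace (𝓡 3) p))
    (hξ : ContactThree.IsContactStructure ξ)
    (htor : ContactThree.HasGirouxTorsion ξ) :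
    ContactThree.PropertyStar ξ := by
  open ContactThree in
  obtain ⟨F, hF1, hF2, hF3, hF4⟩ := htor
  obtain ⟨ε, δ, lam, hA, hper⟩ := (IsTorsionMap.mk hF1 hF2 hF3 hF4).exists_adapted hξ
  obtain ⟨φ, hφ⟩ := exists_isFlowOf (isSmoothField_reeb hA.contact.1)
  obtain ⟨j, hj, hjF⟩ := hA.exists_compatible
  have hIcc : ∀ i, crit i ∈ Icc (0 : ℝ) 1 := fun i =>
    ⟨by linarith [(crit_mem i).1], by linarith [(crit_mem i).2]⟩
  have hlev : ∀ i, {q : T3 | q.2.2 = crit i} ⊆ slab := fun i q hq => by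
    change q.2.2 ∈ Icc (0 : ℝ) 1
    rw [show q.2.2 = crit i from hq]
    exact hIcc i
  have horb : ∀ i, orbitSet φ (F (0, 0, crit i)) ⊆ F '' {q | q.2.2 = crit i} := fun i => by
    rw [hA.orbitSet_crit hφ]
    exact image_mono fun q hq => hq.2
  have hdisj : ∀ i i', i ≠ i' → Disjoint (F '' {q | q.2.2 = crit i}) (F '' {q | q.2.2 = crit i'}) :=
    fun i i' hne => hA.disjoint_levels (hlev i) (hlev i') fun q hq q' hq' he =>
      hne (crit_injective ((show q.2.2 = crit i from hq).symm.trans (he.trans hq')))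
  refine ⟨lam, reeb lam, φ, j, 2, punctures, curveR ε, curveM F ε, fun i => F (0, 0, crit i),
    fun _ => ε, fun i => F '' {q | q.2.2 = crit i}, fun _ => 2, hA.contact,
    isReebField_reeb hA.contact.1, hφ, hj, punctures_injective, hA.isFiniteEnergyCurve hjF,
    fun i => ⟨(hA.isPeriodicOrbit_crit hφ i).1, (hA.isPeriodicOrbit_crit hφ i).2,
      hA.isAsymptotic hφ i⟩,
    hA.torsion.isEmbeddedOn_curveM hA.eps_pos,
    fun i i' hne => (hdisj i i' hne).mono (horb i) (horb i'),
    hA.closureHasOrientedBoundary hφ, fun i => ⟨hA.isMorseBott hφ i, _, rfl, rfl⟩, ?_, ?_, ?_⟩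
  · intro q T' hq hN
    rw [Fin.sum_univ_two, ← two_mul]
    refine (hper φ hφ q T' hq.1 hq.2).resolve_left ?_
    rintro ⟨q', h | h, rfl⟩
    · exact hN 0 ⟨⟨q', h, rfl⟩, hA.flow_eq_self_of_mem hφ 0 ⟨q', h, rfl⟩ hq.2⟩
    · exact hN 1 ⟨⟨q', h, rfl⟩, hA.flow_eq_self_of_mem hφ 1 ⟨q', h, rfl⟩ hq.2⟩
  · -- the orbits in the critical tori are degenerate
    intro i hnd
    exact absurd hnd (hA.not_isNondegenerate hφ i rfl)
  · intro i _ _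
    exact ⟨hA.torsion.nonempty_homeomorph_torus (hIcc i),
      fun i' hne => (hdisj i' i hne).mono_left (horb i')⟩
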